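/- Let $n\in\mathbb N$ and let $\alpha_0,\alpha_1$ be hermitian complex $n\times n$ matrices with $\alpha_0^2=\alpha_1^2=\mathbb 1$ and $\alpha_0\alpha_1+\alpha_1\alpha_0=0$. Let $V\in C^\infty(\mathbb R,\mathbb R)$ be such that every derivative $V^{(k)}$, $k\ge 0$, is bounded on $\mathbb R$ and, for some $\delta\in(0,1)$, $-1+\delta\le V(x)\le-\delta$ for all $x\in\mathbb R$. For $h\in(0,1]$ consider in $L^2(\mathbb R,\mathbb C^n)$ the Dirac operator $$D_{h,V}=-ih\,\alpha_1\frac{d}{dx}+\alpha_0+V$$ with domain $H^1(\mathbb R,\mathbb C^n)$. Then $D_{h,V}$ has a bounded inverse, whose distribution kernel $D_{h,V}^{-1}(x,y)$ is a smooth matrix-valued function away from the diagonal $x=y$. Let $x,y\in\mathbb R$, $x\neq y$, let $\tau>0$, and let $(\gamma,\omega):[0,\tau]\to\mathbb R\times(-1,1)$ be a smooth solution of Hamilton's equations $\dot\gamma=\partial_pH(\gamma,\omega)$, $\dot\omega=-\partial_xH(\gamma,\omega)$ for $H(x,p)=-\sqrt{1-p^2}-V(x)$, such that $H(\gamma(t),\omega(t))=0$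 for all $t\in[0,\tau]$, $\gamma(0)=y$ and $\gamma(\tau)=x$. Put $$\vartheta(\tau)=\int_0^\tau\frac{V'(\gamma(t))}{2V(\gamma(t))}\,dt,\qquad \Lambda^+(\zeta)=\frac12\mathbb 1+\frac12\,\frac{\zeta\alpha_1+\alpha_0}{\sqrt{1+\zeta^2}}\quad(\zeta\in\mathbb C,\ |\operatorname{Im}\zeta|<1),$$ where $\sqrt{\cdot}$ is the principal branch, and $$M=\big(\cos(\vartheta(\tau))\,\mathbb 1-i\sin(\vartheta(\tau))\,\alpha_1\big)\,(-V(y))\,\Lambda^+(i\omega(0)).$$ Then, for $h\in(0,1]$, $$D_{h,V}^{-1}(x,y)=\frac1h\cdot\frac{\exp\big(-\big|\int_y^x\sqrt{1-V^2(t)}\,dt\big|\big/h\big)}{(1-V^2(x))^{1/4}\,(1-V^2(y))^{1/4}}\;\big(M+R(h)\big),$$ where the matrix-valued remainder satisfies $R(h)=O(h)$ as $h\searrow0$ and has a complete asymptotic expansion in powers of $h$: there are $n\times n$ matrices $C_1,C_2,\dots$, independent of $h$, with $R(h)=\sum_{k=1}^N h^kC_k+O(h^{N+1})$ as $h\searrow0$,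 for every $N$. -/

import Mathlib

open MeasureTheory Set Filter Topology Asymptotics
open scoped ContDiff

noncomputable section

/-- The fibre `ℂⁿ` with its Euclidean norm. -/
abbrev Spinor (n : ℕ) : Type := EuclideanSpace ℂ (Fin n)

/-- The Hilbert space `L²(ℝ, ℂⁿ)`. -/
abbrev SpinorL2 (n : ℕ) : Type := Lp (Spinor n) 2 (volume : Measure ℝ)

/-- Action of a matrix on `ℂⁿ`. -/
def matAct {n : ℕ} (A : Matrix (Fin n) (Fin n) ℂ) (v : Spinor n) : Spinor n :=
  WithLp.toLp 2 (A.mulVec v.ofLp)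

/-- Dirac matrices in one space dimension: hermitian matrices with
`{α_k, α_l} = 2 δ_{kl} 1` for `k, l ∈ {0, 1}`. -/
structure IsDiracMatrices {n : ℕ} (α : Fin 2 → Matrix (Fin n) (Fin n) ℂ) : Prop where
  hermitian : ∀ k, (α k).IsHermitian
  clifford : ∀ k l, α k * α l + α l * α k = if k = l then 2 else 0

/-- The standing assumption on the potential: `V` is smooth and real-valued, every derivative
of `V` (including `V` itself) is bounded, and `-1 + δ ≤ V ≤ -δ` for some `δ ∈ (0, 1)`. -/
structure IsAdmissiblePotential (V : ℝ → ℝ) : Prop where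
  smooth : ContDiff ℝ ∞ V
  bounded : ∀ k : ℕ, ∃ C : ℝ, ∀ x, |iteratedDeriv k V x| ≤ C
  gap : ∃ δ ∈ Ioo (0 : ℝ) 1, ∀ x, -1 + δ ≤ V x ∧ V x ≤ -δ

/-- `w ∈ L²` is the weak derivative of `u ∈ L²`, so that `u ∈ H¹(ℝ, ℂⁿ)`. -/
def IsWeakDeriv {n : ℕ} (u w : SpinorL2 n) : Prop :=
  ∀ φ : ℝ → ℝ, ContDiff ℝ ∞ φ → HasCompactSupport φ →
    ∫ x, deriv φ x • u x = - ∫ x, φ x • w x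

/-- The graph of the Dirac operator `D_{h,V} = α₁ (-i h d/dx) + α₀ + V` with domain
`H¹(ℝ, ℂⁿ)` in `L²(ℝ, ℂⁿ)`: `u` is in the domain and `D_{h,V} u = f`. -/
def DiracGraph {n : ℕ} (α : Fin 2 → Matrix (Fin n) (Fin n) ℂ) (V : ℝ → ℝ) (h : ℝ)
    (u f : SpinorL2 n) : Prop :=
  ∃ w : SpinorL2 n, IsWeakDeriv u w ∧
    ∀ᵐ x : ℝ, f x = (-(Complex.I * (h : ℂ))) • matAct (α 1) (w x) + matAct (α 0) (u x)
      + (V x : ℂ) • u x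

/-- `T` is the bounded, everywhere defined inverse of `D_{h,V} : H¹ → L²`. -/
def IsDiracInverse {n : ℕ} (α : Fin 2 → Matrix (Fin n) (Fin n) ℂ) (V : ℝ → ℝ) (h : ℝ)
    (T : SpinorL2 n →L[ℂ] SpinorL2 n) : Prop :=
  (∀ f, DiracGraph α V h (T f) f) ∧ ∀ u f, DiracGraph α V h u f → T f = u

/-- Away from the diagonal the distribution kernel of `T` is the smooth matrix-valued function
`K`: one has `⟨g, T f⟩ = ∬ ⟨g(x), K(x, y) f(y)⟩ dy dx` for all test functions `f`, `g` with
disjoint supports. The values `K x x` play no role. -/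
structure IsOffDiagonalKernel {n : ℕ} (T : SpinorL2 n →L[ℂ] SpinorL2 n)
    (K : ℝ → ℝ → Matrix (Fin n) (Fin n) ℂ) : Prop where
  smooth : ∀ i j, ContDiffOn ℝ ∞ (fun p : ℝ × ℝ => K p.1 p.2 i j) {p | p.1 ≠ p.2}
  kernel : ∀ f g : ℝ → Spinor n, ContDiff ℝ ∞ f → ContDiff ℝ ∞ g →
    HasCompactSupport f → HasCompactSupport g → Disjoint (tsupport f) (tsupport g) →
    ∀ F : SpinorL2 n, F =ᵐ[volume] f →
      ∫ x, inner ℂ (g x) (T F x) = ∫ x, ∫ y, inner ℂ (g x) (matAct (K x y) (f y))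

/-- `K` is the Green kernel `(x, y) ↦ D_{h,V}⁻¹(x, y)`, `x ≠ y`. -/
def IsGreenKernel {n : ℕ} (α : Fin 2 → Matrix (Fin n) (Fin n) ℂ) (V : ℝ → ℝ) (h : ℝ)
    (K : ℝ → ℝ → Matrix (Fin n) (Fin n) ℂ) : Prop :=
  ∃ T : SpinorL2 n →L[ℂ] SpinorL2 n, IsDiracInverse α V h T ∧ IsOffDiagonalKernel T K

/-- The Hamilton function `H(x, p) = -√(1 - p²) - V(x)`, for `|p| < 1`. -/
def hamiltonian (V : ℝ → ℝ) (x p : ℝ) : ℝ := -√(1 - p ^ 2) - V x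

/-- `(γ, ϖ) : [0, τ] → ℝ²` is a smooth solution of Hamilton's equations for `H`, with values
in `|p| < 1`, on the zero energy level, running from `γ(0) = y` to `γ(τ) = x`. -/
structure IsZeroEnergyTrajectory (V : ℝ → ℝ) (τ : ℝ) (γ ϖ : ℝ → ℝ) (y x : ℝ) : Prop where
  pos : 0 < τ
  smooth_pos : ContDiffOn ℝ ∞ γ (Icc 0 τ)
  smooth_mom : ContDiffOn ℝ ∞ ϖ (Icc 0 τ)
  mom_lt : ∀ t ∈ Icc 0 τ, |ϖ t| < 1
  deriv_pos : ∀ t ∈ Icc 0 τ,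
    HasDerivWithinAt γ (deriv (fun p => hamiltonian V (γ t) p) (ϖ t)) (Icc 0 τ) t
  deriv_mom : ∀ t ∈ Icc 0 τ,
    HasDerivWithinAt ϖ (-deriv (fun q => hamiltonian V q (ϖ t)) (γ t)) (Icc 0 τ) t
  energy : ∀ t ∈ Icc 0 τ, hamiltonian V (γ t) (ϖ t) = 0
  start : γ 0 = y
  finish : γ τ = x

/-- `S(ζ) = (ζ α₁ + α₀) / √(1 + ζ²)`, with the principal branch of the square root. -/
def symbolS {n : ℕ} (α : Fin 2 → Matrix (Fin n) (Fin n) ℂ) (ζ : ℂ) :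
    Matrix (Fin n) (Fin n) ℂ :=
  ((1 + ζ ^ 2) ^ (1 / 2 : ℂ))⁻¹ • (ζ • α 1 + α 0)

/-- The projection `Λ⁺(ζ) = (1 + S(ζ)) / 2`, for `|Im ζ| < 1`. -/
def projPlus {n : ℕ} (α : Fin 2 → Matrix (Fin n) (Fin n) ℂ) (ζ : ℂ) :
    Matrix (Fin n) (Fin n) ℂ :=
  (1 / 2 : ℂ) • (1 : Matrix (Fin n) (Fin n) ℂ) + (1 / 2 : ℂ) • symbolS α ζ

/-- The angle `ϑ(τ) = ∫₀^τ V'(γ(t)) / (2 V(γ(t))) dt`. -/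
def spinAngle (V : ℝ → ℝ) (γ : ℝ → ℝ) (τ : ℝ) : ℝ :=
  ∫ t in (0 : ℝ)..τ, deriv V (γ t) / (2 * V (γ t))

/-- The leading matrix `(cos ϑ(τ) 1 - i sin ϑ(τ) α₁) (-V(y)) Λ⁺(i ϖ(0))`. -/
def leadingMatrix {n : ℕ} (α : Fin 2 → Matrix (Fin n) (Fin n) ℂ) (V : ℝ → ℝ) (γ ϖ : ℝ → ℝ)
    (τ y : ℝ) : Matrix (Fin n) (Fin n) ℂ :=
  ((Real.cos (spinAngle V γ τ) : ℂ) • (1 : Matrix (Fin n) (Fin n) ℂ)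
      - (Complex.I * (Real.sin (spinAngle V γ τ) : ℂ)) • α 1)
    * (((-V y : ℝ) : ℂ) • projPlus α (Complex.I * (ϖ 0 : ℂ)))

/-- The scalar factor
`h⁻¹ exp(-|∫_y^x √(1 - V²)| / h) / ((1 - V(x)²)^{1/4} (1 - V(y)²)^{1/4})`. -/
def scalarFactor (V : ℝ → ℝ) (x y h : ℝ) : ℝ :=
  1 / h * Real.exp (-|∫ t in y..x, √(1 - V t ^ 2)| / h)
    / ((1 - V x ^ 2) ^ (1 / 4 : ℝ) * (1 - V y ^ 2) ^ (1 / 4 : ℝ))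

/-- The matrix-valued function `R(h)` is `O(h)` as `h ↓ 0` and has a complete asymptotic
expansion `R(h) ∼ ∑_{k ≥ 1} h^k C_k` in powers of `h`. -/
def HasCompleteExpansion {n : ℕ} (R : ℝ → Matrix (Fin n) (Fin n) ℂ) : Prop :=
  (∀ i j, (fun h : ℝ => R h i j) =O[𝓝[>] 0] fun h : ℝ => h) ∧
  ∃ C : ℕ → Matrix (Fin n) (Fin n) ℂ, ∀ N : ℕ, ∀ i j,
    (fun h : ℝ => (R h - ∑ k ∈ Finset.Icc 1 N, ((h ^ k : ℝ) : ℂ) • C k) i j)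
      =O[𝓝[>] 0] fun h : ℝ => h ^ (N + 1)

end

/-! The relations `α₀² = α₁² = 1`, `α₀ α₁ = - α₁ α₀` make every complex combination of `1`, `α₀`,
`i α₁` and `i α₀ α₁` behave like a `2 × 2` matrix, and in this realisation `D_{h,V} u = 0` becomes,
with `W = -V ∈ [δ, 1 - δ]`, the real system `h a' = -a + W b`, `h b' = -W a + b`. The quotient
`r = b / a` of the components of a solution satisfies the Riccati equation `h r' = 2 r - W - W r²`,
whose zeroth-order approximation is the small root `r₀ = (1 - √(1 - W²)) / W`.

The Riccati equation is repelling near `r₀`. Hence it has a solution with `|r| ≤ 1 - δ`, the fixed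
point of a contraction (`exists_isRiccatiSolution`), and any approximate solution in that range is
as close to `r` as its residual (`abs_le_of_unstable`). Comparing `r` with the formal power series
solution gives its complete expansion in powers of `h`, uniformly in `x`, and with it that of
`∫ W (r - r₀) / h` (`IsGapFunction.hasPowerExpansion_riccati`,
`IsGapFunction.hasPowerExpansion_exponent`).

From `r` one gets a zero mode `a = exp (∫ (W r - 1) / h)`, `b = r a` decaying at `+∞`, and from the
solution for the reflected potential a mode decaying at `-∞`. Their products, divided by the
Wronskian, form the Green kernel (`IsGreenPair.isGreenKernel`): it solves `D_{h,V} u = f` for test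
functions `f`, and the coercivity bound `‖D_{h,V} u‖ ≥ δ ‖u‖`, valid because `|V| ≤ 1 - δ`, extends
this to a bounded inverse on `L²`. Since the off-diagonal kernel of an operator is unique
(`IsOffDiagonalKernel.eq_of_ne`), its asymptotics may be read off from the modes. As
`W r₀ - 1 = -√(1 - W²)`, the exponential factor of the theorem splits off exactly, and the rest is a
sum, product, exponential and inverse of functions with complete expansions.

For the leading term put `a = arctan (r₀ x)`, `b = arctan (r₀ y)`, so that `W = sin 2a` at `x` and
`W = sin 2b` at `y`. The amplitude is `cos a cos b` (`IsGapFunction.amplitude_eq`). On the energy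
level zero `√(1 - ω²) = W` along the trajectory, so `ω = ± √(1 - W²)` with constant sign, equal to
the sign of `x - y`, and `ϑ(τ) = ± (a - b)` (`IsZeroEnergyTrajectory.exists_sign`). The addition
theorems then turn the limit of the kernel into the matrix `M` of the theorem
(`leadingMatrix_eq`). -/

/-! ### Asymptotic power series at `0⁺` -/

/-- `f : ℝ → ℝ` tends to `a` at `0⁺` and is approximated to every order by polynomials. The
polynomials are not required to be compatible with each other: compatibility is automatic, see
`HasPowerExpansion.exists_coeff`. -/
structure HasPowerExpansion (f : ℝ → ℝ) (a : ℝ) : Prop where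
  tendsto : Tendsto f (𝓝[>] 0) (𝓝 a)
  approx : ∀ N : ℕ, ∃ p : Polynomial ℝ, (fun h => f h - p.eval h) =O[𝓝[>] 0] fun h => h ^ N

namespace HasPowerExpansion

variable {f g : ℝ → ℝ} {a b : ℝ}

theorem id_isBigO_one : (fun h : ℝ => h) =O[𝓝[>] 0] fun _ => (1 : ℝ) := by
  have : Tendsto (fun h : ℝ => h) (𝓝[>] 0) (𝓝 0) := tendsto_nhdsWithin_of_tendsto_nhds tendsto_id
  exact this.isBigO_one ℝ

theorem pow_isBigO_pow {m n : ℕ} (hmn : m ≤ n) :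
    (fun h : ℝ => h ^ n) =O[𝓝[>] 0] fun h => h ^ m := by
  obtain ⟨k, rfl⟩ := Nat.exists_eq_add_of_le hmn
  simpa [pow_add] using (isBigO_refl (fun h : ℝ => h ^ m) (𝓝[>] 0)).mul (id_isBigO_one.pow k)

theorem eval_tendsto (p : Polynomial ℝ) :
    Tendsto (fun h => p.eval h) (𝓝[>] 0) (𝓝 (p.eval 0)) :=
  tendsto_nhdsWithin_of_tendsto_nhds (p.continuous.tendsto 0)

theorem eval_isBigO_one (p : Polynomial ℝ) :
    (fun h => p.eval h) =O[𝓝[>] 0] fun _ => (1 : ℝ) :=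
  (eval_tendsto p).isBigO_one ℝ

theorem isBigO_one (hf : HasPowerExpansion f a) : f =O[𝓝[>] 0] fun _ => (1 : ℝ) :=
  hf.tendsto.isBigO_one ℝ

theorem of_polynomial (p : Polynomial ℝ) : HasPowerExpansion (fun h => p.eval h) (p.eval 0) :=
  ⟨eval_tendsto p, fun _ => ⟨p, by simpa using isBigO_zero _ _⟩⟩

theorem const (a : ℝ) : HasPowerExpansion (fun _ => a) a := by
  simpa using of_polynomial (Polynomial.C a)

theorem add (hf : HasPowerExpansion f a) (hg : HasPowerExpansion g b) :
    HasPowerExpansion (fun h => f h + g h) (a + b) :=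
  ⟨hf.tendsto.add hg.tendsto, fun N => by
    obtain ⟨p, hp⟩ := hf.approx N
    obtain ⟨q, hq⟩ := hg.approx N
    refine ⟨p + q, (hp.add hq).congr_left fun h => ?_⟩
    simp only [Polynomial.eval_add]; ring⟩

theorem mul (hf : HasPowerExpansion f a) (hg : HasPowerExpansion g b) :
    HasPowerExpansion (fun h => f h * g h) (a * b) :=
  ⟨hf.tendsto.mul hg.tendsto, fun N => by
    obtain ⟨p, hp⟩ := hf.approx N
    obtain ⟨q, hq⟩ := hg.approx N
    refine ⟨p * q, ?_⟩
    have h1 := hp.mul hg.isBigO_one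
    have h2 := (eval_isBigO_one p).mul hq
    simp only [mul_one, one_mul] at h1 h2
    refine (h1.add h2).congr_left fun h => ?_
    simp only [Polynomial.eval_mul]; ring⟩

theorem const_mul (c : ℝ) (hf : HasPowerExpansion f a) :
    HasPowerExpansion (fun h => c * f h) (c * a) := (const c).mul hf

theorem sub (hf : HasPowerExpansion f a) (hg : HasPowerExpansion g b) :
    HasPowerExpansion (fun h => f h - g h) (a - b) := by
  simpa [sub_eq_add_neg] using hf.add (hg.const_mul (-1))

theorem pow (hf : HasPowerExpansion f a) (n : ℕ) :
    HasPowerExpansion (fun h => f h ^ n) (a ^ n) := by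
  induction n with
  | zero => simpa using const 1
  | succ n ih => simpa [pow_succ] using ih.mul hf

theorem sum {ι : Type*} (s : Finset ι) {F : ι → ℝ → ℝ} {A : ι → ℝ}
    (hF : ∀ i ∈ s, HasPowerExpansion (F i) (A i)) :
    HasPowerExpansion (fun h => ∑ i ∈ s, F i h) (∑ i ∈ s, A i) := by
  classical
  induction s using Finset.induction_on with
  | empty => simpa using const 0
  | insert i s hi ih =>
    simp only [Finset.sum_insert hi]
    exact (hF i (by simp)).add (ih fun j hj => hF j (by simp [hj]))

/-- The value of an approximating polynomial at `0` is the limit. -/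
theorem eval_zero_eq (hf : HasPowerExpansion f a) {N : ℕ} {p : Polynomial ℝ}
    (hp : (fun h => f h - p.eval h) =O[𝓝[>] 0] fun h => h ^ (N + 1)) : p.eval 0 = a := by
  have h0 : Tendsto (fun h : ℝ => h ^ (N + 1)) (𝓝[>] 0) (𝓝 0) := by
    have : Tendsto (fun h : ℝ => h ^ (N + 1)) (𝓝 0) (𝓝 (0 ^ (N + 1))) :=
      (continuous_pow (N + 1)).tendsto 0
    simpa using tendsto_nhdsWithin_of_tendsto_nhds this
  have h1 := hp.trans_tendsto h0
  have h2 := hf.tendsto.sub h1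
  simp only [sub_sub_cancel, sub_zero] at h2
  exact tendsto_nhds_unique (eval_tendsto p) h2

/-- A function with an expansion and limit `0` can be divided by `h`. -/
theorem div_id (hf : HasPowerExpansion f 0) : ∃ b, HasPowerExpansion (fun h => f h / h) b := by
  have key : ∀ N, ∃ p : Polynomial ℝ, (fun h => f h / h - p.eval h) =O[𝓝[>] 0] fun h => h ^ N := by
    intro N
    obtain ⟨p, hp⟩ := hf.approx (N + 1)
    have h0 := hf.eval_zero_eq hp
    refine ⟨p.divX, ?_⟩
    have h1 : (fun h => (f h - p.eval h) * h⁻¹) =O[𝓝[>] 0] fun h => h ^ (N + 1) * h⁻¹ :=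
      hp.mul (isBigO_refl _ _)
    refine h1.congr' ?_ ?_
    · filter_upwards [self_mem_nhdsWithin] with h (hh : 0 < h)
      have : p.eval h = p.divX.eval h * h := by
        conv_lhs => rw [← p.divX_mul_X_add]
        simp [Polynomial.coeff_zero_eq_eval_zero, h0]
      rw [this]; field_simp
    · filter_upwards [self_mem_nhdsWithin] with h (hh : 0 < h)
      field_simp; ring
  obtain ⟨p, hp⟩ := key 1
  refine ⟨p.eval 0, ?_, key⟩
  have h0 : Tendsto (fun h : ℝ => h ^ 1) (𝓝[>] 0) (𝓝 0) := by
    simp only [pow_one]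
    exact tendsto_nhdsWithin_of_tendsto_nhds tendsto_id
  simpa using (hp.trans_tendsto h0).add (eval_tendsto p)

theorem sub_limit_isBigO_pow (hf : HasPowerExpansion f a) (N : ℕ) :
    (fun h => (f h - a) ^ N) =O[𝓝[>] 0] fun h => h ^ N := by
  have h0 := hf.sub (const a)
  rw [sub_self] at h0
  obtain ⟨b, hb⟩ := h0.div_id
  have h1 := (hb.isBigO_one.mul (isBigO_refl (fun h : ℝ => h) (𝓝[>] 0))).pow N
  refine h1.congr' ?_ ?_
  · filter_upwards [self_mem_nhdsWithin] with h (hh : 0 < h)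
    field_simp
  · simp

/-- Substitution into a function with a Taylor expansion: if `φ (f h)` is approximated to every
order by finite sums `∑ c k (f h - a) ^ k`, it has an expansion. -/
theorem of_series {φ : ℝ → ℝ} (hf : HasPowerExpansion f a) (hφ : ContinuousAt φ a) (c : ℕ → ℝ)
    (h : ∀ N, (fun h => φ (f h) - ∑ k ∈ Finset.range N, c k * (f h - a) ^ k)
      =O[𝓝[>] 0] fun h => (f h - a) ^ N) :
    HasPowerExpansion (fun h => φ (f h)) (φ a) := by
  refine ⟨hφ.tendsto.comp hf.tendsto, fun N => ?_⟩
  have h1 := sum (Finset.range N) (F := fun k h => c k * (f h - a) ^ k)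
    fun k _ => ((hf.sub (const a)).pow k).const_mul (c k)
  obtain ⟨p, hp⟩ := h1.approx N
  exact ⟨p, (((h N).trans (hf.sub_limit_isBigO_pow N)).add hp).congr_left fun _ => by ring⟩

theorem exp (hf : HasPowerExpansion f a) :
    HasPowerExpansion (fun h => Real.exp (f h)) (Real.exp a) := by
  refine hf.of_series Real.continuous_exp.continuousAt (fun k => Real.exp a / k.factorial)
    fun N => ?_
  have h0 : Tendsto (fun h => f h - a) (𝓝[>] 0) (𝓝 0) := by
    simpa using hf.tendsto.sub_const a
  have h1 := ((Real.exp_sub_sum_range_isBigO_pow N).comp_tendsto h0).const_mul_left (Real.exp a)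
  refine h1.congr_left fun h => ?_
  simp only [Function.comp, mul_sub, Finset.mul_sum, ← Real.exp_add, add_sub_cancel]
  congr 1
  exact Finset.sum_congr rfl fun k _ => by ring

theorem inv (hf : HasPowerExpansion f a) (ha : a ≠ 0) :
    HasPowerExpansion (fun h => (f h)⁻¹) a⁻¹ := by
  refine hf.of_series (φ := fun x => x⁻¹) (continuousAt_inv₀ ha)
    (fun k => (-1) ^ k * (a⁻¹) ^ (k + 1)) fun N => ?_
  have h1 : (fun h => (f h)⁻¹ * (-a⁻¹) ^ N * (f h - a) ^ N) =O[𝓝[>] 0]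
      fun h => 1 * (f h - a) ^ N :=
    (((hf.tendsto.inv₀ ha).mul_const _).isBigO_one ℝ).mul (isBigO_refl _ _)
  simp only [one_mul] at h1
  refine h1.congr' ?_ EventuallyEq.rfl
  filter_upwards [hf.tendsto.eventually_ne ha] with h hh
  clear h1
  induction N with
  | zero => simp
  | succ N ih =>
    rw [Finset.sum_range_succ, ← sub_sub, ← ih, pow_succ _ N, pow_succ _ N, pow_succ a⁻¹ N,
      neg_pow]
    field_simp
    ring

/-- Compatible coefficients exist: a function with approximating polynomials of every order has an
asymptotic power series. -/
theorem exists_coeff (hf : HasPowerExpansion f a) :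
    ∃ c : ℕ → ℝ, c 0 = a ∧ ∀ N : ℕ, (fun h => f h - ∑ k ∈ Finset.range (N + 1), c k * h ^ k)
      =O[𝓝[>] 0] fun h => h ^ (N + 1) := by
  -- `F k` is the `k`-th remainder divided by `h ^ k`, and `c k` its limit.
  let S := {F : (ℝ → ℝ) × ℝ // HasPowerExpansion F.1 F.2}
  have step : ∀ F : S, ∃ G : S, ∀ h, G.1.1 h = (F.1.1 h - F.1.2) / h := by
    rintro ⟨⟨F, b⟩, hF⟩
    have hF' := hF.sub (const b)
    rw [sub_self] at hF'
    obtain ⟨b', hb'⟩ := hF'.div_id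
    exact ⟨⟨(_, b'), hb'⟩, fun h => rfl⟩
  choose next hnext using step
  let F : ℕ → S := fun k => next^[k] ⟨(f, a), hf⟩
  have hF : ∀ k h, (F (k + 1)).1.1 h = ((F k).1.1 h - (F k).1.2) / h := by
    intro k h
    simp only [F, Function.iterate_succ_apply']
    exact hnext _ h
  have hrem : ∀ N h, h ≠ 0 →
      f h - ∑ k ∈ Finset.range N, (F k).1.2 * h ^ k = h ^ N * (F N).1.1 h := by
    intro N h hh
    induction N with
    | zero => simp [F]
    | succ N ih =>
      rw [Finset.sum_range_succ, ← sub_sub, ih, hF]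
      field_simp
      ring
  refine ⟨fun k => (F k).1.2, rfl, fun N => ?_⟩
  have h1 : (fun h : ℝ => h ^ (N + 1) * (F (N + 1)).1.1 h) =O[𝓝[>] 0]
      fun h => h ^ (N + 1) * 1 := (isBigO_refl _ _).mul (F (N + 1)).2.isBigO_one
  simp only [mul_one] at h1
  refine h1.congr' ?_ EventuallyEq.rfl
  filter_upwards [self_mem_nhdsWithin] with h (hh : 0 < h)
  rw [hrem _ _ hh.ne']

end HasPowerExpansion

theorem HasCompleteExpansion.add {n : ℕ} {R S : ℝ → Matrix (Fin n) (Fin n) ℂ}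
    (hR : HasCompleteExpansion R) (hS : HasCompleteExpansion S) :
    HasCompleteExpansion fun h => R h + S h := by
  obtain ⟨hR, C, hC⟩ := hR
  obtain ⟨hS, D, hD⟩ := hS
  refine ⟨fun i j => (hR i j).add (hS i j), fun k => C k + D k, fun N i j => ?_⟩
  refine ((hC N i j).add (hD N i j)).congr_left fun h => ?_
  simp only [Matrix.sub_apply, Matrix.add_apply, smul_add, Finset.sum_add_distrib]
  ring

theorem HasPowerExpansion.hasCompleteExpansion_smul {n : ℕ} {f : ℝ → ℝ} {a : ℝ}
    (hf : HasPowerExpansion f a) (E : Matrix (Fin n) (Fin n) ℂ) :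
    HasCompleteExpansion fun h => ((f h - a : ℝ) : ℂ) • E := by
  obtain ⟨c, rfl, hc⟩ := hf.exists_coeff
  have key : ∀ N : ℕ, ∀ i j, (fun h : ℝ => (((f h - c 0 : ℝ) : ℂ) • E -
      ∑ k ∈ Finset.Icc 1 N, ((h ^ k : ℝ) : ℂ) • ((c k : ℂ) • E)) i j)
      =O[𝓝[>] 0] fun h : ℝ => h ^ (N + 1) := by
    intro N i j
    have h1 : (fun h => ((f h - ∑ k ∈ Finset.range (N + 1), c k * h ^ k : ℝ) : ℂ) * E i j)
        =O[𝓝[>] 0] fun h : ℝ => h ^ (N + 1) := by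
      simpa [mul_comm] using
        (((hc N).norm_left.congr_left (f₂ := fun h => ‖((f h - ∑ k ∈ Finset.range (N + 1),
          c k * h ^ k : ℝ) : ℂ)‖) fun h => (Complex.norm_real _).symm).of_norm_left).const_mul_left
          (E i j)
    refine h1.congr_left fun h => ?_
    have h2 := Finset.sum_Ico_add' (fun k => c k * h ^ k) 0 N 1
    have h3 : Finset.Ico (0 + 1) (N + 1) = Finset.Icc 1 N := by
      ext
      simp only [Finset.mem_Ico, Finset.mem_Icc]
      omega
    rw [h3, ← Finset.range_eq_Ico] at h2
    rw [Finset.sum_range_succ', h2]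
    simp only [Matrix.sub_apply, Matrix.smul_apply, Matrix.sum_apply, smul_eq_mul]
    push_cast
    rw [pow_zero, mul_one, add_comm, ← sub_sub, sub_mul, Finset.sum_mul]
    congr 1
    exact Finset.sum_congr rfl fun k _ => by ring
  refine ⟨fun i j => by simpa using key 0 i j, fun k => (c k : ℂ) • E, key⟩

/-- A function approximated to every order by functions with expansions has an expansion. -/
theorem HasPowerExpansion.of_approx {f : ℝ → ℝ} {a : ℝ}
    (h : ∀ N : ℕ, ∃ p : ℝ → ℝ, HasPowerExpansion p a ∧
      (fun h => f h - p h) =O[𝓝[>] 0] fun h => h ^ (N + 1)) : HasPowerExpansion f a := by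
  refine ⟨?_, fun N => ?_⟩
  · obtain ⟨p, hp, hfp⟩ := h 0
    have h0 : Tendsto (fun h : ℝ => h ^ (0 + 1)) (𝓝[>] 0) (𝓝 0) := by
      simp only [zero_add, pow_one]
      exact tendsto_nhdsWithin_of_tendsto_nhds tendsto_id
    simpa using (hfp.trans_tendsto h0).add hp.tendsto
  · obtain ⟨p, hp, hfp⟩ := h N
    obtain ⟨q, hq⟩ := hp.approx N
    exact ⟨q, ((hfp.trans (pow_isBigO_pow (Nat.le_succ N))).add hq).congr_left fun _ => by ring⟩

/-! ### Smooth functions with bounded derivatives, and polynomials in `h` with such coefficients -/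

/-- Smooth functions on `ℝ` all of whose derivatives, including the function itself, are bounded. -/
structure BddSmooth (f : ℝ → ℝ) : Prop where
  smooth : ContDiff ℝ ∞ f
  bounded : ∀ k : ℕ, ∃ C : ℝ, ∀ x, |iteratedDeriv k f x| ≤ C

namespace BddSmooth

variable {f g : ℝ → ℝ}

theorem hasDerivAt (hf : BddSmooth f) (x : ℝ) : HasDerivAt f (deriv f x) x :=
  ((hf.smooth.differentiable (by simp)) x).hasDerivAt

theorem bdd (hf : BddSmooth f) : ∃ C, ∀ x, |f x| ≤ C := by simpa using hf.bounded 0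

theorem const (c : ℝ) : BddSmooth fun _ => c :=
  ⟨contDiff_const, fun k => ⟨|c|, fun x => by
    rw [iteratedDeriv_const]; split_ifs <;> simp⟩⟩

theorem deriv (hf : BddSmooth f) : BddSmooth (deriv f) :=
  ⟨(contDiff_infty_iff_deriv.1 hf.smooth).2, fun k => by
    simpa [iteratedDeriv_succ'] using hf.bounded (k + 1)⟩

theorem add (hf : BddSmooth f) (hg : BddSmooth g) : BddSmooth fun x => f x + g x :=
  ⟨hf.smooth.add hg.smooth, fun k => by
    obtain ⟨C, hC⟩ := hf.bounded k
    obtain ⟨D, hD⟩ := hg.bounded k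
    refine ⟨C + D, fun x => ?_⟩
    have : iteratedDeriv k (fun x => f x + g x) x = iteratedDeriv k f x + iteratedDeriv k g x :=
      iteratedDeriv_fun_add (hf.smooth.contDiffAt.of_le (by exact_mod_cast le_top))
        (hg.smooth.contDiffAt.of_le (by exact_mod_cast le_top))
    rw [this]
    exact (abs_add_le _ _).trans (add_le_add (hC x) (hD x))⟩

theorem mul (hf : BddSmooth f) (hg : BddSmooth g) : BddSmooth fun x => f x * g x :=
  ⟨hf.smooth.mul hg.smooth, fun k => by
    choose C hC using hf.bounded
    choose D hD using hg.bounded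
    refine ⟨∑ i ∈ Finset.range (k + 1), (k.choose i : ℝ) * C i * D (k - i), fun x => ?_⟩
    have h := norm_iteratedFDeriv_mul_le hf.smooth hg.smooth x (n := k) (by exact_mod_cast le_top)
    simp only [norm_iteratedFDeriv_eq_norm_iteratedDeriv, Real.norm_eq_abs] at h
    refine h.trans (Finset.sum_le_sum fun i _ => ?_)
    have h1 := hC i x
    have h2 := hD (k - i) x
    have h3 : 0 ≤ C i := (abs_nonneg _).trans h1
    gcongr⟩

theorem const_mul (c : ℝ) (hf : BddSmooth f) : BddSmooth fun x => c * f x := (const c).mul hf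

/-- Composition with a function which is smooth on a compact interval containing the range. -/
theorem comp {φ : ℝ → ℝ} {a b : ℝ} (hab : a < b) (hφ : ContDiffOn ℝ ∞ φ (Icc a b))
    (hf : BddSmooth f) (hfab : ∀ x, f x ∈ Icc a b) : BddSmooth fun x => φ (f x) := by
  refine ⟨contDiffOn_univ.1 (hφ.comp hf.smooth.contDiffOn fun x _ => hfab x), fun k => ?_⟩
  have hu : UniqueDiffOn ℝ (Icc a b) := uniqueDiffOn_Icc hab
  have h1 : ∀ i : ℕ, ∃ C, ∀ y ∈ Icc a b, ‖iteratedFDerivWithin ℝ i φ (Icc a b) y‖ ≤ C := fun i =>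
    isCompact_Icc.exists_bound_of_continuousOn
      (hφ.continuousOn_iteratedFDerivWithin (by exact_mod_cast le_top) hu)
  choose C hC using h1
  choose D hD using hf.bounded
  have hC0 : ∀ i, 0 ≤ C i := fun i => (norm_nonneg _).trans (hC i a ⟨le_rfl, hab.le⟩)
  have hD0 : ∀ i, 0 ≤ D i := fun i => (abs_nonneg _).trans (hD i 0)
  refine ⟨k.factorial * (∑ i ∈ Finset.range (k + 1), C i) *
    (1 + ∑ i ∈ Finset.range (k + 1), D i) ^ k, fun x => ?_⟩
  have h := norm_iteratedFDeriv_comp_le' (n := k) (C := ∑ i ∈ Finset.range (k + 1), C i)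
    (D := 1 + ∑ i ∈ Finset.range (k + 1), D i)
    (range_subset_iff.2 hfab) hu hφ hf.smooth (by exact_mod_cast le_top) x
    (fun i hi => (hC i _ (hfab x)).trans
      (Finset.single_le_sum (f := C) (fun j _ => hC0 j) (Finset.mem_range.2 (by omega))))
    (fun i hi hik => ?_)
  · rwa [norm_iteratedFDeriv_eq_norm_iteratedDeriv, Real.norm_eq_abs] at h
  · rw [norm_iteratedFDeriv_eq_norm_iteratedDeriv, Real.norm_eq_abs]
    have h1 : D i ≤ ∑ j ∈ Finset.range (k + 1), D j :=
      Finset.single_le_sum (f := D) (fun j _ => hD0 j) (Finset.mem_range.2 (by omega))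
    have h2 : (1 : ℝ) ≤ 1 + ∑ j ∈ Finset.range (k + 1), D j := by
      linarith [Finset.sum_nonneg (s := Finset.range (k + 1)) fun j _ => hD0 j]
    calc |iteratedDeriv i f x| ≤ 1 + ∑ j ∈ Finset.range (k + 1), D j := by linarith [hD i x]
      _ = (1 + ∑ j ∈ Finset.range (k + 1), D j) ^ 1 := (pow_one _).symm
      _ ≤ _ := pow_le_pow_right₀ h2 hi

theorem comp_neg (hf : BddSmooth f) : BddSmooth fun x => f (-x) :=
  ⟨hf.smooth.comp contDiff_neg, fun k => by
    obtain ⟨C, hC⟩ := hf.bounded k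
    refine ⟨C, fun x => ?_⟩
    rw [iteratedDeriv_comp_neg]
    simpa [abs_mul] using hC (-x)⟩

end BddSmooth

/-- Functions `p h x` which are polynomial in the parameter `h`, with coefficients in `BddSmooth`;
built from the constant coefficient upwards. -/
inductive PolyFamily : (ℝ → ℝ → ℝ) → Prop
  | of (c : ℝ → ℝ) (hc : BddSmooth c) : PolyFamily fun _ x => c x
  | cons (c : ℝ → ℝ) (p : ℝ → ℝ → ℝ) (hc : BddSmooth c) (hp : PolyFamily p) :
      PolyFamily fun h x => c x + h * p h x

namespace PolyFamily

variable {p q : ℝ → ℝ → ℝ}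

theorem zero : PolyFamily fun _ _ => 0 := of _ (BddSmooth.const 0)

theorem exists_eq_cons (hp : PolyFamily p) : ∃ c q, BddSmooth c ∧ PolyFamily q ∧
    p = fun h x => c x + h * q h x := by
  cases hp with
  | of c hc => exact ⟨c, _, hc, zero, by simp⟩
  | cons c p hc hp => exact ⟨c, p, hc, hp, rfl⟩

theorem shift (hp : PolyFamily p) : PolyFamily fun h x => h * p h x := by
  simpa using cons _ _ (BddSmooth.const 0) hp

theorem pow_mul (hp : PolyFamily p) (k : ℕ) : PolyFamily fun h x => h ^ k * p h x := by
  induction k with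
  | zero => simpa using hp
  | succ k ih => simpa [pow_succ', mul_assoc] using ih.shift

theorem add (hp : PolyFamily p) (hq : PolyFamily q) : PolyFamily fun h x => p h x + q h x := by
  induction hp generalizing q with
  | of c hc =>
    obtain ⟨d, q, hd, hq', rfl⟩ := hq.exists_eq_cons
    simpa [add_assoc] using cons _ _ (hc.add hd) hq'
  | cons c p hc hp ih =>
    obtain ⟨d, q, hd, hq', rfl⟩ := hq.exists_eq_cons
    convert! cons _ _ (hc.add hd) (ih hq') using 3
    ring

theorem coeff_mul {c : ℝ → ℝ} (hc : BddSmooth c) (hp : PolyFamily p) :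
    PolyFamily fun h x => c x * p h x := by
  induction hp with
  | of d hd => exact of _ (hc.mul hd)
  | cons d p hd hp ih =>
    convert! cons _ _ (hc.mul hd) ih using 3
    ring

theorem contDiff (hp : PolyFamily p) (h : ℝ) : ContDiff ℝ ∞ (p h) := by
  induction hp with
  | of c hc => exact hc.smooth
  | cons c p hc hp ih => exact hc.smooth.add (contDiff_const.mul ih)

theorem hasDerivAt (hp : PolyFamily p) (h x : ℝ) : HasDerivAt (p h) (deriv (p h) x) x :=
  (((hp.contDiff h).differentiable (by simp)) x).hasDerivAt

theorem bdd (hp : PolyFamily p) : ∃ C, ∀ h ∈ Icc (0 : ℝ) 1, ∀ x, |p h x| ≤ C := by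
  induction hp with
  | of c hc => exact hc.bdd.imp fun C hC h _ x => hC x
  | cons c p hc hp ih =>
    obtain ⟨C, hC⟩ := ih
    obtain ⟨D, hD⟩ := hc.bdd
    refine ⟨D + C, fun h hh x => (abs_add_le _ _).trans (add_le_add (hD x) ?_)⟩
    rw [abs_mul, abs_of_nonneg hh.1]
    nlinarith [hC h hh x, abs_nonneg (p h x), hh.2, hh.1]

theorem hasPowerExpansion (hp : PolyFamily p) (x : ℝ) :
    HasPowerExpansion (fun h => p h x) (p 0 x) := by
  induction hp with
  | of c hc => exact .const _
  | cons c p hc hp ih =>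
    have h1 := HasPowerExpansion.of_polynomial Polynomial.X
    simp only [Polynomial.eval_X] at h1
    exact (HasPowerExpansion.const (c x)).add (h1.mul ih)

theorem hasPowerExpansion_integral (hp : PolyFamily p) (a b : ℝ) :
    HasPowerExpansion (fun h => ∫ t in a..b, p h t) (∫ t in a..b, p 0 t) := by
  induction hp with
  | of c hc => exact .const _
  | cons c p hc hp ih =>
    have h1 := HasPowerExpansion.of_polynomial Polynomial.X
    simp only [Polynomial.eval_X] at h1
    have h2 := (HasPowerExpansion.const (∫ t in a..b, c t)).add (h1.mul ih)
    have h3 : ∀ h, ∫ t in a..b, (c t + h * p h t) = (∫ t in a..b, c t) + h * ∫ t in a..b, p h t := by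
      intro h
      have h4 : Continuous fun t => h * p h t := continuous_const.mul (hp.contDiff h).continuous
      rw [intervalIntegral.integral_add (hc.smooth.continuous.intervalIntegrable _ _)
        (h4.intervalIntegrable _ _), intervalIntegral.integral_const_mul]
    simpa only [h3] using h2

end PolyFamily

open scoped ContDiff BoundedContinuousFunction

/-! ### The Riccati equation -/

/-- A bounded solution of the unstable scalar equation `h e' = a e + b` with `a ≥ c > 0` is bounded
by `sup |b| / c`. -/
theorem abs_le_of_unstable {e a b : ℝ → ℝ} {h c M K : ℝ} (hh : 0 < h) (hc : 0 < c)
    (ha : Continuous a) (hac : ∀ x, c ≤ a x)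
    (he : ∀ x, HasDerivAt e ((a x * e x + b x) / h) x) (hb : ∀ x, |b x| ≤ M)
    (hK : ∀ x, |e x| ≤ K) (x : ℝ) : |e x| ≤ M / c := by
  have hM : 0 ≤ M := (abs_nonneg _).trans (hb 0)
  have upper : ∀ (e b : ℝ → ℝ), (∀ x, HasDerivAt e ((a x * e x + b x) / h) x) →
      (∀ x, |b x| ≤ M) → (∀ x, |e x| ≤ K) → ∀ x, e x ≤ M / c := by
    intro e b he hb hK x
    -- Multiplied by the integrating factor, `e - M / c` increases to `0`.
    let E : ℝ → ℝ := fun t => Real.exp (-(∫ s in (0 : ℝ)..t, a s) / h)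
    have hE : ∀ t, HasDerivAt E (E t * (-a t / h)) t := fun t =>
      ((((ha.integral_hasStrictDerivAt 0 t).hasDerivAt).neg).div_const h).exp
    have hφ : ∀ t, HasDerivAt (fun t => (e t - M / c) * E t)
        ((a t * e t + b t) / h * E t + (e t - M / c) * (E t * (-a t / h))) t := fun t =>
      ((he t).sub_const _).mul (hE t)
    have hmono : Monotone fun t => (e t - M / c) * E t := by
      refine monotone_of_deriv_nonneg (fun t => (hφ t).differentiableAt) fun t => ?_
      rw [(hφ t).deriv]
      have h1 : (a t * e t + b t) / h * E t + (e t - M / c) * (E t * (-a t / h))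
          = E t / h * (b t + a t / c * M) := by
        field_simp; ring
      rw [h1]
      have h2 : 1 ≤ a t / c := (one_le_div hc).2 (hac t)
      have h3 : -M ≤ b t := (abs_le.1 (hb t)).1
      have : 0 < E t := Real.exp_pos _
      refine mul_nonneg (by positivity) ?_
      nlinarith
    have hlim : Tendsto (fun t => (e t - M / c) * E t) atTop (𝓝 0) := by
      have h1 : Tendsto (fun t => (K + M / c) * Real.exp (-(c / h * t))) atTop (𝓝 0) := by
        have h2 : Tendsto (fun t => c / h * t) atTop atTop :=
          tendsto_id.const_mul_atTop (by positivity)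
        simpa using (Real.tendsto_exp_neg_atTop_nhds_zero.comp h2).const_mul (K + M / c)
      refine squeeze_zero_norm' ?_ h1
      filter_upwards [eventually_ge_atTop 0] with t ht
      have h2 : c * t ≤ ∫ s in (0 : ℝ)..t, a s := by
        have := intervalIntegral.integral_mono_on (μ := volume) ht
          (continuous_const.intervalIntegrable 0 t) (ha.intervalIntegrable 0 t) (fun s _ => hac s)
        simpa [mul_comm] using this
      rw [norm_mul, Real.norm_eq_abs, Real.norm_eq_abs, Real.abs_exp]
      refine mul_le_mul ?_ ?_ (Real.exp_pos _).le ?_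
      · have h4 : |M / c| = M / c := abs_of_nonneg (by positivity)
        linarith [abs_sub (e t) (M / c), hK t]
      · refine Real.exp_le_exp.2 ?_
        rw [neg_div, neg_le_neg_iff, div_mul_eq_mul_div]
        gcongr
      · have := (abs_nonneg _).trans (hK t)
        positivity
    have h1 : (e x - M / c) * E x ≤ 0 :=
      ge_of_tendsto hlim ((eventually_ge_atTop x).mono fun t ht => hmono ht)
    have h2 : 0 < E x := Real.exp_pos _
    by_contra! hcon
    nlinarith
  refine abs_le.2 ⟨?_, upper e b he hb hK x⟩
  have h1 := upper (fun x => -e x) (fun x => -b x) (fun x => ?_) (fun x => by simpa using hb x)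
    (fun x => by simpa using hK x) x
  · linarith
  · convert! (he x).neg using 1
    ring

/-- The equation `h e' = 2 e - g` with bounded continuous `g` has a bounded solution. -/
theorem exists_bounded_solution {h : ℝ} (hh : 0 < h) (g : ℝ →ᵇ ℝ) :
    ∃ e : ℝ →ᵇ ℝ, ∀ x, HasDerivAt e ((2 * e x - g x) / h) x := by
  have hneg : -2 / h < 0 := div_neg_of_neg_of_pos (by norm_num) hh
  let F : ℝ → ℝ := fun t => Real.exp (-2 / h * t) * g t
  have hFc : Continuous F := by fun_prop
  have hexp : ∀ x, IntegrableOn (fun t => Real.exp (-2 / h * t)) (Ioi x) := fun x =>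
    integrableOn_exp_mul_Ioi hneg x
  have hF : ∀ x, IntegrableOn F (Ioi x) := by
    intro x
    refine ((hexp x).mul_const ‖g‖).mono' hFc.aestronglyMeasurable.restrict ?_
    refine ae_of_all _ fun t => ?_
    rw [norm_mul, Real.norm_eq_abs, Real.abs_exp]
    gcongr
    exact g.norm_coe_le_norm t
  let I : ℝ → ℝ := fun x => ∫ t in Ioi x, F t
  have hI : ∀ x, HasDerivAt I (-F x) x := by
    intro x
    have h1 : I = fun y => I 0 - ∫ t in (0 : ℝ)..y, F t := by
      ext y
      have := intervalIntegral.integral_Ioi_sub_Ioi' (hF 0) (hF y)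
      simp only [I]; linarith
    rw [h1]
    exact ((hFc.integral_hasStrictDerivAt 0 x).hasDerivAt).const_sub (I 0)
  let e : ℝ → ℝ := fun x => Real.exp (2 / h * x) / h * I x
  have he : ∀ x, HasDerivAt e ((2 * e x - g x) / h) x := by
    intro x
    have h1 : HasDerivAt (fun x => Real.exp (2 / h * x) / h)
        (Real.exp (2 / h * x) * (2 / h * 1) / h) x :=
      (((hasDerivAt_id x).const_mul (2 / h)).exp).div_const h
    convert! h1.mul (hI x) using 1
    have h2 : Real.exp (-2 / h * x) = (Real.exp (2 / h * x))⁻¹ := by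
      rw [← Real.exp_neg]; congr 1; ring
    simp only [e, F, h2]
    have := (Real.exp_pos (2 / h * x)).ne'
    field_simp
    ring
  have hb : ∀ x, ‖e x‖ ≤ ‖g‖ / 2 := by
    intro x
    have h1 : ‖I x‖ ≤ ∫ t in Ioi x, Real.exp (-2 / h * t) * ‖g‖ := by
      refine norm_integral_le_of_norm_le ((hexp x).mul_const ‖g‖) (ae_of_all _ fun t => ?_)
      rw [norm_mul, Real.norm_eq_abs, Real.abs_exp]
      gcongr
      exact g.norm_coe_le_norm t
    rw [integral_mul_const, integral_exp_mul_Ioi hneg] at h1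
    have h2 : Real.exp (-2 / h * x) = (Real.exp (2 / h * x))⁻¹ := by
      rw [← Real.exp_neg]; congr 1; ring
    have h3 := Real.exp_pos (2 / h * x)
    calc ‖e x‖ = Real.exp (2 / h * x) / h * ‖I x‖ := by
          simp only [e, norm_mul, norm_div, Real.norm_eq_abs, Real.abs_exp, abs_of_pos hh]
      _ ≤ Real.exp (2 / h * x) / h * (-Real.exp (-2 / h * x) / (-2 / h) * ‖g‖) := by gcongr
      _ = ‖g‖ / 2 := by rw [h2]; field_simp
  exact ⟨.ofNormedAddCommGroup e
    (continuous_iff_continuousAt.2 fun x => (he x).continuousAt) _ hb, he⟩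

/-- `r` is a solution of the Riccati equation `h r' = 2 r - W - W r²` with `|r| ≤ κ`. -/
structure IsRiccatiSolution (W : ℝ → ℝ) (κ h : ℝ) (r : ℝ → ℝ) : Prop where
  hasDerivAt : ∀ x, HasDerivAt r ((2 * r x - W x - W x * r x ^ 2) / h) x
  abs_le : ∀ x, |r x| ≤ κ

/-- For `|W| ≤ κ < 1` a bounded solution exists: it is the fixed point of the contraction of the
unit ball which sends `r` to the bounded solution `e` of `h e' = 2 e - W (1 + r²)`. -/
theorem exists_isRiccatiSolution {W : ℝ → ℝ} {κ h : ℝ} (hW : Continuous W) (hκ : κ < 1)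
    (hWκ : ∀ x, |W x| ≤ κ) (hh : 0 < h) : ∃ r, IsRiccatiSolution W κ h r := by
  have hκ0 : 0 ≤ κ := (abs_nonneg _).trans (hWκ 0)
  choose L hL using fun g : ℝ →ᵇ ℝ => exists_bounded_solution hh g
  have hLip : ∀ g₁ g₂ : ℝ →ᵇ ℝ, ∀ M, (∀ x, |g₁ x - g₂ x| ≤ M) → ∀ x, |L g₁ x - L g₂ x| ≤ M / 2 := by
    intro g₁ g₂ M hM x
    refine abs_le_of_unstable (e := fun x => L g₁ x - L g₂ x) (a := fun _ => 2)
      (b := fun x => -(g₁ x - g₂ x)) (K := ‖L g₁ - L g₂‖) hh two_pos continuous_const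
      (fun _ => le_rfl) (fun x => ?_) (fun x => by rw [abs_neg]; exact hM x)
      (fun x => (L g₁ - L g₂).norm_coe_le_norm x) x
    convert! (hL g₁ x).sub (hL g₂ x) using 1
    ring
  let w : ℝ →ᵇ ℝ := .ofNormedAddCommGroup W hW κ hWκ
  let Φ : (ℝ →ᵇ ℝ) → (ℝ →ᵇ ℝ) := fun r => L (w * (1 + r * r))
  have hball : ∀ r ∈ Metric.closedBall (0 : ℝ →ᵇ ℝ) 1, ∀ x, |r x| ≤ 1 := by
    intro r hr x
    have : ‖r‖ ≤ 1 := by simpa using hr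
    exact (r.norm_coe_le_norm x).trans this
  have hΦ : ∀ r ∈ Metric.closedBall (0 : ℝ →ᵇ ℝ) 1, ∀ x, |Φ r x| ≤ κ := by
    intro r hr x
    have h1 : |Φ r x| ≤ 2 * κ / 2 := by
      refine abs_le_of_unstable (e := Φ r) (a := fun _ => 2)
        (b := fun x => -(w x * (1 + r x * r x))) (K := ‖Φ r‖) hh two_pos continuous_const
        (fun _ => le_rfl) (fun x => ?_) (fun x => ?_) (fun x => (Φ r).norm_coe_le_norm x) x
      · convert! hL _ x using 1
      · have h2 := hball r hr x
        have h3 : |1 + r x * r x| ≤ 2 := by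
          rw [abs_of_nonneg (by nlinarith [mul_self_nonneg (r x)])]
          nlinarith [abs_mul_abs_self (r x), abs_nonneg (r x)]
        rw [abs_neg, abs_mul, mul_comm 2 κ]
        exact mul_le_mul (hWκ x) h3 (abs_nonneg _) hκ0
    simpa using h1
  have hmaps : MapsTo Φ (Metric.closedBall 0 1) (Metric.closedBall 0 1) := by
    intro r hr
    rw [mem_closedBall_zero_iff]
    exact (BoundedContinuousFunction.norm_le zero_le_one).2 fun x => (hΦ r hr x).trans hκ.le
  have hcontr : ContractingWith ⟨κ, hκ0⟩ (hmaps.restrict Φ _ _) := by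
    refine ⟨by exact_mod_cast hκ, LipschitzWith.of_dist_le_mul ?_⟩
    rintro ⟨r₁, h₁⟩ ⟨r₂, h₂⟩
    simp only [Subtype.dist_eq, MapsTo.val_restrict_apply]
    refine (BoundedContinuousFunction.dist_le (by positivity)).2 fun x => ?_
    rw [Real.dist_eq]
    refine (hLip _ _ (2 * (κ * dist r₁ r₂)) (fun y => ?_) x).trans
      (mul_div_cancel_left₀ (κ * dist r₁ r₂) two_ne_zero).le
    have h3 : |r₁ y - r₂ y| ≤ dist r₁ r₂ := by
      rw [← Real.dist_eq]; exact BoundedContinuousFunction.dist_coe_le_dist y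
    have h4 : |r₁ y + r₂ y| ≤ 2 := by
      linarith [abs_add_le (r₁ y) (r₂ y), hball _ h₁ y, hball _ h₂ y]
    have h5 : (w * (1 + r₁ * r₁)) y - (w * (1 + r₂ * r₂)) y
        = W y * ((r₁ y + r₂ y) * (r₁ y - r₂ y)) := by
      change W y * (1 + r₁ y * r₁ y) - W y * (1 + r₂ y * r₂ y) = _
      ring
    rw [h5, abs_mul, abs_mul]
    calc |W y| * (|r₁ y + r₂ y| * |r₁ y - r₂ y|) ≤ κ * (2 * dist r₁ r₂) := by
          gcongr
          exact hWκ y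
      _ = _ := by ring
  obtain ⟨r, hr, hfix, -⟩ := hcontr.exists_fixedPoint' Metric.isClosed_closedBall.isComplete hmaps
    (x := 0) (by simp) (edist_ne_top _ _)
  have hfix' : Φ r = r := hfix
  refine ⟨r, fun x => ?_, fun x => ?_⟩
  · have h1 := hL (w * (1 + r * r)) x
    have h2 : (L (w * (1 + r * r)) : ℝ → ℝ) = r := congrArg _ hfix'
    rw [h2] at h1
    convert! h1 using 2
    change _ = 2 * r x - W x * (1 + r x * r x)
    ring
  · have := hΦ r hr x
    rwa [hfix'] at this

theorem IsRiccatiSolution.contDiff {W r : ℝ → ℝ} {κ h : ℝ} (hr : IsRiccatiSolution W κ h r)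
    (hW : ContDiff ℝ ∞ W) : ContDiff ℝ ∞ r := by
  rw [contDiff_infty]
  intro n
  induction n with
  | zero => 
    exact contDiff_zero.2 (continuous_iff_continuousAt.2 fun x => (hr.hasDerivAt x).continuousAt)
  | succ n ih =>
    rw [show ((n + 1 : ℕ) : ℕ∞ω) = (n : ℕ∞ω) + 1 by norm_cast, contDiff_succ_iff_deriv]
    refine ⟨fun x => (hr.hasDerivAt x).differentiableAt, by simp, ?_⟩
    have h1 : deriv r = fun x => (2 * r x - W x - W x * r x ^ 2) / h :=
      funext fun x => (hr.hasDerivAt x).deriv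
    have h2 : ContDiff ℝ n W := hW.of_le (by exact_mod_cast le_top)
    rw [h1]
    fun_prop

/-! ### Semiclassical expansion of the Riccati solution -/

/-- The assumption on `W = -V`: smooth with bounded derivatives, and `δ ≤ W ≤ 1 - δ`. -/
structure IsGapFunction (W : ℝ → ℝ) (δ : ℝ) : Prop where
  bddSmooth : BddSmooth W
  pos : 0 < δ
  le : ∀ x, δ ≤ W x
  ge : ∀ x, W x ≤ 1 - δ

/-- `√(1 - W²)`, the derivative of the phase. -/
noncomputable def phaseSlope (W : ℝ → ℝ) (x : ℝ) : ℝ := √(1 - W x ^ 2)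

/-- The small root `(1 - √(1 - W²)) / W` of `W - 2 r + W r² = 0`, written without division by
`W`; it is the tangent of half the angle `arcsin W`. -/
noncomputable def rootFun (W : ℝ → ℝ) (x : ℝ) : ℝ := W x / (1 + √(1 - W x ^ 2))

/-- The coefficient of `h` in the formal solution of the Riccati equation. -/
noncomputable def subrootFun (W : ℝ → ℝ) (x : ℝ) : ℝ :=
  deriv (rootFun W) x * (2 * phaseSlope W x)⁻¹

namespace IsGapFunction

variable {W : ℝ → ℝ} {δ : ℝ}

theorem le_half (hW : IsGapFunction W δ) : δ ≤ 1 / 2 := by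
  linarith [hW.le 0, hW.ge 0]

theorem pos' (hW : IsGapFunction W δ) (x : ℝ) : 0 < W x := hW.pos.trans_le (hW.le x)

theorem lt_one (hW : IsGapFunction W δ) (x : ℝ) : W x < 1 := by linarith [hW.pos, hW.ge x]

theorem abs_le (hW : IsGapFunction W δ) (x : ℝ) : |W x| ≤ 1 - δ := by
  rw [abs_of_pos (hW.pos' x)]; exact hW.ge x

theorem one_sub_sq_pos (hW : IsGapFunction W δ) (x : ℝ) : 0 < 1 - W x ^ 2 := by
  nlinarith [hW.pos' x, hW.lt_one x]

theorem phaseSlope_pos (hW : IsGapFunction W δ) (x : ℝ) : 0 < phaseSlope W x :=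
  Real.sqrt_pos.2 (hW.one_sub_sq_pos x)

theorem phaseSlope_sq (hW : IsGapFunction W δ) (x : ℝ) : phaseSlope W x ^ 2 = 1 - W x ^ 2 :=
  Real.sq_sqrt (hW.one_sub_sq_pos x).le

theorem comp_bddSmooth (hW : IsGapFunction W δ) {φ : ℝ → ℝ} (hφ : ContDiffOn ℝ ∞ φ (Ioo 0 1)) :
    BddSmooth fun x => φ (W x) := by
  have h1 := hW.pos
  have h2 := hW.le_half
  refine hW.bddSmooth.comp (a := δ / 2) (b := 1 - δ / 2) (by linarith)
    (hφ.mono fun y hy => ⟨by linarith [hy.1], by linarith [hy.2]⟩)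
    fun x => ⟨by linarith [hW.le x], by linarith [hW.ge x]⟩

theorem contDiffOn_sqrt : ContDiffOn ℝ ∞ (fun w : ℝ => √(1 - w ^ 2)) (Ioo 0 1) :=
  ContDiffOn.sqrt (by fun_prop) fun w hw => by
    have h1 := hw.1
    have h2 := hw.2
    nlinarith

theorem bddSmooth_phaseSlope (hW : IsGapFunction W δ) : BddSmooth (phaseSlope W) :=
  hW.comp_bddSmooth contDiffOn_sqrt

theorem bddSmooth_rootFun (hW : IsGapFunction W δ) : BddSmooth (rootFun W) :=
  hW.comp_bddSmooth (φ := fun w => w / (1 + √(1 - w ^ 2)))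
    (contDiffOn_id.div (contDiffOn_const.add contDiffOn_sqrt) fun w _ => by positivity)

theorem bddSmooth_inv (hW : IsGapFunction W δ) : BddSmooth fun x => (2 * phaseSlope W x)⁻¹ :=
  hW.comp_bddSmooth (φ := fun w => (2 * √(1 - w ^ 2))⁻¹)
    ((contDiffOn_const.mul contDiffOn_sqrt).inv fun w hw => by
      have h1 := hw.1
      have h2 := hw.2
      have : 0 < √(1 - w ^ 2) := Real.sqrt_pos.2 (by nlinarith)
      positivity)

theorem bddSmooth_subrootFun (hW : IsGapFunction W δ) : BddSmooth (subrootFun W) :=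
  hW.bddSmooth_rootFun.deriv.mul hW.bddSmooth_inv

theorem rootFun_nonneg (hW : IsGapFunction W δ) (x : ℝ) : 0 ≤ rootFun W x :=
  div_nonneg (hW.pos' x).le (by positivity)

theorem rootFun_lt_one (hW : IsGapFunction W δ) (x : ℝ) : rootFun W x < 1 := by
  have h1 := hW.phaseSlope_pos x
  have h2 := hW.lt_one x
  change W x / (1 + phaseSlope W x) < 1
  rw [div_lt_one (by positivity)]
  linarith

theorem one_sub_mul_rootFun (hW : IsGapFunction W δ) (x : ℝ) :
    1 - W x * rootFun W x = phaseSlope W x := by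
  have h1 := hW.phaseSlope_pos x
  have h2 := hW.phaseSlope_sq x
  change 1 - W x * (W x / (1 + phaseSlope W x)) = phaseSlope W x
  field_simp
  linarith

theorem rootFun_eq (hW : IsGapFunction W δ) (x : ℝ) :
    W x - 2 * rootFun W x + W x * rootFun W x ^ 2 = 0 := by
  have h1 := hW.phaseSlope_pos x
  have h3 : W x = rootFun W x * (1 + phaseSlope W x) := by
    change W x = W x / (1 + phaseSlope W x) * (1 + phaseSlope W x)
    field_simp
  have h4 := hW.one_sub_mul_rootFun x
  linear_combination h3 - rootFun W x * h4

/-- The formal solution of the Riccati equation: for every `N` there is a polynomial in `h` which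
solves it up to `O(h ^ (N + 2))`. The next coefficient is found by dividing by
`2 (1 - W r₀) = 2 √(1 - W²)`. -/
theorem exists_formal_solution (hW : IsGapFunction W δ) (N : ℕ) :
    ∃ P Q : ℝ → ℝ → ℝ, PolyFamily P ∧ PolyFamily Q ∧ (∀ x, P 0 x = subrootFun W x) ∧
      ∀ h x, h * (deriv (rootFun W) x + h * deriv (P h) x)
        - 2 * (rootFun W x + h * P h x) + W x + W x * (rootFun W x + h * P h x) ^ 2
        = h ^ (N + 2) * Q h x := by
  have hr := hW.bddSmooth_rootFun
  have hs := hW.bddSmooth_subrootFun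
  induction N with
  | zero =>
    refine ⟨fun _ => subrootFun W, fun h x => deriv (subrootFun W) x + W x * subrootFun W x ^ 2,
      .of _ hs, .of _ ?_, fun _ => rfl, fun h x => ?_⟩
    · simpa only [pow_two] using hs.deriv.add (hW.bddSmooth.mul (hs.mul hs))
    · have h1 := hW.rootFun_eq x
      have h2 : 2 * subrootFun W x * (1 - W x * rootFun W x) = deriv (rootFun W) x := by
        rw [hW.one_sub_mul_rootFun, subrootFun]
        have := (hW.phaseSlope_pos x).ne'
        field_simp
      linear_combination h1 - h * h2
  | succ N ih =>
    obtain ⟨P, Q, hP, hQ, hP0, hPQ⟩ := ih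
    obtain ⟨c, Q', hc, hQ', rfl⟩ := hQ.exists_eq_cons
    have hc2 : BddSmooth fun x => c x * (2 * phaseSlope W x)⁻¹ := hc.mul hW.bddSmooth_inv
    set d : ℝ → ℝ := fun x => c x * (2 * phaseSlope W x)⁻¹ with hd
    refine ⟨fun h x => P h x + h ^ (N + 1) * d x, fun h x => (Q' h x + deriv d x +
      (2 * W x) * d x * P h x) + h ^ (N + 1) * (W x * (d x * d x)),
      hP.add ((PolyFamily.of _ hc2).pow_mul _), ?_, fun x => by simp [hP0], fun h x => ?_⟩
    · exact ((hQ'.add (.of _ hc2.deriv)).add (.coeff_mul ((hW.bddSmooth.const_mul 2).mul hc2)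
        hP)).add (.pow_mul (.of _ (hW.bddSmooth.mul (hc2.mul hc2))) _)
    · have h1 : deriv (fun x => P h x + h ^ (N + 1) * d x) x
          = deriv (P h) x + h ^ (N + 1) * deriv d x :=
        ((hP.hasDerivAt h x).add ((hc2.hasDerivAt x).const_mul _)).deriv
      have h2 : 2 * d x * (1 - W x * rootFun W x) = c x := by
        rw [hW.one_sub_mul_rootFun, hd]
        have := (hW.phaseSlope_pos x).ne'
        field_simp
      rw [h1]
      have h3 := hPQ h x
      rw [pow_succ] at h3 ⊢
      linear_combination h3 - h ^ (N + 2) * h2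

/-- The formal solutions approximate every bounded solution uniformly on `ℝ`: the difference
satisfies an unstable linear equation. -/
theorem exists_approx (hW : IsGapFunction W δ) (N : ℕ) :
    ∃ P : ℝ → ℝ → ℝ, PolyFamily P ∧ (∀ x, P 0 x = subrootFun W x) ∧ ∃ C h₀ : ℝ, 0 < h₀ ∧
      ∀ h ∈ Ioc 0 h₀, ∀ r, IsRiccatiSolution W (1 - δ) h r →
        ∀ x, |r x - (rootFun W x + h * P h x)| ≤ C * h ^ (N + 2) := by
  obtain ⟨P, Q, hP, hQ, hP0, hPQ⟩ := hW.exists_formal_solution N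
  obtain ⟨B, hB⟩ := hP.bdd
  obtain ⟨M, hM⟩ := hQ.bdd
  have hB0 : 0 ≤ B := (abs_nonneg _).trans (hB 0 ⟨le_rfl, zero_le_one⟩ 0)
  have hδ := hW.pos
  refine ⟨P, hP, hP0, M / δ, min 1 (δ / (B + 1)), by positivity, ?_⟩
  rintro h ⟨hh, hh'⟩ r hr x
  have hh1 : h ∈ Icc (0 : ℝ) 1 := ⟨hh.le, hh'.trans (min_le_left _ _)⟩
  have hhB : h * B ≤ δ := by
    have h1 := (le_div_iff₀ (by positivity)).1 (hh'.trans (min_le_right _ _))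
    nlinarith
  have hrc : Continuous r := continuous_iff_continuousAt.2 fun x => (hr.hasDerivAt x).continuousAt
  set p : ℝ → ℝ := fun x => rootFun W x + h * P h x with hp
  have hpc : Continuous p :=
    hW.bddSmooth_rootFun.smooth.continuous.add (continuous_const.mul (hP.contDiff h).continuous)
  have hp' : ∀ x, HasDerivAt p (deriv (rootFun W) x + h * deriv (P h) x) x := fun x =>
    (hW.bddSmooth_rootFun.hasDerivAt x).add ((hP.hasDerivAt h x).const_mul h)
  have hpb : ∀ x, |p x| ≤ 1 + δ := by
    intro x
    have h1 : |h * P h x| ≤ h * B := by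
      rw [abs_mul, abs_of_pos hh]
      exact mul_le_mul_of_nonneg_left (hB h hh1 x) hh.le
    have h2 : |rootFun W x| ≤ 1 := by
      rw [abs_of_nonneg (hW.rootFun_nonneg x)]; exact (hW.rootFun_lt_one x).le
    linarith [abs_add_le (rootFun W x) (h * P h x)]
  have key := abs_le_of_unstable (e := fun x => r x - p x) (a := fun x => 2 - W x * (r x + p x))
    (b := fun x => -(h ^ (N + 2) * Q h x)) (h := h) (c := δ) (M := h ^ (N + 2) * M)
    (K := (1 - δ) + (1 + δ)) hh hδ
    (continuous_const.sub (hW.bddSmooth.smooth.continuous.mul (hrc.add hpc))) (fun x => ?_)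
    (fun x => ?_) (fun x => ?_) (fun x => ?_) x
  · calc |r x - p x| ≤ h ^ (N + 2) * M / δ := key
      _ = M / δ * h ^ (N + 2) := by ring
  · have h1 := hpb x
    have h2 := hr.abs_le x
    have h3 : |W x * (r x + p x)| ≤ (1 - δ) * 2 := by
      rw [abs_mul]
      refine mul_le_mul (hW.abs_le x) ?_ (abs_nonneg _) (by linarith [hW.le_half])
      linarith [abs_add_le (r x) (p x)]
    linarith [le_abs_self (W x * (r x + p x))]
  · have h1 : h * (deriv (rootFun W) x + h * deriv (P h) x) - 2 * p x + W x + W x * p x ^ 2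
        = h ^ (N + 2) * Q h x := hPQ h x
    convert! (hr.hasDerivAt x).sub (hp' x) using 1
    field_simp
    linear_combination h1
  · rw [abs_neg, abs_mul, abs_of_pos (pow_pos hh _)]
    exact mul_le_mul_of_nonneg_left (hM h hh1 x) (pow_pos hh _).le
  · exact (abs_sub _ _).trans (add_le_add (hr.abs_le x) (hpb x))

/-- Pointwise values of the Riccati solutions have an asymptotic power series. -/
theorem hasPowerExpansion_riccati (hW : IsGapFunction W δ) {r : ℝ → ℝ → ℝ}
    (hr : ∀ h ∈ Ioc (0 : ℝ) 1, IsRiccatiSolution W (1 - δ) h (r h)) (x : ℝ) :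
    HasPowerExpansion (fun h => r h x) (rootFun W x) := by
  have key : ∀ N, ∃ p : ℝ → ℝ, HasPowerExpansion p (rootFun W x) ∧
      (fun h => r h x - p h) =O[𝓝[>] 0] fun h => h ^ (N + 1) := by
    intro N
    obtain ⟨P, hP, hP0, C, h₀, hh₀, hC⟩ := hW.exists_approx N
    refine ⟨fun h => rootFun W x + h * P h x, ?_, ?_⟩
    · simpa using (PolyFamily.cons _ _ hW.bddSmooth_rootFun hP).hasPowerExpansion x
    · refine (IsBigO.of_bound C ?_).trans (HasPowerExpansion.pow_isBigO_pow (Nat.le_succ (N + 1)))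
      filter_upwards [Ioc_mem_nhdsGT (lt_min zero_lt_one hh₀)] with h hh
      rw [Real.norm_eq_abs, Real.norm_eq_abs, abs_of_pos (pow_pos hh.1 _)]
      exact hC h ⟨hh.1, hh.2.trans (min_le_right _ _)⟩ _
        (hr h ⟨hh.1, hh.2.trans (min_le_left _ _)⟩) x
  exact .of_approx key

/-- The first correction to the exponent, `h⁻¹ ∫ W (r - r₀)`, has an asymptotic power series. -/
theorem hasPowerExpansion_exponent (hW : IsGapFunction W δ) {r : ℝ → ℝ → ℝ}
    (hr : ∀ h ∈ Ioc (0 : ℝ) 1, IsRiccatiSolution W (1 - δ) h (r h)) (a b : ℝ) :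
    HasPowerExpansion (fun h => ∫ t in a..b, W t * ((r h t - rootFun W t) / h))
      (∫ t in a..b, W t * subrootFun W t) := by
  refine .of_approx fun N => ?_
  obtain ⟨P, hP, hP0, C, h₀, hh₀, hC⟩ := hW.exists_approx N
  refine ⟨fun h => ∫ t in a..b, W t * P h t, ?_, ?_⟩
  · simpa only [hP0] using (PolyFamily.coeff_mul hW.bddSmooth hP).hasPowerExpansion_integral a b
  · refine IsBigO.of_bound (C * |b - a|) ?_
    filter_upwards [Ioc_mem_nhdsGT (lt_min zero_lt_one hh₀)] with h hh
    have hr' := hr h ⟨hh.1, hh.2.trans (min_le_left _ _)⟩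
    have hC' := hC h ⟨hh.1, hh.2.trans (min_le_right _ _)⟩ _ hr'
    have hrc : Continuous (r h) :=
      continuous_iff_continuousAt.2 fun x => (hr'.hasDerivAt x).continuousAt
    have hWc := hW.bddSmooth.smooth.continuous
    have hPc := (hP.contDiff h).continuous
    have h0c := hW.bddSmooth_rootFun.smooth.continuous
    rw [← intervalIntegral.integral_sub
      (Continuous.intervalIntegrable (by fun_prop) _ _)
      (Continuous.intervalIntegrable (by fun_prop) _ _)]
    have h1 : ∀ t, ‖W t * ((r h t - rootFun W t) / h) - W t * P h t‖ ≤ C * h ^ (N + 1) := by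
      intro t
      have h2 : W t * ((r h t - rootFun W t) / h) - W t * P h t
          = W t * ((r h t - (rootFun W t + h * P h t)) / h) := by
        have := hh.1.ne'
        field_simp
        ring
      have h3 : |W t| ≤ 1 := by rw [abs_of_pos (hW.pos' t)]; exact (hW.lt_one t).le
      rw [h2, Real.norm_eq_abs, abs_mul, abs_div, abs_of_pos hh.1]
      calc |W t| * (|r h t - (rootFun W t + h * P h t)| / h)
          ≤ 1 * (C * h ^ (N + 2) / h) := by
            gcongr
            · exact div_nonneg (abs_nonneg _) hh.1.le
            · exact hh.1.le
            · exact hC' t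
        _ = C * h ^ (N + 1) := by
            have := hh.1.ne'
            field_simp
            ring
    have h4 := intervalIntegral.norm_integral_le_of_norm_le_const (a := a) (b := b)
      fun t _ => h1 t
    rw [Real.norm_eq_abs (h ^ (N + 1)), abs_of_pos (pow_pos hh.1 _)]
    linarith

/-- `W r₁ = -½ (log (1 - r₀²))'`, which gives the amplitude of the solution. -/
theorem exp_integral_subrootFun (hW : IsGapFunction W δ) (a b : ℝ) :
    Real.exp (∫ t in a..b, W t * subrootFun W t) ^ 2 * (1 - rootFun W b ^ 2)
      = 1 - rootFun W a ^ 2 := by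
  have hpos : ∀ t, 0 < 1 - rootFun W t ^ 2 := fun t => by
    nlinarith [hW.rootFun_nonneg t, hW.rootFun_lt_one t]
  have hd : ∀ t, HasDerivAt (fun t => -(1 / 2) * Real.log (1 - rootFun W t ^ 2))
      (W t * subrootFun W t) t := by
    intro t
    have h1 := ((((hW.bddSmooth_rootFun.hasDerivAt t).pow 2).const_sub 1).log
      (hpos t).ne').const_mul (-(1 / 2))
    convert! h1 using 1
    have h2 := hW.rootFun_eq t
    have h3 := hW.one_sub_mul_rootFun t
    have h4 := hW.phaseSlope_pos t
    have h5 := (hpos t).ne'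
    rw [subrootFun]
    have h6 : W t * (1 - rootFun W t ^ 2) = 2 * rootFun W t * phaseSlope W t := by
      rw [← h3]; linear_combination h2
    have h7 : (1 - (rootFun W ^ 2) t) = 1 - rootFun W t ^ 2 := rfl
    rw [h7]
    field_simp
    simp only [Nat.cast_ofNat, Nat.add_one_sub_one, pow_one]
    linear_combination (deriv (rootFun W) t) * h6
  have hc : Continuous fun t => W t * subrootFun W t :=
    (hW.bddSmooth.mul hW.bddSmooth_subrootFun).smooth.continuous
  rw [intervalIntegral.integral_eq_sub_of_hasDerivAt (fun t _ => hd t) (hc.intervalIntegrable _ _),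
    ← Real.exp_nat_mul]
  have h1 : ((2 : ℕ) : ℝ) * (-(1 / 2) * Real.log (1 - rootFun W b ^ 2) -
      -(1 / 2) * Real.log (1 - rootFun W a ^ 2)) =
      Real.log (1 - rootFun W a ^ 2) - Real.log (1 - rootFun W b ^ 2) := by push_cast; ring
  rw [h1, Real.exp_sub, Real.exp_log (hpos a), Real.exp_log (hpos b)]
  exact div_mul_cancel₀ _ (hpos b).ne'

theorem comp_neg (hW : IsGapFunction W δ) : IsGapFunction (fun x => W (-x)) δ :=
  ⟨hW.bddSmooth.comp_neg, hW.pos, fun x => hW.le (-x), fun x => hW.ge (-x)⟩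

end IsGapFunction

/-! ### The Dirac operator on `L²` -/

section DiracOperator

variable {n : ℕ}

/-- `matAct A` as a continuous linear map. -/
noncomputable def matCLM (A : Matrix (Fin n) (Fin n) ℂ) : Spinor n →L[ℂ] Spinor n :=
  Matrix.toEuclideanCLM (n := Fin n) (𝕜 := ℂ) A

theorem matAct_eq (A : Matrix (Fin n) (Fin n) ℂ) (v : Spinor n) : matAct A v = matCLM A v := rfl

theorem matCLM_mul (A B : Matrix (Fin n) (Fin n) ℂ) (v : Spinor n) :
    matCLM (A * B) v = matCLM A (matCLM B v) := by
  simp only [matCLM, map_mul]; rfl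

theorem matCLM_add (A B : Matrix (Fin n) (Fin n) ℂ) (v : Spinor n) :
    matCLM (A + B) v = matCLM A v + matCLM B v := by
  simp only [matCLM, map_add]; rfl

theorem matCLM_smul (c : ℂ) (A : Matrix (Fin n) (Fin n) ℂ) (v : Spinor n) :
    matCLM (c • A) v = c • matCLM A v := by
  simp only [matCLM, map_smul]; rfl

theorem matCLM_one (v : Spinor n) : matCLM (1 : Matrix (Fin n) (Fin n) ℂ) v = v := by
  simp only [matCLM, map_one]; rfl

theorem inner_matCLM {A : Matrix (Fin n) (Fin n) ℂ} (hA : A.IsHermitian) (u v : Spinor n) :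
    inner ℂ (matCLM A u) v = inner ℂ u (matCLM A v) := by
  have h1 : IsSelfAdjoint (matCLM A) :=
    IsSelfAdjoint.map (Matrix.isHermitian_iff_isSelfAdjoint.1 hA) _
  have := ContinuousLinearMap.adjoint_inner_left (matCLM A) v u
  rwa [h1.adjoint_eq] at this

namespace IsDiracMatrices

variable {α : Fin 2 → Matrix (Fin n) (Fin n) ℂ}

theorem sq_eq_one (hα : IsDiracMatrices α) (k : Fin 2) : α k * α k = 1 := by
  have h := hα.clifford k k
  rw [if_pos rfl, ← one_add_one_eq_two] at h
  ext i j
  have h2 := congrFun (congrFun h i) j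
  simp only [Matrix.add_apply] at h2
  linear_combination h2 / 2

theorem anticomm (hα : IsDiracMatrices α) : α 0 * α 1 = -(α 1 * α 0) := by
  have h := hα.clifford 0 1
  rw [if_neg (by decide)] at h
  exact eq_neg_of_add_eq_zero_left h

theorem matCLM_sq (hα : IsDiracMatrices α) (k : Fin 2) (v : Spinor n) :
    matCLM (α k) (matCLM (α k) v) = v := by
  rw [← matCLM_mul, hα.sq_eq_one, matCLM_one]

theorem matCLM_anticomm (hα : IsDiracMatrices α) (v : Spinor n) :
    matCLM (α 0) (matCLM (α 1) v) = -matCLM (α 1) (matCLM (α 0) v) := by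
  rw [← matCLM_mul, hα.anticomm, ← matCLM_mul, ← neg_one_smul ℂ, matCLM_smul, neg_one_smul]

theorem norm_matCLM (hα : IsDiracMatrices α) (k : Fin 2) (v : Spinor n) :
    ‖matCLM (α k) v‖ = ‖v‖ := by
  have h : inner ℂ (matCLM (α k) v) (matCLM (α k) v) = inner ℂ v v := by
    rw [inner_matCLM (hα.hermitian k), hα.matCLM_sq]
  rw [inner_self_eq_norm_sq_to_K, inner_self_eq_norm_sq_to_K] at h
  have h2 : ‖matCLM (α k) v‖ ^ 2 = ‖v‖ ^ 2 := by exact_mod_cast h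
  exact (sq_eq_sq₀ (norm_nonneg _) (norm_nonneg _)).1 h2

end IsDiracMatrices

/-- The value of `D_{h,V} u` at a point `x` where `u` and `u'` have the values `u` and `w`. -/
noncomputable def diracValue (α : Fin 2 → Matrix (Fin n) (Fin n) ℂ) (V : ℝ → ℝ) (h x : ℝ)
    (u w : Spinor n) : Spinor n :=
  (-(Complex.I * (h : ℂ))) • matCLM (α 1) w + matCLM (α 0) u + (V x : ℂ) • u

variable {α : Fin 2 → Matrix (Fin n) (Fin n) ℂ} {V : ℝ → ℝ} {h : ℝ}

theorem diracValue_add (x : ℝ) (u w u' w' : Spinor n) :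
    diracValue α V h x (u + u') (w + w') = diracValue α V h x u w + diracValue α V h x u' w' := by
  simp only [diracValue, map_add, smul_add]; abel

theorem diracValue_smul (c : ℂ) (x : ℝ) (u w : Spinor n) :
    diracValue α V h x (c • u) (c • w) = c • diracValue α V h x u w := by
  simp only [diracValue, map_smul, smul_add, smul_comm c]

theorem diracValue_zero (x : ℝ) : diracValue α V h x 0 0 = 0 := by
  simp [diracValue]

theorem diracValue_solve (hα : IsDiracMatrices α) (hh : h ≠ 0) (x : ℝ) (u f : Spinor n) :
    diracValue α V h x u ((Complex.I / h) • matCLM (α 1) (f - matCLM (α 0) u - (V x : ℂ) • u))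
      = f := by
  have hh' : (h : ℂ) ≠ 0 := by exact_mod_cast hh
  have h1 : -(Complex.I * (h : ℂ)) * (Complex.I / h) = 1 := by
    field_simp
    simp
  rw [diracValue, map_smul, hα.matCLM_sq, smul_smul, h1, one_smul]
  abel

theorem eq_of_diracValue_eq (hα : IsDiracMatrices α) (hh : h ≠ 0) {x : ℝ} {u w f : Spinor n}
    (hf : diracValue α V h x u w = f) :
    w = (Complex.I / h) • matCLM (α 1) (f - matCLM (α 0) u - (V x : ℂ) • u) := by
  have hh' : (h : ℂ) ≠ 0 := by exact_mod_cast hh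
  have h1 : (Complex.I / h) * -(Complex.I * (h : ℂ)) = 1 := by
    field_simp
    simp
  have h2 : f - matCLM (α 0) u - (V x : ℂ) • u = (-(Complex.I * (h : ℂ))) • matCLM (α 1) w := by
    rw [← hf, diracValue]; abel
  rw [h2, map_smul, hα.matCLM_sq, smul_smul, h1, one_smul]

theorem MeasureTheory.MemLp.diracValue (hVc : Continuous V) {B : ℝ} (hVB : ∀ x, |V x| ≤ B)
    {u w : ℝ → Spinor n} (hu : MemLp u 2) (hw : MemLp w 2) :
    MemLp (fun x => diracValue α V h x (u x) (w x)) 2 := by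
  refine MemLp.add (MemLp.add ((hw.continuousLinearMap_comp (matCLM (α 1))).const_smul
    (-(Complex.I * (h : ℂ)))) (hu.continuousLinearMap_comp (matCLM (α 0)))) (hu.of_le_mul (c := B) ?_ ?_)
  · exact (Complex.continuous_ofReal.comp hVc).aestronglyMeasurable.smul hu.1
  · refine ae_of_all _ fun x => ?_
    rw [norm_smul, Complex.norm_real]
    gcongr
    exact hVB x

theorem integrable_inner_of_memLp {f g : ℝ → Spinor n} (hf : MemLp f 2) (hg : MemLp g 2) :
    Integrable fun x => inner ℂ (f x) (g x) := by
  refine (L2.integrable_inner (𝕜 := ℂ) (hf.toLp f) (hg.toLp g)).congr ?_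
  filter_upwards [hf.coeFn_toLp, hg.coeFn_toLp] with x h1 h2
  rw [h1, h2]

theorem inner_toLp {f : ℝ → Spinor n} (hf : MemLp f 2) (u : SpinorL2 n) :
    inner ℂ (hf.toLp f) u = ∫ x, inner ℂ (f x) (u x) := by
  rw [L2.inner_def]
  refine integral_congr_ae ?_
  filter_upwards [hf.coeFn_toLp] with x h1
  rw [h1]

theorem norm_toLp_sq {f : ℝ → Spinor n} (hf : MemLp f 2) : ‖hf.toLp f‖ ^ 2 = ∫ x, ‖f x‖ ^ 2 := by
  have h1 := inner_toLp hf (hf.toLp f)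
  rw [inner_self_eq_norm_sq_to_K] at h1
  have h2 : ∫ x, inner ℂ (f x) (hf.toLp f x) = ∫ x, ((‖f x‖ ^ 2 : ℝ) : ℂ) := by
    refine integral_congr_ae ?_
    filter_upwards [hf.coeFn_toLp] with x h3
    rw [h3, inner_self_eq_norm_sq_to_K]
    simp
  rw [h2, integral_complex_ofReal] at h1
  refine Complex.ofReal_injective ?_
  rw [← h1]
  push_cast
  rfl

/-- `‖(-ihα₁ ∂ + α₀) v‖² = h² ‖v'‖² + ‖v‖² ≥ ‖v‖²`: the cross terms are the derivative of
`⟪-ihα₁ v, α₀ v⟫`, because `α₀` and `α₁` anticommute. -/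
theorem integral_norm_sq_le (hα : IsDiracMatrices α) {v v' : ℝ → Spinor n}
    (hv : ∀ x, HasDerivAt v (v' x) x) (hv2 : MemLp v 2) (hv2' : MemLp v' 2) :
    ∫ x, ‖v x‖ ^ 2 ≤ ∫ x, ‖diracValue α 0 h x (v x) (v' x)‖ ^ 2 := by
  let B : Spinor n →L[ℂ] Spinor n := (-(Complex.I * (h : ℂ))) • matCLM (α 1)
  have hB : ∀ u, B u = (-(Complex.I * (h : ℂ))) • matCLM (α 1) u := fun u => rfl
  have hsymm : ∀ u w, inner ℂ (B u) (matCLM (α 0) w) = inner ℂ (matCLM (α 0) u) (B w) := by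
    intro u w
    rw [hB, hB, inner_smul_left, inner_smul_right, ← inner_matCLM (hα.hermitian 0),
      hα.matCLM_anticomm, inner_neg_left, inner_matCLM (hα.hermitian 1)]
    simp
  have hd : ∀ x, HasDerivAt (fun x => inner ℂ (B (v x)) (matCLM (α 0) (v x)))
      (inner ℂ (matCLM (α 0) (v x)) (B (v' x)) + inner ℂ (B (v' x)) (matCLM (α 0) (v x))) x := by
    intro x
    have h1 : HasDerivAt (fun x => B (v x)) (B (v' x)) x :=
      (B.restrictScalars ℝ).hasFDerivAt.comp_hasDerivAt x (hv x)
    have h2 : HasDerivAt (fun x => matCLM (α 0) (v x)) (matCLM (α 0) (v' x)) x :=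
      ((matCLM (α 0)).restrictScalars ℝ).hasFDerivAt.comp_hasDerivAt x (hv x)
    rw [← hsymm]
    exact h1.inner ℂ h2
  have m1 := hv2.continuousLinearMap_comp (matCLM (α 0))
  have m2 := hv2.continuousLinearMap_comp B
  have m3 := hv2'.continuousLinearMap_comp B
  have i1 := integrable_inner_of_memLp m3 m1
  have hzero := integral_eq_zero_of_hasDerivAt_of_integrable hd
    ((integrable_inner_of_memLp m1 m3).add i1) (integrable_inner_of_memLp m2 m1)
  have hre : ∫ x, 2 * (inner ℂ (B (v' x)) (matCLM (α 0) (v x))).re = 0 := by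
    have h1 : ∀ x, inner ℂ (matCLM (α 0) (v x)) (B (v' x))
        + inner ℂ (B (v' x)) (matCLM (α 0) (v x))
        = ((2 * (inner ℂ (B (v' x)) (matCLM (α 0) (v x))).re : ℝ) : ℂ) := by
      intro x
      rw [← inner_conj_symm, add_comm, Complex.add_conj]
    simp only [h1] at hzero
    rw [integral_complex_ofReal] at hzero
    exact_mod_cast hzero
  have hsum : ∀ x, diracValue α 0 h x (v x) (v' x) = B (v' x) + matCLM (α 0) (v x) := by
    intro x; simp [diracValue, hB]
  have m4 : MemLp (fun x => diracValue α 0 h x (v x) (v' x)) 2 := by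
    simp only [hsum]; exact m3.add m1
  have i2 : Integrable fun x => 2 * (inner ℂ (B (v' x)) (matCLM (α 0) (v x))).re :=
    i1.re.const_mul 2
  have i3 : Integrable fun x => ‖diracValue α 0 h x (v x) (v' x)‖ ^ 2 :=
    m4.integrable_norm_pow (p := 2) two_ne_zero
  have i4 : Integrable fun x => ‖v x‖ ^ 2 := hv2.integrable_norm_pow (p := 2) two_ne_zero
  have h2 : ∫ x, ‖v x‖ ^ 2 ≤ ∫ x, (‖diracValue α 0 h x (v x) (v' x)‖ ^ 2
      - 2 * (inner ℂ (B (v' x)) (matCLM (α 0) (v x))).re) := by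
    refine integral_mono i4 (i3.sub i2) fun x => ?_
    have h3 := norm_add_sq (𝕜 := ℂ) (B (v' x)) (matCLM (α 0) (v x))
    rw [hα.norm_matCLM] at h3
    simp only [hsum, h3, RCLike.re_to_complex]
    nlinarith [sq_nonneg ‖B (v' x)‖]
  rwa [integral_sub i3 i2, hre, sub_zero] at h2

/-- Coercivity: `δ ‖v‖ ≤ ‖D_{h,V} v‖` when `|V| ≤ 1 - δ`. -/
theorem norm_le_norm_diracValue (hα : IsDiracMatrices α) (hVc : Continuous V) {δ : ℝ}
    (hV : ∀ x, |V x| ≤ 1 - δ) {v v' : ℝ → Spinor n}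
    (hv : ∀ x, HasDerivAt v (v' x) x) (hv2 : MemLp v 2) (hv2' : MemLp v' 2) :
    δ * ‖hv2.toLp v‖ ≤ ‖(hv2.diracValue (α := α) (h := h) hVc hV hv2').toLp _‖ := by
  set F := (hv2.diracValue (α := α) (h := h) hVc hV hv2').toLp _ with hF
  have m0 : MemLp (fun x => diracValue α 0 h x (v x) (v' x)) 2 :=
    hv2.diracValue (B := 0) continuous_const (fun _ => abs_zero.le) hv2'
  have h1 : ‖hv2.toLp v‖ ≤ ‖m0.toLp _‖ := by
    have := integral_norm_sq_le (h := h) hα hv hv2 hv2'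
    rw [← norm_toLp_sq hv2, ← norm_toLp_sq m0] at this
    exact (sq_le_sq₀ (norm_nonneg _) (norm_nonneg _)).1 this
  have h2 : ‖m0.toLp _ - F‖ ≤ (1 - δ) * ‖hv2.toLp v‖ := by
    refine Lp.norm_le_mul_norm_of_ae_le_mul ?_
    filter_upwards [Lp.coeFn_sub (m0.toLp _) F, m0.coeFn_toLp, hv2.coeFn_toLp,
      (hv2.diracValue (α := α) (h := h) hVc hV hv2').coeFn_toLp] with x e1 e2 e3 e4
    rw [e1, Pi.sub_apply, e2, e3, hF, e4]
    have : diracValue α 0 h x (v x) (v' x) - diracValue α V h x (v x) (v' x)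
        = -((V x : ℂ) • v x) := by simp [diracValue]
    rw [this, norm_neg, norm_smul, Complex.norm_real]
    gcongr
    exact hV x
  have h3 : ‖m0.toLp _‖ ≤ ‖m0.toLp _ - F‖ + ‖F‖ := by
    simpa using norm_add_le (m0.toLp _ - F) F
  linarith

/-- Weak derivatives may be tested against vector-valued functions. -/
theorem IsWeakDeriv.integral_inner {u w : SpinorL2 n} (hu : IsWeakDeriv u w) {ψ : ℝ → Spinor n}
    (hψ : ContDiff ℝ ∞ ψ) (hc : HasCompactSupport ψ) :
    ∫ x, inner ℂ (deriv ψ x) (u x) = -∫ x, inner ℂ (ψ x) (w x) := by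
  have hul : LocallyIntegrable u := (Lp.memLp u).locallyIntegrable one_le_two
  have hwl : LocallyIntegrable w := (Lp.memLp w).locallyIntegrable one_le_two
  -- The coordinates of `ψ` as real test functions.
  let re : Fin n → ℝ → ℝ := fun i x => (ψ x i).re
  let im : Fin n → ℝ → ℝ := fun i x => (ψ x i).im
  let Lr : Fin n → (Spinor n →L[ℝ] ℝ) := fun i =>
    Complex.reCLM.comp ((EuclideanSpace.proj i : Spinor n →L[ℂ] ℂ).restrictScalars ℝ)
  let Li : Fin n → (Spinor n →L[ℝ] ℝ) := fun i =>
    Complex.imCLM.comp ((EuclideanSpace.proj i : Spinor n →L[ℂ] ℂ).restrictScalars ℝ)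
  have hd : Differentiable ℝ ψ := hψ.differentiable (by simp)
  have key : ∀ (L : Spinor n →L[ℝ] ℝ),
      Integrable (fun x => L (deriv ψ x) • u x) ∧ Integrable (fun x => L (ψ x) • w x) ∧
      ∫ x, L (deriv ψ x) • u x = -∫ x, L (ψ x) • w x := by
    intro L
    have h1 : ContDiff ℝ ∞ fun x => L (ψ x) := L.contDiff.comp hψ
    have h2 : HasCompactSupport fun x => L (ψ x) := hc.comp_left (map_zero L)
    have h3 : ∀ x, deriv (fun x => L (ψ x)) x = L (deriv ψ x) := fun x =>
      (L.hasFDerivAt.comp_hasDerivAt x (hd x).hasDerivAt).deriv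
    have h4 := hu _ h1 h2
    simp only [h3] at h4
    refine ⟨hul.integrable_smul_left_of_hasCompactSupport
      (L.continuous.comp (hψ.continuous_deriv (by simp))) (hc.deriv.comp_left (map_zero L)),
      hwl.integrable_smul_left_of_hasCompactSupport h1.continuous h2, h4⟩
  have expand : ∀ a b : Spinor n, inner ℂ a b = ∑ i, ((Lr i a • b) i - Complex.I * (Li i a • b) i) := by
    intro a b
    rw [PiLp.inner_apply]
    refine Finset.sum_congr rfl fun i _ => ?_
    simp only [RCLike.inner_apply, PiLp.smul_apply, Complex.real_smul]
    change b i * (starRingEnd ℂ) (a i) = ((a i).re : ℂ) * b i - Complex.I * (((a i).im : ℂ) * b i)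
    conv_lhs => rw [← Complex.re_add_im (a i)]
    simp only [map_add, map_mul, Complex.conj_ofReal, Complex.conj_I]
    ring
  have coord : ∀ (f : ℝ → Spinor n), Integrable f → ∀ i, Integrable (fun x => f x i) ∧
      ∫ x, f x i = (∫ x, f x) i := fun f hf i =>
    ⟨(EuclideanSpace.proj i : Spinor n →L[ℂ] ℂ).integrable_comp hf,
      (EuclideanSpace.proj i : Spinor n →L[ℂ] ℂ).integral_comp_comm hf⟩
  simp only [expand]
  rw [integral_finsetSum, integral_finsetSum, ← Finset.sum_neg_distrib]
  · refine Finset.sum_congr rfl fun i _ => ?_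
    rw [integral_sub (coord _ (key (Lr i)).1 i).1 ((coord _ (key (Li i)).1 i).1.const_mul _),
      integral_sub (coord _ (key (Lr i)).2.1 i).1 ((coord _ (key (Li i)).2.1 i).1.const_mul _),
      integral_const_mul, integral_const_mul, (coord _ (key (Lr i)).1 i).2,
      (coord _ (key (Li i)).1 i).2, (coord _ (key (Lr i)).2.1 i).2, (coord _ (key (Li i)).2.1 i).2,
      (key (Lr i)).2.2, (key (Li i)).2.2]
    simp only [PiLp.neg_apply]
    ring
  · exact fun i _ => (coord _ (key (Lr i)).2.1 i).1.sub ((coord _ (key (Li i)).2.1 i).1.const_mul _)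
  · exact fun i _ => (coord _ (key (Lr i)).1 i).1.sub ((coord _ (key (Li i)).1 i).1.const_mul _)

theorem continuous_diracValue (hVc : Continuous V) {ψ : ℝ → Spinor n} (hψ : ContDiff ℝ ∞ ψ) :
    Continuous fun x => diracValue α V h x (ψ x) (deriv ψ x) := by
  have h1 : Continuous (deriv ψ) := hψ.continuous_deriv (by simp)
  have h2 := hψ.continuous
  have h3 := (matCLM (α 0)).continuous.comp h2
  have h4 := (matCLM (α 1)).continuous.comp h1
  have h5 : Continuous fun x => (V x : ℂ) := Complex.continuous_ofReal.comp hVc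
  have h6 : Continuous fun x => (-(Complex.I * (h : ℂ))) • matCLM (α 1) (deriv ψ x) :=
    h4.const_smul (-(Complex.I * (h : ℂ)))
  simp only [diracValue]
  exact (h6.add h3).add (h5.smul h2)

theorem memLp_diracValue (hVc : Continuous V) {ψ : ℝ → Spinor n} (hψ : ContDiff ℝ ∞ ψ)
    (hc : HasCompactSupport ψ) : MemLp (fun x => diracValue α V h x (ψ x) (deriv ψ x)) 2 := by
  refine (continuous_diracValue hVc hψ).memLp_of_hasCompactSupport
    (hc.mono' fun x hx => ?_)
  by_contra hx'
  have h1 : ψ x = 0 := image_eq_zero_of_notMem_tsupport hx'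
  have h2 : deriv ψ x = 0 := by
    by_contra h3
    exact hx' (support_deriv_subset (Function.mem_support.2 h3))
  exact hx (by simp only [h1, h2, diracValue_zero])

/-- The graph of the Dirac operator is described by testing against smooth compactly supported
functions, on which the symmetric operator acts classically. -/
theorem diracGraph_iff (hα : IsDiracMatrices α) (hVc : Continuous V) {B : ℝ}
    (hVB : ∀ x, |V x| ≤ B) (hh : h ≠ 0) (u f : SpinorL2 n) :
    DiracGraph α V h u f ↔ ∀ ψ : ℝ → Spinor n, ContDiff ℝ ∞ ψ → HasCompactSupport ψ →
      ∫ x, inner ℂ (diracValue α V h x (ψ x) (deriv ψ x)) (u x) = ∫ x, inner ℂ (ψ x) (f x) := by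
  have hu := Lp.memLp u
  have hV2 : ∀ {g : ℝ → Spinor n}, MemLp g 2 → MemLp (fun x => (V x : ℂ) • g x) 2 := by
    intro g hg
    refine hg.of_le_mul (c := B) ((Complex.continuous_ofReal.comp hVc).aestronglyMeasurable.smul
      hg.1) (ae_of_all _ fun x => ?_)
    rw [norm_smul, Complex.norm_real]
    gcongr
    exact hVB x
  have hz : MemLp (fun x => matCLM (α 0) (u x) + (V x : ℂ) • u x) 2 :=
    (hu.continuousLinearMap_comp (matCLM (α 0))).add (hV2 hu)
  have hsplit : ∀ (x : ℝ) (a b c : Spinor n), inner ℂ (diracValue α V h x a b) c =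
      Complex.I * h * inner ℂ (matCLM (α 1) b) c
        + inner ℂ a (matCLM (α 0) c + (V x : ℂ) • c) := by
    intro x a b c
    simp only [diracValue, inner_add_left, inner_smul_left, inner_add_right, inner_smul_right,
      inner_matCLM (hα.hermitian 0)]
    simp
    ring
  constructor
  · rintro ⟨w, hw, hf⟩ ψ hψ hc
    have hψ2 : MemLp ψ 2 := hψ.continuous.memLp_of_hasCompactSupport hc
    have hψ2' : MemLp (deriv ψ) 2 :=
      (hψ.continuous_deriv (by simp)).memLp_of_hasCompactSupport hc.deriv
    have h1 := hw.integral_inner (ψ := fun x => matCLM (α 1) (ψ x))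
      (((matCLM (α 1)).restrictScalars ℝ).contDiff.comp hψ) (hc.comp_left (map_zero _))
    have h2 : ∀ x, deriv (fun x => matCLM (α 1) (ψ x)) x = matCLM (α 1) (deriv ψ x) := fun x =>
      (((matCLM (α 1)).restrictScalars ℝ).hasFDerivAt.comp_hasDerivAt x
        ((hψ.differentiable (by simp)) x).hasDerivAt).deriv
    simp only [h2] at h1
    have h3 : ∫ x, inner ℂ (ψ x) (f x) = ∫ x, (-(Complex.I * h) * inner ℂ (matCLM (α 1) (ψ x)) (w x)
        + inner ℂ (ψ x) (matCLM (α 0) (u x) + (V x : ℂ) • u x)) := by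
      refine integral_congr_ae ?_
      filter_upwards [hf] with x hx
      rw [hx, matAct_eq, matAct_eq, add_assoc, inner_add_right, inner_smul_right,
        inner_matCLM (hα.hermitian 1)]
    have i1 := integrable_inner_of_memLp (hψ2'.continuousLinearMap_comp (matCLM (α 1))) hu
    have i2 := integrable_inner_of_memLp hψ2 hz
    have i3 := integrable_inner_of_memLp (hψ2.continuousLinearMap_comp (matCLM (α 1))) (Lp.memLp w)
    simp only [hsplit]
    rw [h3, integral_add (i1.const_mul _) i2, integral_add (i3.const_mul _) i2,
      integral_const_mul, integral_const_mul, h1]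
    ring
  · intro H
    have hw : MemLp (fun x => (Complex.I / h) •
        matCLM (α 1) (f x - matCLM (α 0) (u x) - (V x : ℂ) • u x)) 2 :=
      ((((Lp.memLp f).sub (hu.continuousLinearMap_comp (matCLM (α 0)))).sub
        (hV2 hu)).continuousLinearMap_comp (matCLM (α 1))).const_smul (Complex.I / h)
    refine ⟨hw.toLp _, fun φ hφ hc => ?_, ?_⟩
    · refine ext_inner_left ℂ fun e => ?_
      have hul : LocallyIntegrable u := hu.locallyIntegrable one_le_two
      have hwl : LocallyIntegrable (hw.toLp _) := (Lp.memLp _).locallyIntegrable one_le_two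
      have hφ' : Continuous (deriv φ) := hφ.continuous_deriv (by simp)
      rw [inner_neg_right, ← _root_.integral_inner
        (hul.integrable_smul_left_of_hasCompactSupport hφ' hc.deriv), ← _root_.integral_inner
        (hwl.integrable_smul_left_of_hasCompactSupport hφ.continuous hc)]
      let a : Spinor n := (Complex.I / h) • matCLM (α 1) e
      let ψ : ℝ → Spinor n := fun x => φ x • a
      have hψ : ContDiff ℝ ∞ ψ := hφ.smul contDiff_const
      have hψc : HasCompactSupport ψ := hc.smul_right
      have hψ2 : MemLp ψ 2 := hψ.continuous.memLp_of_hasCompactSupport hψc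
      have hψd : ∀ x, deriv ψ x = deriv φ x • a := fun x =>
        (((hφ.differentiable (by simp)) x).hasDerivAt.smul_const a).deriv
      have h1 := H ψ hψ hψc
      have hh' : (h : ℂ) ≠ 0 := by exact_mod_cast hh
      have ha : ∀ (c : ℝ) (b : Spinor n), Complex.I * h * inner ℂ (matCLM (α 1) (c • a)) b
          = inner ℂ e (c • b) := by
        intro c b
        have h3 : matCLM (α 1) (c • a) = (c * (Complex.I / h)) • e := by
          rw [← Complex.coe_smul, map_smul, map_smul, hα.matCLM_sq, smul_smul]
        rw [h3, inner_smul_left, ← Complex.coe_smul, inner_smul_right]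
        simp only [map_mul, map_div₀, Complex.conj_ofReal, Complex.conj_I]
        field_simp
        rw [Complex.I_sq]
        ring
      have hb : ∀ (c : ℝ) (b : Spinor n), inner ℂ (c • a) b
          = -inner ℂ e (c • ((Complex.I / h) • matCLM (α 1) b)) := by
        intro c b
        simp only [a, ← Complex.coe_smul, inner_smul_left, inner_smul_right,
          inner_matCLM (hα.hermitian 1), map_div₀, Complex.conj_ofReal, Complex.conj_I]
        ring
      simp only [hsplit, hψd, ha] at h1
      have i1 : Integrable fun x => inner ℂ e (deriv φ x • u x) :=
        (innerSL ℂ e).integrable_comp (hul.integrable_smul_left_of_hasCompactSupport hφ' hc.deriv)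
      have i2 := integrable_inner_of_memLp hψ2 hz
      have i3 := integrable_inner_of_memLp hψ2 (Lp.memLp f)
      rw [integral_add i1 i2, ← eq_sub_iff_add_eq, ← integral_sub i3 i2] at h1
      rw [h1, ← integral_neg]
      refine integral_congr_ae ?_
      filter_upwards [hw.coeFn_toLp] with x hx
      rw [hx, ← inner_sub_right, sub_add_eq_sub_sub]
      exact hb _ _
    · filter_upwards [hw.coeFn_toLp] with x hx
      rw [hx]
      exact (diracValue_solve hα hh x (u x) (f x)).symm

end DiracOperator

/-! ### Existence and uniqueness of the bounded inverse -/

section Inverse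

variable {n : ℕ} {α : Fin 2 → Matrix (Fin n) (Fin n) ℂ} {V : ℝ → ℝ} {h : ℝ}

/-- `v` is a smooth square-integrable classical solution of `D_{h,V} v = g`. -/
structure IsClassicalSolution (α : Fin 2 → Matrix (Fin n) (Fin n) ℂ) (V : ℝ → ℝ) (h : ℝ)
    (g v : ℝ → Spinor n) : Prop where
  smooth : ContDiff ℝ ∞ v
  memLp : MemLp v 2
  eq : ∀ x, diracValue α V h x (v x) (deriv v x) = g x

theorem IsClassicalSolution.memLp_deriv (hα : IsDiracMatrices α) (hVc : Continuous V) {B : ℝ}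
    (hVB : ∀ x, |V x| ≤ B) (hh : h ≠ 0) {g v : ℝ → Spinor n} (hv : IsClassicalSolution α V h g v)
    (hg : MemLp g 2) : MemLp (deriv v) 2 := by
  have h1 : deriv v = fun x =>
      (Complex.I / h) • matCLM (α 1) (g x - matCLM (α 0) (v x) - (V x : ℂ) • v x) :=
    funext fun x => eq_of_diracValue_eq hα hh (hv.eq x)
  have h2 : MemLp (fun x => (V x : ℂ) • v x) 2 := by
    refine hv.memLp.of_le_mul (c := B) ((Complex.continuous_ofReal.comp hVc).aestronglyMeasurable.smul
      hv.memLp.1) (ae_of_all _ fun x => ?_)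
    rw [norm_smul, Complex.norm_real]
    gcongr
    exact hVB x
  rw [h1]
  exact (((hg.sub (hv.memLp.continuousLinearMap_comp (matCLM (α 0)))).sub
    h2).continuousLinearMap_comp (matCLM (α 1))).const_smul (Complex.I / h)

/-- A smooth function equal to `1` on a neighbourhood of `[-1, 1]`, with compact support; the
functions `x ↦ cutoff (x / R)` exhaust the line. -/
theorem exists_cutoff : ∃ χ : ℝ → ℝ, ContDiff ℝ ∞ χ ∧ HasCompactSupport χ ∧
    (∀ x, |x| < 1 → χ x = 1) ∧ (∀ x, |χ x| ≤ 1) ∧ ∃ C, ∀ x, |deriv χ x| ≤ C := by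
  let f : ContDiffBump (0 : ℝ) := ⟨1, 2, one_pos, one_lt_two⟩
  have hd : Continuous (deriv f) := (f.contDiff : ContDiff ℝ ∞ f).continuous_deriv (by simp)
  obtain ⟨C, hC⟩ := f.hasCompactSupport.deriv.exists_bound_of_continuous hd
  refine ⟨f, f.contDiff, f.hasCompactSupport, fun x hx => f.one_of_mem_closedBall ?_, fun x => ?_,
    C, hC⟩
  · simpa using hx.le
  · rw [abs_of_nonneg f.nonneg]; exact f.le_one

/-- If classical solutions exist for all test functions, `D_{h,V}` is injective on `H¹`: test the
weak equation against truncations of a classical solution. -/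
theorem DiracGraph.eq_zero (hα : IsDiracMatrices α) (hVc : Continuous V) {B : ℝ}
    (hVB : ∀ x, |V x| ≤ B) (hh : h ≠ 0)
    (hsolv : ∀ g : ℝ → Spinor n, ContDiff ℝ ∞ g → HasCompactSupport g →
      ∃ v, IsClassicalSolution α V h g v)
    {u : SpinorL2 n} (hu : DiracGraph α V h u 0) : u = 0 := by
  have hzero : ∀ ψ : ℝ → Spinor n, ContDiff ℝ ∞ ψ → HasCompactSupport ψ →
      ∫ x, inner ℂ (diracValue α V h x (ψ x) (deriv ψ x)) (u x) = 0 := by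
    intro ψ hψ hc
    rw [(diracGraph_iff hα hVc hVB hh u 0).1 hu ψ hψ hc, ← integral_zero ℝ ℂ]
    refine integral_congr_ae ?_
    filter_upwards [Lp.coeFn_zero (Spinor n) 2 (volume : Measure ℝ)] with x hx
    rw [hx, Pi.zero_apply, inner_zero_right]
  obtain ⟨χ, hχ, hχc, hχ1, hχb, C, hC⟩ := exists_cutoff
  have hC0 : 0 ≤ C := (abs_nonneg _).trans (hC 0)
  have test : ∀ g : ℝ → Spinor n, ContDiff ℝ ∞ g → HasCompactSupport g →
      ∫ x, inner ℂ (g x) (u x) = 0 := by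
    intro g hg hgc
    obtain ⟨v, hv⟩ := hsolv g hg hgc
    have hg2 : MemLp g 2 := hg.continuous.memLp_of_hasCompactSupport hgc
    let s : ℕ → ℝ := fun k => ((k : ℝ) + 1)⁻¹
    have hs : ∀ k, 0 < s k ∧ s k ≤ 1 := fun k =>
      ⟨by positivity, inv_le_one_of_one_le₀ (by linarith [(Nat.cast_nonneg k : (0 : ℝ) ≤ k)])⟩
    let η : ℕ → ℝ → ℝ := fun k x => χ (s k * x)
    have hη : ∀ k, ContDiff ℝ ∞ (η k) := fun k => hχ.comp (contDiff_const.mul contDiff_id)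
    have hηc : ∀ k, HasCompactSupport (η k) := fun k =>
      hχc.comp_homeomorph (Homeomorph.mulLeft₀ (s k) (hs k).1.ne')
    have hηd : ∀ k x, HasDerivAt (η k) (s k * deriv χ (s k * x)) x := by
      intro k x
      have h1 : HasDerivAt (fun x => s k * x) (s k) x := by
        simpa using (hasDerivAt_id x).const_mul (s k)
      have h2 := ((hχ.differentiable (by simp)) (s k * x)).hasDerivAt.comp x h1
      rwa [mul_comm] at h2
    have hψd : ∀ k x, deriv (fun x => η k x • v x) x =
        η k x • deriv v x + (s k * deriv χ (s k * x)) • v x := fun k x =>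
      ((hηd k x).smul ((hv.smooth.differentiable (by simp)) x).hasDerivAt).deriv
    let G : ℕ → ℝ → Spinor n := fun k x =>
      diracValue α V h x (η k x • v x) (deriv (fun x => η k x • v x) x)
    have hG : ∀ k x, G k x = η k x • g x
        + (-(Complex.I * (h : ℂ))) • matCLM (α 1) ((s k * deriv χ (s k * x)) • v x) := by
      intro k x
      rw [← hv.eq x]
      simp only [G]
      rw [hψd]
      simp only [diracValue, ← Complex.coe_smul, map_add, map_smul, smul_add]
      simp only [smul_comm ((η k x : ℝ) : ℂ)]
      abel
    have hGint : ∀ k, ∫ x, inner ℂ (G k x) (u x) = 0 := fun k =>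
      hzero (fun x => η k x • v x) ((hη k).smul hv.smooth) (hηc k).smul_right
    have hlim : Tendsto (fun k => ∫ x, inner ℂ (G k x) (u x)) atTop
        (𝓝 (∫ x, inner ℂ (g x) (u x))) := by
      refine tendsto_integral_of_dominated_convergence
        (fun x => ‖g x‖ * ‖u x‖ + |h| * C * (‖v x‖ * ‖u x‖)) (fun k => ?_) ?_ (fun k => ?_) ?_
      · exact AEStronglyMeasurable.inner (continuous_diracValue hVc
          ((hη k).smul hv.smooth)).aestronglyMeasurable (Lp.memLp u).1
      · have i1 : Integrable fun x => ‖g x‖ * ‖u x‖ := hg2.norm.integrable_mul (Lp.memLp u).norm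
        have i2 : Integrable fun x => ‖v x‖ * ‖u x‖ := hv.memLp.norm.integrable_mul (Lp.memLp u).norm
        exact i1.add (i2.const_mul _)
      · refine ae_of_all _ fun x => (norm_inner_le_norm _ _).trans ?_
        have h1 : ‖G k x‖ ≤ ‖g x‖ + |h| * C * ‖v x‖ := by
          rw [hG]
          refine (norm_add_le _ _).trans (add_le_add ?_ ?_)
          · rw [norm_smul, Real.norm_eq_abs]
            exact mul_le_of_le_one_left (norm_nonneg _) (hχb _)
          · rw [norm_smul, norm_neg, norm_mul, Complex.norm_I, one_mul, Complex.norm_real,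
              hα.norm_matCLM, norm_smul, Real.norm_eq_abs, Real.norm_eq_abs, abs_mul,
              abs_of_pos (hs k).1, mul_assoc |h|]
            gcongr
            calc s k * |deriv χ (s k * x)| ≤ 1 * C :=
                  mul_le_mul (hs k).2 (hC _) (abs_nonneg _) zero_le_one
              _ = C := one_mul C
        calc ‖G k x‖ * ‖u x‖ ≤ (‖g x‖ + |h| * C * ‖v x‖) * ‖u x‖ := by gcongr
          _ = _ := by ring
      · refine ae_of_all _ fun x => tendsto_const_nhds.congr' ?_
        -- Near a fixed point the cutoff is eventually equal to `1`.
        have h1 : Tendsto (fun k => |s k * x|) atTop (𝓝 0) := by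
          have := (tendsto_one_div_add_atTop_nhds_zero_nat (𝕜 := ℝ)).mul_const x
          simpa [s, one_div] using this.abs
        filter_upwards [h1.eventually_lt_const one_pos] with k hk
        have h2 : η k x = 1 := hχ1 _ hk
        have h3 : deriv χ (s k * x) = 0 := by
          have : χ =ᶠ[𝓝 (s k * x)] fun _ => 1 := by
            filter_upwards [continuous_abs.continuousAt.eventually_lt_const hk] with y hy
              using hχ1 y hy
          rw [this.deriv_eq, deriv_const]
        rw [hG, h2, h3]
        simp
    simp only [hGint] at hlim
    exact (tendsto_nhds_unique hlim tendsto_const_nhds)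
  have h1 : ∀ F : SpinorL2 n, inner ℂ F u = 0 := by
    have hdense := Lp.dense_hasCompactSupport_contDiff (E := ℝ) (F := Spinor n)
      (μ := (volume : Measure ℝ)) (p := 2) (by simp)
    have hclosed : IsClosed {F : SpinorL2 n | inner ℂ F u = (0 : ℂ)} :=
      isClosed_eq (continuous_id.inner continuous_const) continuous_const
    intro F
    refine closure_minimal ?_ hclosed (hdense F)
    rintro G ⟨g, hGg, hgc, hg⟩
    change inner ℂ G u = (0 : ℂ)
    rw [L2.inner_def, ← test g hg hgc]
    refine integral_congr_ae ?_
    filter_upwards [hGg] with x hx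
    rw [hx]
  exact inner_self_eq_zero.1 (h1 u)

/-- The part of the graph of `D_{h,V}` over differentiable functions, as pairs `(D_{h,V} v, v)`. -/
noncomputable def classicalGraph (α : Fin 2 → Matrix (Fin n) (Fin n) ℂ) (V : ℝ → ℝ) (h : ℝ) :
    Submodule ℂ (SpinorL2 n × SpinorL2 n) where
  carrier := {p | ∃ v v' : ℝ → Spinor n, (∀ x, HasDerivAt v (v' x) x) ∧ MemLp v 2 ∧ MemLp v' 2 ∧
    p.2 =ᵐ[volume] v ∧ p.1 =ᵐ[volume] fun x => diracValue α V h x (v x) (v' x)}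
  zero_mem' := by
    refine ⟨0, 0, fun x => hasDerivAt_const x 0, MemLp.zero, MemLp.zero, Lp.coeFn_zero _ _ _, ?_⟩
    filter_upwards [Lp.coeFn_zero (Spinor n) 2 (volume : Measure ℝ)] with x hx
    simp [diracValue_zero]
  add_mem' := by
    rintro ⟨F, U⟩ ⟨G, W⟩ ⟨v, v', h1, h2, h3, h4, h5⟩ ⟨w, w', k1, k2, k3, k4, k5⟩
    refine ⟨v + w, v' + w', fun x => (h1 x).add (k1 x), h2.add k2, h3.add k3,
      (Lp.coeFn_add U W).trans (h4.add k4), ?_⟩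
    filter_upwards [Lp.coeFn_add F G, h5, k5] with x e1 e2 e3
    simp only [Prod.fst_add, Pi.add_apply, diracValue_add] at e1 e2 e3 ⊢
    rw [e1, e2, e3]
  smul_mem' := by
    rintro c ⟨F, U⟩ ⟨v, v', h1, h2, h3, h4, h5⟩
    refine ⟨c • v, c • v', fun x => (h1 x).const_smul c, h2.const_smul c, h3.const_smul c,
      (Lp.coeFn_smul c U).trans (h4.const_smul c), ?_⟩
    filter_upwards [Lp.coeFn_smul c F, h5] with x e1 e2
    simp only [Prod.smul_fst, Pi.smul_apply, diracValue_smul] at e1 e2 ⊢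
    rw [e1, e2]

theorem diracGraph_of_mem_classicalGraph {p : SpinorL2 n × SpinorL2 n}
    (hp : p ∈ classicalGraph α V h) : DiracGraph α V h p.2 p.1 := by
  obtain ⟨v, v', hv, hv2, hv2', hU, hF⟩ := hp
  refine ⟨hv2'.toLp v', fun φ hφ hc => ?_, ?_⟩
  · have e1 : ∫ x, deriv φ x • p.2 x = ∫ x, deriv φ x • v x := by
      refine integral_congr_ae ?_
      filter_upwards [hU] with x hx
      rw [hx]
    have e2 : ∫ x, φ x • hv2'.toLp v' x = ∫ x, φ x • v' x := by
      refine integral_congr_ae ?_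
      filter_upwards [hv2'.coeFn_toLp] with x hx
      rw [hx]
    have hvl := hv2.locallyIntegrable one_le_two
    have i1 := (hv2'.locallyIntegrable one_le_two).integrable_smul_left_of_hasCompactSupport
      hφ.continuous hc
    have i2 := hvl.integrable_smul_left_of_hasCompactSupport (hφ.continuous_deriv (by simp)) hc.deriv
    have h1 := integral_eq_zero_of_hasDerivAt_of_integrable
      (fun x => ((hφ.differentiable (by simp)) x).hasDerivAt.smul (hv x)) (i1.add i2)
      (hvl.integrable_smul_left_of_hasCompactSupport hφ.continuous hc)
    rw [integral_add i1 i2] at h1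
    rw [e1, e2]
    exact eq_neg_of_add_eq_zero_right h1
  · filter_upwards [hU, hF, hv2'.coeFn_toLp] with x e1 e2 e3
    rw [e1, e2, e3]
    rfl

/-- If classical solutions exist for all test functions, `D_{h,V}` has a bounded inverse: the
solution operator extends by coercivity and density, and the graph of `D_{h,V}` is closed. -/
theorem exists_isDiracInverse (hα : IsDiracMatrices α) (hVc : Continuous V) {δ : ℝ} (hδ : 0 < δ)
    (hV : ∀ x, |V x| ≤ 1 - δ) (hh : h ≠ 0)
    (hsolv : ∀ g : ℝ → Spinor n, ContDiff ℝ ∞ g → HasCompactSupport g →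
      ∃ v, IsClassicalSolution α V h g v) :
    ∃ T : SpinorL2 n →L[ℂ] SpinorL2 n, IsDiracInverse α V h T := by
  let Γ := classicalGraph α V h
  let e : Γ →ₗ[ℂ] SpinorL2 n := (LinearMap.fst ℂ _ _).comp Γ.subtype
  let f : Γ →ₗ[ℂ] SpinorL2 n := (LinearMap.snd ℂ _ _).comp Γ.subtype
  have hnorm : ∃ C, ∀ p : Γ, ‖f p‖ ≤ C * ‖e p‖ := by
    refine ⟨δ⁻¹, ?_⟩
    rintro ⟨⟨F, U⟩, v, v', hv, hv2, hv2', hU, hF⟩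
    have h1 := norm_le_norm_diracValue (h := h) hα hVc hV hv hv2 hv2'
    have h2 : hv2.toLp v = U := Lp.ext (hv2.coeFn_toLp.trans hU.symm)
    have h3 : (hv2.diracValue (α := α) (h := h) hVc hV hv2').toLp _ = F :=
      Lp.ext ((MemLp.coeFn_toLp _).trans hF.symm)
    rw [h2, h3] at h1
    change ‖U‖ ≤ δ⁻¹ * ‖F‖
    rw [inv_mul_eq_div, le_div_iff₀ hδ]
    linarith
  have hdense : DenseRange e := by
    refine (Lp.dense_hasCompactSupport_contDiff (E := ℝ) (F := Spinor n)
      (μ := (volume : Measure ℝ)) (p := 2) (by simp)).mono ?_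
    rintro F ⟨g, hFg, hgc, hg⟩
    obtain ⟨v, hv⟩ := hsolv g hg hgc
    refine ⟨⟨(F, hv.memLp.toLp v), v, deriv v,
      fun x => ((hv.smooth.differentiable (by simp)) x).hasDerivAt, hv.memLp,
      hv.memLp_deriv hα hVc hV hh (hg.continuous.memLp_of_hasCompactSupport hgc),
      hv.memLp.coeFn_toLp, ?_⟩, rfl⟩
    simp only [hv.eq]
    exact hFg
  let T : SpinorL2 n →L[ℂ] SpinorL2 n := f.extendOfNorm e
  have hT : ∀ p : Γ, T (e p) = f p := LinearMap.extendOfNorm_eq hdense hnorm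
  have hgraph : ∀ F, DiracGraph α V h (T F) F := by
    have hclosed : IsClosed {F | DiracGraph α V h (T F) F} := by
      simp only [diracGraph_iff hα hVc hV hh, Set.ofPred_forall]
      refine isClosed_iInter fun ψ => isClosed_iInter fun hψ => isClosed_iInter fun hc => ?_
      have hψ2 : MemLp ψ 2 := hψ.continuous.memLp_of_hasCompactSupport hc
      simp only [← inner_toLp (memLp_diracValue (α := α) (h := h) hVc hψ hc), ← inner_toLp hψ2]
      exact isClosed_eq (continuous_const.inner T.continuous) (continuous_const.inner continuous_id)
    intro F
    refine hdense.induction_on (p := fun F => DiracGraph α V h (T F) F) F hclosed fun p => ?_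
    rw [hT]
    exact diracGraph_of_mem_classicalGraph p.2
  refine ⟨T, hgraph, fun u F hu => ?_⟩
  have h1 : DiracGraph α V h (T F - u) 0 := by
    rw [diracGraph_iff hα hVc hV hh]
    intro ψ hψ hc
    have hψ2 : MemLp ψ 2 := hψ.continuous.memLp_of_hasCompactSupport hc
    have h2 := (diracGraph_iff hα hVc hV hh _ _).1 hu ψ hψ hc
    have h3 := (diracGraph_iff hα hVc hV hh _ _).1 (hgraph F) ψ hψ hc
    rw [← inner_toLp (memLp_diracValue (α := α) (h := h) hVc hψ hc), ← inner_toLp hψ2] at h2 h3 ⊢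
    rw [inner_sub_right, h2, h3, sub_self, inner_zero_right]
  exact sub_eq_zero.1 (h1.eq_zero hα hVc hV hh hsolv)

/-- On test functions the inverse is given by the classical solutions. -/
theorem IsDiracInverse.ae_eq {T : SpinorL2 n →L[ℂ] SpinorL2 n} (hT : IsDiracInverse α V h T)
    (hα : IsDiracMatrices α) (hVc : Continuous V) {B : ℝ} (hVB : ∀ x, |V x| ≤ B) (hh : h ≠ 0)
    {g v : ℝ → Spinor n} (hg : MemLp g 2) (hv : IsClassicalSolution α V h g v)
    {F : SpinorL2 n} (hF : F =ᵐ[volume] g) : T F =ᵐ[volume] v := by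
  have h1 : (F, hv.memLp.toLp v) ∈ classicalGraph α V h :=
    ⟨v, deriv v, fun x => ((hv.smooth.differentiable (by simp)) x).hasDerivAt, hv.memLp,
      hv.memLp_deriv hα hVc hVB hh hg, hv.memLp.coeFn_toLp, by simpa only [hv.eq] using hF⟩
  rw [hT.2 _ _ (diracGraph_of_mem_classicalGraph h1)]
  exact hv.memLp.coeFn_toLp

theorem IsDiracInverse.unique {T T' : SpinorL2 n →L[ℂ] SpinorL2 n} (hT : IsDiracInverse α V h T)
    (hT' : IsDiracInverse α V h T') : T = T' :=
  ContinuousLinearMap.ext fun f => hT.2 _ _ (hT'.1 f)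

end Inverse

/-! ### Matrix units in the Clifford algebra -/

section Clifford

variable {n : ℕ} (α : Fin 2 → Matrix (Fin n) (Fin n) ℂ)

/-- The matrix `i α₁`, which plays the role of `(0, 1; -1, 0)`. -/
noncomputable def diracJ : Matrix (Fin n) (Fin n) ℂ := Complex.I • α 1

/-- The image in `M_n(ℂ)` of the upper left matrix unit of `M_2(ℂ)` under the homomorphism which
sends `(0, 1; 1, 0)` to `α₀` and `(0, 1; -1, 0)` to `i α₁`. In this realisation the equation
`D_{h,V} u = 0` becomes a real `2 × 2` system. -/
noncomputable def unit11 : Matrix (Fin n) (Fin n) ℂ := (1 / 2 : ℂ) • (1 - α 0 * diracJ α)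

/-- The upper right matrix unit, see `unit11`. -/
noncomputable def unit12 : Matrix (Fin n) (Fin n) ℂ := (1 / 2 : ℂ) • (α 0 + diracJ α)

/-- The lower left matrix unit, see `unit11`. -/
noncomputable def unit21 : Matrix (Fin n) (Fin n) ℂ := (1 / 2 : ℂ) • (α 0 - diracJ α)

/-- The lower right matrix unit, see `unit11`. -/
noncomputable def unit22 : Matrix (Fin n) (Fin n) ℂ := (1 / 2 : ℂ) • (1 + α 0 * diracJ α)

/-- The image in `M_n(ℂ)` of the real matrix `(a, b; c, d)`. -/
noncomputable def cliffordMatrix (a b c d : ℝ) : Matrix (Fin n) (Fin n) ℂ :=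
  (a : ℂ) • unit11 α + (b : ℂ) • unit12 α + (c : ℂ) • unit21 α + (d : ℂ) • unit22 α

variable {α}

theorem one_eq_units : (1 : Matrix (Fin n) (Fin n) ℂ) = unit11 α + unit22 α := by
  simp only [unit11, unit22]; module

theorem alpha0_eq_units : α 0 = unit12 α + unit21 α := by
  simp only [unit12, unit21]; module

theorem diracJ_eq_units : diracJ α = unit12 α - unit21 α := by
  simp only [unit12, unit21]; module

theorem alpha1_eq : α 1 = (-Complex.I) • diracJ α := by
  rw [diracJ, smul_smul]; simp

namespace IsDiracMatrices

theorem diracJ_sq (hα : IsDiracMatrices α) : diracJ α * diracJ α = -1 := by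
  rw [diracJ, smul_mul_smul_comm, hα.sq_eq_one]; simp

theorem anticomm_diracJ (hα : IsDiracMatrices α) : diracJ α * α 0 = -(α 0 * diracJ α) := by
  rw [diracJ, smul_mul_assoc, mul_smul_comm, hα.anticomm, smul_neg, neg_neg]

/-- The multiplication table needed below: products with `α₀` and `i α₁` on the left. -/
theorem mul_units (hα : IsDiracMatrices α) :
    α 0 * unit11 α = unit21 α ∧ α 0 * unit21 α = unit11 α ∧ diracJ α * unit11 α = -unit21 α ∧
      diracJ α * unit21 α = unit11 α ∧ α 0 * unit12 α = unit22 α ∧ α 0 * unit22 α = unit12 α ∧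
      diracJ α * unit12 α = -unit22 α ∧ diracJ α * unit22 α = unit12 α := by
  have h1 := hα.sq_eq_one 0
  have h2 := hα.diracJ_sq
  have h3 := hα.anticomm_diracJ
  have h4 : ∀ Z, α 0 * (α 0 * Z) = Z := fun Z => by rw [← mul_assoc, h1, one_mul]
  have h5 : diracJ α * (α 0 * diracJ α) = α 0 := by
    rw [← mul_assoc, h3, neg_mul, mul_assoc, h2]; simp
  refine ⟨?_, ?_, ?_, ?_, ?_, ?_, ?_, ?_⟩ <;>
    simp only [unit11, unit12, unit21, unit22, mul_smul_comm, mul_sub, mul_add, mul_one, h1, h2,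
      h3, h4, h5] <;> try module

theorem unit_products (hα : IsDiracMatrices α) :
    unit11 α * unit11 α = unit11 α ∧ unit11 α * unit12 α = unit12 α ∧
      unit21 α * unit11 α = unit21 α ∧ unit21 α * unit12 α = unit22 α := by
  obtain ⟨a1, a2, a3, a4, a5, a6, a7, a8⟩ := hα.mul_units
  refine ⟨?_, ?_, ?_, ?_⟩
  · conv_lhs => enter [1]; rw [unit11]
    rw [smul_mul_assoc, sub_mul, one_mul, mul_assoc, a3, mul_neg, a2]; module
  · conv_lhs => enter [1]; rw [unit11]
    rw [smul_mul_assoc, sub_mul, one_mul, mul_assoc, a7, mul_neg, a6]; module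
  · conv_lhs => enter [1]; rw [unit21]
    rw [smul_mul_assoc, sub_mul, a1, a3]; module
  · conv_lhs => enter [1]; rw [unit21]
    rw [smul_mul_assoc, sub_mul, a5, a7]; module

end IsDiracMatrices

/-! ### Zero modes and the Green kernel -/

/-- `(a, b)` solves `D_{h,V} u = 0` in the real `2 × 2` realisation, where `W = -V`. -/
structure IsZeroMode (W : ℝ → ℝ) (h : ℝ) (a b : ℝ → ℝ) : Prop where
  smooth_fst : ContDiff ℝ ∞ a
  smooth_snd : ContDiff ℝ ∞ b
  deriv_fst : ∀ x, HasDerivAt a ((-a x + W x * b x) / h) x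
  deriv_snd : ∀ x, HasDerivAt b ((-(W x * a x) + b x) / h) x

/-- Zero modes `(a, b)` and `(c, d)` which decay exponentially at `+∞` and at `-∞` respectively,
with nonzero Wronskian `w`. -/
structure IsGreenPair (W : ℝ → ℝ) (h w : ℝ) (a b c d : ℝ → ℝ) : Prop where
  right : IsZeroMode W h a b
  left : IsZeroMode W h c d
  wronskian_ne : w ≠ 0
  wronskian : ∀ x, a x * d x - b x * c x = w
  decay : ∃ κ > 0, a =O[atTop] (fun x => Real.exp (-κ * x)) ∧
    b =O[atTop] (fun x => Real.exp (-κ * x)) ∧ c =O[atBot] (fun x => Real.exp (κ * x)) ∧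
    d =O[atBot] (fun x => Real.exp (κ * x))

/-- The kernel built from a Green pair: `(h w)⁻¹` times the column at `x` of the mode which
decays in the direction from `y` to `x`, times the row at `y` of the other mode. -/
noncomputable def greenKernel (α : Fin 2 → Matrix (Fin n) (Fin n) ℂ) (h w : ℝ) (a b c d : ℝ → ℝ)
    (x y : ℝ) : Matrix (Fin n) (Fin n) ℂ :=
  if y ≤ x then
    ((h * w)⁻¹ : ℂ) • cliffordMatrix α (a x * c y) (a x * d y) (b x * c y) (b x * d y)
  else ((h * w)⁻¹ : ℂ) • cliffordMatrix α (c x * a y) (c x * b y) (d x * a y) (d x * b y)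

/-- The column `(p, q)` as an operator, through the first column of matrix units. -/
noncomputable def colOp (α : Fin 2 → Matrix (Fin n) (Fin n) ℂ) (p q : ℝ) (z : Spinor n) :
    Spinor n := p • matCLM (unit11 α) z + q • matCLM (unit21 α) z

/-- The row `(p, q)` as an operator, through the first row of matrix units. -/
noncomputable def rowOp (α : Fin 2 → Matrix (Fin n) (Fin n) ℂ) (p q : ℝ) (z : Spinor n) :
    Spinor n := p • matCLM (unit11 α) z + q • matCLM (unit12 α) z

theorem colOp_rowOp (hα : IsDiracMatrices α) (p q r s : ℝ) (z : Spinor n) :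
    colOp α p q (rowOp α r s z) = matCLM (cliffordMatrix α (p * r) (p * s) (q * r) (q * s)) z := by
  obtain ⟨h1, h2, h3, h4⟩ := hα.unit_products
  simp only [colOp, rowOp, cliffordMatrix, matCLM_add, matCLM_smul, map_add, ← Complex.coe_smul,
    map_smul, ← matCLM_mul, h1, h2, h3, h4, Complex.ofReal_mul]
  module

theorem contDiff_rowOp {p q : ℝ → ℝ} {g : ℝ → Spinor n} (hp : ContDiff ℝ ∞ p)
    (hq : ContDiff ℝ ∞ q) (hg : ContDiff ℝ ∞ g) :
    ContDiff ℝ ∞ fun y => rowOp α (p y) (q y) (g y) :=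
  (hp.smul (((matCLM (unit11 α)).restrictScalars ℝ).contDiff.comp hg)).add
    (hq.smul (((matCLM (unit12 α)).restrictScalars ℝ).contDiff.comp hg))

theorem hasCompactSupport_rowOp (p q : ℝ → ℝ) {g : ℝ → Spinor n} (hg : HasCompactSupport g) :
    HasCompactSupport fun y => rowOp α (p y) (q y) (g y) :=
  hg.mono fun y hy => by
    contrapose! hy
    simp only [Function.mem_support, not_not] at hy ⊢
    simp [rowOp, hy]

theorem contDiff_colOp {p q : ℝ → ℝ} {g : ℝ → Spinor n} (hp : ContDiff ℝ ∞ p)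
    (hq : ContDiff ℝ ∞ q) (hg : ContDiff ℝ ∞ g) :
    ContDiff ℝ ∞ fun y => colOp α (p y) (q y) (g y) :=
  (hp.smul (((matCLM (unit11 α)).restrictScalars ℝ).contDiff.comp hg)).add
    (hq.smul (((matCLM (unit21 α)).restrictScalars ℝ).contDiff.comp hg))

theorem hasDerivAt_colOp {p q : ℝ → ℝ} {g : ℝ → Spinor n} {p' q' x : ℝ} {g' : Spinor n}
    (hp : HasDerivAt p p' x) (hq : HasDerivAt q q' x) (hg : HasDerivAt g g' x) :
    HasDerivAt (fun y => colOp α (p y) (q y) (g y))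
      (colOp α p' q' (g x) + colOp α (p x) (q x) g') x := by
  have h1 := hp.smul (((matCLM (unit11 α)).restrictScalars ℝ).hasFDerivAt.comp_hasDerivAt x hg)
  have h2 := hq.smul (((matCLM (unit21 α)).restrictScalars ℝ).hasFDerivAt.comp_hasDerivAt x hg)
  convert! h1.add h2 using 1
  simp only [colOp, Function.comp, ContinuousLinearMap.coe_restrictScalars']
  abel

theorem norm_colOp_le (p q : ℝ) (z : Spinor n) :
    ‖colOp α p q z‖ ≤ (|p| + |q|) * ((‖matCLM (unit11 α)‖ + ‖matCLM (unit21 α)‖) * ‖z‖) := by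
  have h1 := (matCLM (unit11 α)).le_opNorm z
  have h2 := (matCLM (unit21 α)).le_opNorm z
  have h3 := norm_nonneg (matCLM (unit11 α))
  have h4 := norm_nonneg (matCLM (unit21 α))
  refine (norm_add_le _ _).trans ?_
  rw [norm_smul, norm_smul, Real.norm_eq_abs, Real.norm_eq_abs]
  have h5 : |p| * ‖matCLM (unit11 α) z‖ ≤ |p| * ((‖matCLM (unit11 α)‖ + ‖matCLM (unit21 α)‖) * ‖z‖) := by
    gcongr
    nlinarith [norm_nonneg z]
  have h6 : |q| * ‖matCLM (unit21 α) z‖ ≤ |q| * ((‖matCLM (unit11 α)‖ + ‖matCLM (unit21 α)‖) * ‖z‖) := by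
    gcongr
    nlinarith [norm_nonneg z]
  linarith

/-- The right-hand side of the `2 × 2` system is the derivative for which the Dirac operator
annihilates a column. -/
theorem diracValue_colOp (hα : IsDiracMatrices α) {V : ℝ → ℝ} {h : ℝ} (hh : h ≠ 0)
    (x p q : ℝ) (z : Spinor n) :
    diracValue α V h x (colOp α p q z)
      (colOp α ((-p + -V x * q) / h) ((-(-V x * p) + q) / h) z) = 0 := by
  obtain ⟨a1, a2, a3, a4, -⟩ := hα.mul_units
  have hh' : (h : ℂ) ≠ 0 := by exact_mod_cast hh
  have h1 : ∀ z, matCLM (α 1) z = (-Complex.I) • matCLM (diracJ α) z := fun z => by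
    rw [← matCLM_smul, ← alpha1_eq]
  have h2 : -(Complex.I * (h : ℂ)) * (-Complex.I) = -h := by
    linear_combination (h : ℂ) * Complex.I_mul_I
  rw [diracValue, h1, smul_smul, h2]
  simp only [colOp, map_add, ← Complex.coe_smul, map_smul, ← matCLM_mul, a1, a2, a3, a4,
    ← neg_one_smul ℂ (unit21 α), matCLM_smul]
  push_cast
  match_scalars <;> field_simp <;> ring

section Primitive

variable {F : ℝ → Spinor n}

theorem hasDerivAt_integral_Iic (hF : Continuous F) (hc : HasCompactSupport F) (x : ℝ) :
    HasDerivAt (fun x => ∫ y in Iic x, F y) (F x) x := by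
  have hi := hF.integrable_of_hasCompactSupport hc (μ := volume)
  have h1 : (fun x => ∫ y in Iic x, F y) = fun x => (∫ y in Iic 0, F y) + ∫ y in (0 : ℝ)..x, F y := by
    ext1 x
    rw [← intervalIntegral.integral_Iic_sub_Iic hi.integrableOn hi.integrableOn]
    abel
  rw [h1]
  exact (hF.integral_hasStrictDerivAt 0 x).hasDerivAt.const_add _

theorem integral_Ioi_eq (hF : Continuous F) (hc : HasCompactSupport F) :
    (fun x => ∫ y in Ioi x, F y) = fun x => (∫ y, F y) - ∫ y in Iic x, F y := by
  have hi := hF.integrable_of_hasCompactSupport hc (μ := volume)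
  ext1 x
  rw [← intervalIntegral.integral_Iic_add_Ioi hi.integrableOn hi.integrableOn (b := x)]
  abel

theorem hasDerivAt_integral_Ioi (hF : Continuous F) (hc : HasCompactSupport F) (x : ℝ) :
    HasDerivAt (fun x => ∫ y in Ioi x, F y) (-F x) x := by
  rw [integral_Ioi_eq hF hc]
  exact (hasDerivAt_integral_Iic hF hc x).const_sub _

theorem contDiff_integral_Iic (hF : ContDiff ℝ ∞ F) (hc : HasCompactSupport F) :
    ContDiff ℝ ∞ fun x => ∫ y in Iic x, F y := by
  have h1 := hasDerivAt_integral_Iic hF.continuous hc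
  rw [contDiff_infty_iff_deriv]
  refine ⟨fun x => (h1 x).differentiableAt, ?_⟩
  rwa [show deriv (fun x => ∫ y in Iic x, F y) = F from funext fun x => (h1 x).deriv]

theorem contDiff_integral_Ioi (hF : ContDiff ℝ ∞ F) (hc : HasCompactSupport F) :
    ContDiff ℝ ∞ fun x => ∫ y in Ioi x, F y := by
  rw [integral_Ioi_eq hF.continuous hc]
  exact contDiff_const.sub (contDiff_integral_Iic hF hc)

theorem norm_setIntegral_le (hF : Continuous F) (hc : HasCompactSupport F) (s : Set ℝ) :
    ‖∫ y in s, F y‖ ≤ ∫ y, ‖F y‖ := by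
  have hi := hF.integrable_of_hasCompactSupport hc (μ := volume)
  exact (norm_integral_le_integral_norm _).trans
    (setIntegral_le_integral hi.norm (ae_of_all _ fun y => norm_nonneg _))

theorem eventually_integral_Ioi_eq_zero (hc : HasCompactSupport F) :
    ∀ᶠ x in atTop, ∫ y in Ioi x, F y = 0 := by
  obtain ⟨B, hB⟩ := hc.isCompact.bddAbove
  filter_upwards [eventually_ge_atTop B] with x hx
  refine setIntegral_eq_zero_of_forall_eq_zero fun y hy => image_eq_zero_of_notMem_tsupport ?_
  exact fun h => not_lt.2 (hB h) (hx.trans_lt hy)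

theorem eventually_integral_Iic_eq_zero (hc : HasCompactSupport F) :
    ∀ᶠ x in atBot, ∫ y in Iic x, F y = 0 := by
  obtain ⟨B, hB⟩ := hc.isCompact.bddBelow
  filter_upwards [eventually_lt_atBot B] with x hx
  refine setIntegral_eq_zero_of_forall_eq_zero fun y hy => image_eq_zero_of_notMem_tsupport ?_
  exact fun h => not_lt.2 (hB h) (lt_of_le_of_lt hy hx)

end Primitive

namespace IsGreenPair

variable {V : ℝ → ℝ} {h w : ℝ} {a b c d : ℝ → ℝ}

/-- The action of the Green kernel on a function. -/
noncomputable def greenSolution (α : Fin 2 → Matrix (Fin n) (Fin n) ℂ) (h w : ℝ)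
    (a b c d : ℝ → ℝ) (g : ℝ → Spinor n) (x : ℝ) : Spinor n :=
  (h * w)⁻¹ • (colOp α (a x) (b x) (∫ y in Iic x, rowOp α (c y) (d y) (g y))
    + colOp α (c x) (d x) (∫ y in Ioi x, rowOp α (a y) (b y) (g y)))

theorem memLp_of_decay {κ : ℝ} (hκ : 0 < κ) {v : ℝ → Spinor n} (hv : Continuous v)
    (htop : v =O[atTop] fun x => Real.exp (-κ * x)) (hbot : v =O[atBot] fun x => Real.exp (κ * x)) :
    MemLp v 2 := by
  rw [memLp_two_iff_integrable_sq_norm hv.aestronglyMeasurable]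
  refine LocallyIntegrable.integrable_of_isBigO_atBot_atTop
    (g := fun x => Real.exp (2 * κ * x)) (g' := fun x => Real.exp (-(2 * κ) * x))
    (hv.norm.pow 2).locallyIntegrable ?_ ?_ ?_ ?_
  · refine (hbot.norm_left.pow 2).congr_right fun x => ?_
    rw [← Real.exp_nat_mul]; congr 1; push_cast; ring
  · exact ⟨Iic 0, Iic_mem_atBot 0, integrableOn_exp_mul_Iic (by positivity) 0⟩
  · refine (htop.norm_left.pow 2).congr_right fun x => ?_
    rw [← Real.exp_nat_mul]; congr 1; push_cast; ring
  · exact ⟨Ioi 0, Ioi_mem_atTop 0, integrableOn_exp_mul_Ioi (by linarith) 0⟩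

theorem colOp_isBigO {l : Filter ℝ} {p q E : ℝ → ℝ} (hp : p =O[l] E) (hq : q =O[l] E)
    {z : ℝ → Spinor n} {C : ℝ} (hz : ∀ x, ‖z x‖ ≤ C) :
    (fun x => colOp α (p x) (q x) (z x)) =O[l] E := by
  refine IsBigO.trans (IsBigO.of_bound ((‖matCLM (unit11 α)‖ + ‖matCLM (unit21 α)‖) * C)
    (Eventually.of_forall fun x => ?_)) (hp.norm_left.add hq.norm_left)
  refine (norm_colOp_le _ _ _).trans ?_
  have h1 : 0 ≤ |p x| + |q x| := by positivity
  simp only [Real.norm_eq_abs]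
  rw [abs_of_nonneg h1, mul_comm]
  gcongr
  exact hz x

/-- Variation of constants: the Green kernel solves `D_{h,V} v = g`. -/
theorem isClassicalSolution (hG : IsGreenPair (fun x => -V x) h w a b c d)
    (hα : IsDiracMatrices α) (hh : h ≠ 0) {g : ℝ → Spinor n} (hg : ContDiff ℝ ∞ g)
    (hgc : HasCompactSupport g) :
    IsClassicalSolution α V h g (greenSolution α h w a b c d g) := by
  have hF1 : ContDiff ℝ ∞ fun y => rowOp α (c y) (d y) (g y) :=
    contDiff_rowOp hG.left.smooth_fst hG.left.smooth_snd hg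
  have hF2 : ContDiff ℝ ∞ fun y => rowOp α (a y) (b y) (g y) :=
    contDiff_rowOp hG.right.smooth_fst hG.right.smooth_snd hg
  have hc1 := hasCompactSupport_rowOp (α := α) c d hgc
  have hc2 := hasCompactSupport_rowOp (α := α) a b hgc
  have hsm : ContDiff ℝ ∞ (greenSolution α h w a b c d g) :=
    ((contDiff_colOp hG.right.smooth_fst hG.right.smooth_snd (contDiff_integral_Iic hF1 hc1)).add
      (contDiff_colOp hG.left.smooth_fst hG.left.smooth_snd
        (contDiff_integral_Ioi hF2 hc2))).const_smul _
  refine ⟨hsm, ?_, fun x => ?_⟩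
  · obtain ⟨κ, hκ, ha, hb, hc, hd⟩ := hG.decay
    have b1 := fun x => norm_setIntegral_le hF1.continuous hc1 (Iic x)
    have b2 := fun x => norm_setIntegral_le hF2.continuous hc2 (Ioi x)
    have hfun : greenSolution α h w a b c d g = (h * w)⁻¹ • fun x =>
      colOp α (a x) (b x) (∫ y in Iic x, rowOp α (c y) (d y) (g y))
        + colOp α (c x) (d x) (∫ y in Ioi x, rowOp α (a y) (b y) (g y)) := rfl
    refine memLp_of_decay hκ hsm.continuous ?_ ?_ <;> rw [hfun]
    · refine IsBigO.const_smul_left ?_ _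
      refine (colOp_isBigO (α := α) ha hb b1).congr' ?_ EventuallyEq.rfl
      filter_upwards [eventually_integral_Ioi_eq_zero hc2] with x hx
      simp [hx, colOp]
    · refine IsBigO.const_smul_left ?_ _
      refine (colOp_isBigO (α := α) hc hd b2).congr' ?_ EventuallyEq.rfl
      filter_upwards [eventually_integral_Iic_eq_zero hc1] with x hx
      simp [hx, colOp]
  · have hd := ((hasDerivAt_colOp (α := α) (hG.right.deriv_fst x) (hG.right.deriv_snd x)
      (hasDerivAt_integral_Iic hF1.continuous hc1 x)).add
      (hasDerivAt_colOp (α := α) (hG.left.deriv_fst x) (hG.left.deriv_snd x)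
        (hasDerivAt_integral_Ioi hF2.continuous hc2 x))).const_smul (h * w)⁻¹
    have hd' : deriv (greenSolution α h w a b c d g) x = _ := hd.deriv
    have z1 := diracValue_colOp (V := V) hα hh x (a x) (b x) (∫ y in Iic x, rowOp α (c y) (d y) (g y))
    have z2 := diracValue_colOp (V := V) hα hh x (c x) (d x) (∫ y in Ioi x, rowOp α (a y) (b y) (g y))
    set P := ∫ y in Iic x, rowOp α (c y) (d y) (g y)
    set Q := ∫ y in Ioi x, rowOp α (a y) (b y) (g y)
    have hjump : colOp α (a x) (b x) (rowOp α (c x) (d x) (g x))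
        + colOp α (c x) (d x) (-rowOp α (a x) (b x) (g x)) = w • matCLM (diracJ α) (g x) := by
      have e1 : ∀ (p q : ℝ) (z : Spinor n), colOp α p q (-z) = -colOp α p q z := by
        intro p q z; simp only [colOp, map_neg, smul_neg]; abel
      rw [e1, colOp_rowOp hα, colOp_rowOp hα, ← hG.wronskian x, diracJ_eq_units,
        sub_eq_add_neg (unit12 α), ← neg_one_smul ℂ (unit21 α)]
      simp only [cliffordMatrix, matCLM_add, matCLM_smul, ← Complex.coe_smul, Complex.ofReal_mul,
        Complex.ofReal_sub]
      module
    have hJ : (-(Complex.I * (h : ℂ))) • matCLM (α 1) (matCLM (diracJ α) (g x)) = (h : ℂ) • g x := by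
      rw [diracJ, matCLM_smul, map_smul, hα.matCLM_sq, smul_smul]
      congr 1
      linear_combination (-(h : ℂ)) * Complex.I_mul_I
    have hsplit : ∀ u w₁ w₂ : Spinor n, diracValue α V h x u (w₁ + w₂) =
        diracValue α V h x u w₁ + (-(Complex.I * (h : ℂ))) • matCLM (α 1) w₂ := by
      intro u w₁ w₂; simp only [diracValue, map_add, smul_add]; abel
    rw [hd']
    have hre : colOp α ((-a x + -V x * b x) / h) ((-(-V x * a x) + b x) / h) P
          + colOp α (a x) (b x) (rowOp α (c x) (d x) (g x))
          + (colOp α ((-c x + -V x * d x) / h) ((-(-V x * c x) + d x) / h) Q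
          + colOp α (c x) (d x) (-rowOp α (a x) (b x) (g x)))
        = colOp α ((-a x + -V x * b x) / h) ((-(-V x * a x) + b x) / h) P
          + colOp α ((-c x + -V x * d x) / h) ((-(-V x * c x) + d x) / h) Q
          + w • matCLM (diracJ α) (g x) := by
      rw [← hjump]; abel
    rw [hre]
    change diracValue α V h x ((h * w)⁻¹ • (colOp α (a x) (b x) P + colOp α (c x) (d x) Q)) _ = _
    rw [← Complex.coe_smul, ← Complex.coe_smul, diracValue_smul, hsplit, diracValue_add, z1, z2,
      ← Complex.coe_smul, map_smul, smul_comm _ (w : ℂ), hJ]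
    have hw' : (w : ℂ) ≠ 0 := by exact_mod_cast hG.wronskian_ne
    have hh' : (h : ℂ) ≠ 0 := by exact_mod_cast hh
    push_cast
    match_scalars
    field_simp

theorem smooth_greenKernel (hG : IsGreenPair (fun x => -V x) h w a b c d) (i j : Fin n) :
    ContDiffOn ℝ ∞ (fun p : ℝ × ℝ => greenKernel α h w a b c d p.1 p.2 i j) {p | p.1 ≠ p.2} := by
  have key : ∀ {p q r s : ℝ → ℝ}, ContDiff ℝ ∞ p → ContDiff ℝ ∞ q → ContDiff ℝ ∞ r →
      ContDiff ℝ ∞ s → ContDiff ℝ ∞ (fun z : ℝ × ℝ => (((h * w)⁻¹ : ℂ) •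
        cliffordMatrix α (p z.1 * r z.2) (p z.1 * s z.2) (q z.1 * r z.2) (q z.1 * s z.2)) i j) := by
    intro p q r s hp hq hr hs
    have e : ∀ {f g : ℝ → ℝ}, ContDiff ℝ ∞ f → ContDiff ℝ ∞ g →
        ContDiff ℝ ∞ fun z : ℝ × ℝ => ((f z.1 * g z.2 : ℝ) : ℂ) := fun hf hg =>
      Complex.ofRealCLM.contDiff.comp ((hf.comp contDiff_fst).mul (hg.comp contDiff_snd))
    simp only [cliffordMatrix, Matrix.smul_apply, Matrix.add_apply, smul_eq_mul]
    exact contDiff_const.mul (((((e hp hr).mul contDiff_const).add ((e hp hs).mul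
      contDiff_const)).add ((e hq hr).mul contDiff_const)).add ((e hq hs).mul contDiff_const))
  rintro ⟨x, y⟩ (hxy : x ≠ y)
  refine ContDiffAt.contDiffWithinAt ?_
  rcases hxy.lt_or_gt with hlt | hlt
  · refine (key hG.left.smooth_fst hG.left.smooth_snd hG.right.smooth_fst
      hG.right.smooth_snd).contDiffAt.congr_of_eventuallyEq ?_
    filter_upwards [(isOpen_lt continuous_fst continuous_snd).mem_nhds hlt] with z hz
    rw [greenKernel, if_neg (not_le.2 hz)]
  · refine (key hG.right.smooth_fst hG.right.smooth_snd hG.left.smooth_fst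
      hG.left.smooth_snd).contDiffAt.congr_of_eventuallyEq ?_
    filter_upwards [(isOpen_lt continuous_snd continuous_fst).mem_nhds hlt] with z hz
    rw [greenKernel, if_pos (le_of_lt hz)]

/-- The Green solution is the integral of `g` against the Green kernel. -/
theorem integral_greenKernel (hG : IsGreenPair (fun x => -V x) h w a b c d)
    (hα : IsDiracMatrices α) {g : ℝ → Spinor n} (hg : ContDiff ℝ ∞ g)
    (hgc : HasCompactSupport g) (x : ℝ) :
    Integrable (fun y => matAct (greenKernel α h w a b c d x y) (g y)) ∧
      ∫ y, matAct (greenKernel α h w a b c d x y) (g y) = greenSolution α h w a b c d g x := by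
  have hi1 : Integrable fun y => rowOp α (c y) (d y) (g y) :=
    (contDiff_rowOp hG.left.smooth_fst hG.left.smooth_snd hg).continuous.integrable_of_hasCompactSupport
      (hasCompactSupport_rowOp (α := α) c d hgc)
  have hi2 : Integrable fun y => rowOp α (a y) (b y) (g y) :=
    (contDiff_rowOp hG.right.smooth_fst hG.right.smooth_snd hg).continuous.integrable_of_hasCompactSupport
      (hasCompactSupport_rowOp (α := α) a b hgc)
  let L : ℝ → ℝ → Spinor n →L[ℝ] Spinor n := fun p q => (h * w)⁻¹ •
    (p • (matCLM (unit11 α)).restrictScalars ℝ + q • (matCLM (unit21 α)).restrictScalars ℝ)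
  have hL : ∀ p q z, L p q z = (h * w)⁻¹ • colOp α p q z := fun p q z => rfl
  have hcast : ((h * w)⁻¹ : ℂ) = (((h * w)⁻¹ : ℝ) : ℂ) := by push_cast; rfl
  have e1 : EqOn (fun y => matAct (greenKernel α h w a b c d x y) (g y))
      (fun y => L (a x) (b x) (rowOp α (c y) (d y) (g y))) (Iic x) := by
    intro y hy
    simp only [hL, colOp_rowOp hα, matAct_eq, greenKernel, if_pos (mem_Iic.1 hy)]
    rw [matCLM_smul, hcast, Complex.coe_smul]
  have e2 : EqOn (fun y => matAct (greenKernel α h w a b c d x y) (g y))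
      (fun y => L (c x) (d x) (rowOp α (a y) (b y) (g y))) (Ioi x) := by
    intro y hy
    simp only [hL, colOp_rowOp hα, matAct_eq, greenKernel, if_neg (not_le.2 (mem_Ioi.1 hy))]
    rw [matCLM_smul, hcast, Complex.coe_smul]
  have i1 := (integrableOn_congr_fun e1 measurableSet_Iic).2
    ((L (a x) (b x)).integrable_comp hi1).integrableOn
  have i2 := (integrableOn_congr_fun e2 measurableSet_Ioi).2
    ((L (c x) (d x)).integrable_comp hi2).integrableOn
  refine ⟨?_, ?_⟩
  · rw [← integrableOn_univ, ← Iic_union_Ioi (a := x)]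
    exact i1.union i2
  · rw [← intervalIntegral.integral_Iic_add_Ioi i1 i2, setIntegral_congr_fun measurableSet_Iic e1,
      setIntegral_congr_fun measurableSet_Ioi e2,
      (L (a x) (b x)).integral_comp_comm hi1.integrableOn,
      (L (c x) (d x)).integral_comp_comm hi2.integrableOn, hL, hL, ← smul_add]
    rfl

theorem isGreenKernel (hG : IsGreenPair (fun x => -V x) h w a b c d)
    (hα : IsDiracMatrices α) (hVc : Continuous V) {δ : ℝ} (hδ : 0 < δ)
    (hV : ∀ x, |V x| ≤ 1 - δ) (hh : h ≠ 0) :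
    IsGreenKernel α V h (greenKernel α h w a b c d) := by
  obtain ⟨T, hT⟩ := exists_isDiracInverse hα hVc hδ hV hh
    fun g hg hgc => ⟨_, hG.isClassicalSolution hα hh hg hgc⟩
  refine ⟨T, hT, hG.smooth_greenKernel, fun f g hf hg hfc hgc _ F hF => ?_⟩
  have h1 := hT.ae_eq hα hVc hV hh (hf.continuous.memLp_of_hasCompactSupport hfc)
    (hG.isClassicalSolution hα hh hf hfc) hF
  refine integral_congr_ae ?_
  filter_upwards [h1] with x hx
  obtain ⟨h2, h3⟩ := hG.integral_greenKernel hα hf hfc x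
  rw [hx, ← h3]
  exact (_root_.integral_inner h2 (g x)).symm

end IsGreenPair

end Clifford

/-! ### Uniqueness of the off-diagonal kernel -/

section KernelUniqueness

variable {n : ℕ}

/-- Two off-diagonal kernels of the same operator agree: otherwise test their difference against
bumps concentrated near a point where it does not vanish. -/
theorem IsOffDiagonalKernel.eq_of_ne {T : SpinorL2 n →L[ℂ] SpinorL2 n}
    {K K' : ℝ → ℝ → Matrix (Fin n) (Fin n) ℂ} (hK : IsOffDiagonalKernel T K)
    (hK' : IsOffDiagonalKernel T K') {x₀ y₀ : ℝ} (hne : x₀ ≠ y₀) : K x₀ y₀ = K' x₀ y₀ := by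
  ext i j
  by_contra hcon
  set c : ℂ := K x₀ y₀ i j - K' x₀ y₀ i j with hc
  have hc0 : c ≠ 0 := sub_ne_zero.2 hcon
  have hUo : IsOpen {p : ℝ × ℝ | p.1 ≠ p.2} := isOpen_ne_fun continuous_fst continuous_snd
  have hKc := (hK.smooth i j).continuousOn
  have hKc' := (hK'.smooth i j).continuousOn
  let ρ : ℝ × ℝ → ℝ := fun p => ((starRingEnd ℂ) c * (K p.1 p.2 i j - K' p.1 p.2 i j)).re
  have hρ : ContinuousOn ρ {p : ℝ × ℝ | p.1 ≠ p.2} :=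
    Complex.continuous_re.comp_continuousOn (continuousOn_const.mul (hKc.sub hKc'))
  have hρ0 : 0 < ρ (x₀, y₀) := by
    have h1 : ρ (x₀, y₀) = Complex.normSq c := by
      simp only [ρ, ← hc]
      rw [mul_comm, Complex.mul_conj, Complex.ofReal_re]
    rw [h1]
    exact Complex.normSq_pos.2 hc0
  have hnhds : {p : ℝ × ℝ | p.1 ≠ p.2} ∩ {p | 0 < ρ p} ∈ 𝓝 (x₀, y₀) :=
    inter_mem (hUo.mem_nhds hne) ((hρ.continuousAt (hUo.mem_nhds hne)).eventually_const_lt hρ0)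
  obtain ⟨ε, hε, hball⟩ := Metric.nhds_basis_closedBall.mem_iff.1 hnhds
  let φ : ContDiffBump x₀ := ⟨ε / 2, ε, by positivity, by linarith⟩
  let ψ : ContDiffBump y₀ := ⟨ε / 2, ε, by positivity, by linarith⟩
  have hφs : ContDiff ℝ ∞ φ := φ.contDiff
  have hψs : ContDiff ℝ ∞ ψ := ψ.contDiff
  have hsub : ∀ x ∈ tsupport φ, ∀ y ∈ tsupport ψ, x ≠ y ∧ 0 < ρ (x, y) := by
    intro x hx y hy
    rw [φ.tsupport_eq] at hx
    rw [ψ.tsupport_eq] at hy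
    refine hball (?_ : (x, y) ∈ Metric.closedBall (x₀, y₀) ε)
    rw [← closedBall_prod_same]
    exact ⟨hx, hy⟩
  -- The function `(x, y) ↦ φ x ψ y`, supported in a box away from the diagonal.
  let Θ : ℝ × ℝ → ℝ := fun p => φ p.1 * ψ p.2
  have hΘsupp : tsupport Θ ⊆ tsupport φ ×ˢ tsupport ψ := by
    refine closure_minimal (fun p hp => ?_) ((isClosed_tsupport _).prod (isClosed_tsupport _))
    have := mul_ne_zero_iff.1 (Function.mem_support.1 hp)
    exact ⟨subset_tsupport _ this.1, subset_tsupport _ this.2⟩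
  have hΘc : HasCompactSupport Θ :=
    (φ.hasCompactSupport.isCompact.prod ψ.hasCompactSupport.isCompact).of_isClosed_subset
      (isClosed_tsupport _) hΘsupp
  have hΘcont : Continuous Θ := (φ.continuous.comp continuous_fst).mul (ψ.continuous.comp continuous_snd)
  have hΘU : tsupport Θ ⊆ {p : ℝ × ℝ | p.1 ≠ p.2} := fun p hp =>
    (hsub _ (hΘsupp hp).1 _ (hΘsupp hp).2).1
  have hcont : ∀ {f : ℝ × ℝ → ℂ}, ContinuousOn f {p : ℝ × ℝ | p.1 ≠ p.2} →
      Integrable (fun p => (Θ p : ℂ) * f p) := by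
    intro f hf
    have h1 : HasCompactSupport fun p => (Θ p : ℂ) * f p :=
      (hΘc.comp_left Complex.ofReal_zero).mul_right
    refine Continuous.integrable_of_hasCompactSupport ?_ h1
    refine ContinuousOn.continuous_of_tsupport_subset
      ((Complex.continuous_ofReal.comp hΘcont).continuousOn.mul hf) hUo ?_
    refine (closure_mono fun p hp => ?_).trans hΘU
    intro h0
    exact hp (by simp [h0])
  let f : ℝ → Spinor n := fun y => ψ y • EuclideanSpace.single j (1 : ℂ)
  have hf : ContDiff ℝ ∞ f := hψs.smul contDiff_const
  have hfc : HasCompactSupport f := ψ.hasCompactSupport.smul_right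
  have hf2 : MemLp f 2 := hf.continuous.memLp_of_hasCompactSupport hfc
  let g : ℝ → Spinor n := fun x => φ x • EuclideanSpace.single i (1 : ℂ)
  have hg : ContDiff ℝ ∞ g := hφs.smul contDiff_const
  have hgc : HasCompactSupport g := φ.hasCompactSupport.smul_right
  have key : ∀ {L : ℝ → ℝ → Matrix (Fin n) (Fin n) ℂ}, IsOffDiagonalKernel T L →
      ∫ x, inner ℂ (g x) (T (hf2.toLp f) x) = ∫ p : ℝ × ℝ, (Θ p : ℂ) * L p.1 p.2 i j := by
    intro L hL
    rw [hL.kernel f g hf hg hfc hgc ?_ _ hf2.coeFn_toLp]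
    · rw [Measure.volume_eq_prod, integral_prod _ (hcont (hL.smooth i j).continuousOn)]
      refine integral_congr_ae (ae_of_all _ fun x => integral_congr_ae (ae_of_all _ fun y => ?_))
      have e1 : matAct (L x y) (EuclideanSpace.single j (1 : ℂ)) i = L x y i j := by
        simp [matAct]
      simp only [Θ, f, g]
      rw [← Complex.coe_smul, ← Complex.coe_smul, matAct_eq, map_smul, inner_smul_left,
        inner_smul_right, EuclideanSpace.inner_single_left, ← matAct_eq, e1]
      simp
      ring
    · rw [Set.disjoint_left]
      intro x hx hx'
      have h1 : x ∈ tsupport ψ := tsupport_smul_subset_left _ _ hx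
      have h2 : x ∈ tsupport φ := tsupport_smul_subset_left _ _ hx'
      exact (hsub x h2 x h1).1 rfl
  have h1 : ∫ p : ℝ × ℝ, (Θ p : ℂ) * ((starRingEnd ℂ) c * (K p.1 p.2 i j - K' p.1 p.2 i j)) = 0 := by
    have h2 := (key hK).symm.trans (key hK')
    have h3 : ∀ p : ℝ × ℝ, (Θ p : ℂ) * ((starRingEnd ℂ) c * (K p.1 p.2 i j - K' p.1 p.2 i j)) =
        (starRingEnd ℂ) c * ((Θ p : ℂ) * K p.1 p.2 i j - (Θ p : ℂ) * K' p.1 p.2 i j) := fun p => by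
      ring
    simp only [h3]
    rw [integral_const_mul, integral_sub (hcont hKc) (hcont hKc'), h2, sub_self, mul_zero]
  have h2 : ∫ p : ℝ × ℝ, Θ p * ρ p = 0 := by
    have h3 := congrArg Complex.re h1
    have h4 := integral_re (𝕜 := ℂ) (hcont (f := fun p => (starRingEnd ℂ) c *
      (K p.1 p.2 i j - K' p.1 p.2 i j)) (continuousOn_const.mul (hKc.sub hKc')))
    simp only [RCLike.re_to_complex, h3, Complex.zero_re, Complex.re_ofReal_mul] at h4
    exact h4
  have h3 : Continuous fun p => Θ p * ρ p := by
    refine ContinuousOn.continuous_of_tsupport_subset (hΘcont.continuousOn.mul hρ) hUo ?_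
    refine (closure_mono fun p hp => ?_).trans hΘU
    intro h0
    exact hp (by simp [h0])
  have h4 : 0 < ∫ p : ℝ × ℝ, Θ p * ρ p := by
    refine h3.integral_pos_of_hasCompactSupport_nonneg_nonzero hΘc.mul_right (fun p => ?_)
      (x := (x₀, y₀)) ?_
    · by_cases hp : p ∈ tsupport Θ
      · exact mul_nonneg (mul_nonneg φ.nonneg ψ.nonneg)
          (hsub _ (hΘsupp hp).1 _ (hΘsupp hp).2).2.le
      · simp [image_eq_zero_of_notMem_tsupport hp]
    · have e1 : φ x₀ = 1 := φ.one_of_mem_closedBall (by simp [φ]; positivity)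
      have e2 : ψ y₀ = 1 := ψ.one_of_mem_closedBall (by simp [ψ]; positivity)
      simp only [Θ, e1, e2, one_mul]
      exact hρ0.ne'
  exact h4.ne' h2

theorem IsGreenKernel.eq_of_ne {α : Fin 2 → Matrix (Fin n) (Fin n) ℂ} {V : ℝ → ℝ} {h : ℝ}
    {K K' : ℝ → ℝ → Matrix (Fin n) (Fin n) ℂ} (hK : IsGreenKernel α V h K)
    (hK' : IsGreenKernel α V h K') {x y : ℝ} (hne : x ≠ y) : K x y = K' x y := by
  obtain ⟨T, hT, hTK⟩ := hK
  obtain ⟨T', hT', hTK'⟩ := hK'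
  obtain rfl := hT.unique hT'
  exact hTK.eq_of_ne hTK' hne

end KernelUniqueness

/-! ### Zero modes from Riccati solutions -/

/-- The first component of the mode decaying at `+∞`; the second is `r` times it. -/
noncomputable def rightMode (W : ℝ → ℝ) (h : ℝ) (r : ℝ → ℝ) (x : ℝ) : ℝ :=
  Real.exp ((∫ t in (0 : ℝ)..x, (W t * r t - 1)) / h)

/-- The second component of the mode decaying at `-∞`; the first is `s` times it. -/
noncomputable def leftMode (W : ℝ → ℝ) (h : ℝ) (s : ℝ → ℝ) (x : ℝ) : ℝ :=
  Real.exp ((∫ t in (0 : ℝ)..x, (1 - W t * s t)) / h)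

theorem contDiff_exp_primitive {f : ℝ → ℝ} (hf : ContDiff ℝ ∞ f) (h : ℝ) :
    ContDiff ℝ ∞ fun x => Real.exp ((∫ t in (0 : ℝ)..x, f t) / h) := by
  have h1 : ContDiff ℝ ∞ fun x => ∫ t in (0 : ℝ)..x, f t := by
    have h2 := fun x => (hf.continuous.integral_hasStrictDerivAt 0 x).hasDerivAt
    rw [contDiff_infty_iff_deriv]
    refine ⟨fun x => (h2 x).differentiableAt, ?_⟩
    rwa [show deriv (fun x => ∫ t in (0 : ℝ)..x, f t) = f from funext fun x => (h2 x).deriv]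
  exact (h1.div_const h).exp

theorem hasDerivAt_exp_primitive {f : ℝ → ℝ} (hf : Continuous f) (h x : ℝ) :
    HasDerivAt (fun x => Real.exp ((∫ t in (0 : ℝ)..x, f t) / h))
      (Real.exp ((∫ t in (0 : ℝ)..x, f t) / h) * (f x / h)) x :=
  ((hf.integral_hasStrictDerivAt 0 x).hasDerivAt.div_const h).exp

theorem exp_primitive_div {f : ℝ → ℝ} (hf : Continuous f) (h x y : ℝ) :
    Real.exp ((∫ t in (0 : ℝ)..x, f t) / h) =
      Real.exp ((∫ t in y..x, f t) / h) * Real.exp ((∫ t in (0 : ℝ)..y, f t) / h) := by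
  rw [← Real.exp_add, ← add_div, add_comm, intervalIntegral.integral_add_adjacent_intervals
    (hf.intervalIntegrable _ _) (hf.intervalIntegrable _ _)]

/-- The reflected Riccati solution solves the equation for the quotient of the components of a mode
decaying at `-∞`. -/
theorem IsRiccatiSolution.hasDerivAt_comp_neg {W s : ℝ → ℝ} {κ h : ℝ}
    (hs : IsRiccatiSolution (fun x => W (-x)) κ h s) (x : ℝ) :
    HasDerivAt (fun x => s (-x)) ((W x - 2 * s (-x) + W x * s (-x) ^ 2) / h) x := by
  have h1 := (hs.hasDerivAt (-x)).comp x (hasDerivAt_neg x)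
  simp only [neg_neg] at h1
  convert! h1 using 1
  ring

namespace IsGapFunction

variable {W : ℝ → ℝ} {δ h : ℝ} {r s : ℝ → ℝ}

theorem one_sub_mul_pos (hW : IsGapFunction W δ) {p q : ℝ} (hp : |p| ≤ 1 - δ) (hq : |q| ≤ 1 - δ) :
    0 < 1 - p * q := by
  have h1 : |p * q| ≤ (1 - δ) * (1 - δ) := by
    rw [abs_mul]
    exact mul_le_mul hp hq (abs_nonneg _) ((abs_nonneg _).trans hp)
  have h2 := hW.pos
  have h3 := hW.le_half
  nlinarith [le_abs_self (p * q)]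

theorem mul_le (hW : IsGapFunction W δ) {q : ℝ} (hq : |q| ≤ 1 - δ) (x : ℝ) : W x * q ≤ 1 - δ := by
  have h1 : |W x * q| ≤ 1 * (1 - δ) := by
    rw [abs_mul, abs_of_pos (hW.pos' x)]
    exact mul_le_mul (hW.lt_one x).le hq (abs_nonneg _) zero_le_one
  linarith [le_abs_self (W x * q)]

/-- The modes `(E₊, r E₊)` and `(s E₋, E₋)` form a Green pair. -/
theorem isGreenPair (hW : IsGapFunction W δ) (hh : 0 < h) (hr : IsRiccatiSolution W (1 - δ) h r)
    (hs : IsRiccatiSolution (fun x => W (-x)) (1 - δ) h s) :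
    IsGreenPair W h (1 - r 0 * s 0) (rightMode W h r) (fun x => r x * rightMode W h r x)
      (fun x => s (-x) * leftMode W h (fun x => s (-x)) x) (leftMode W h fun x => s (-x)) := by
  have hWs := hW.bddSmooth.smooth
  have hrs := hr.contDiff hWs
  have hss : ContDiff ℝ ∞ fun x => s (-x) := (hs.contDiff (hWs.comp contDiff_neg)).comp contDiff_neg
  have hf : ContDiff ℝ ∞ fun t => W t * r t - 1 := (hWs.mul hrs).sub contDiff_const
  have hg : ContDiff ℝ ∞ fun t => 1 - W t * s (-t) := contDiff_const.sub (hWs.mul hss)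
  have ha' := hasDerivAt_exp_primitive hf.continuous h
  have hd' := hasDerivAt_exp_primitive hg.continuous h
  set a := rightMode W h r with ha_def
  set d := leftMode W h (fun x => s (-x)) with hd_def
  have ha : ∀ x, HasDerivAt a (a x * ((W x * r x - 1) / h)) x := ha'
  have hd : ∀ x, HasDerivAt d (d x * ((1 - W x * s (-x)) / h)) x := hd'
  have has : ContDiff ℝ ∞ a := contDiff_exp_primitive hf h
  have hds : ContDiff ℝ ∞ d := contDiff_exp_primitive hg h
  have hright : IsZeroMode W h a fun x => r x * a x := by
    refine ⟨has, hrs.mul has, fun x => ?_, fun x => ?_⟩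
    · convert! ha x using 1; ring
    · convert! (hr.hasDerivAt x).mul (ha x) using 1; ring
  have hleft : IsZeroMode W h (fun x => s (-x) * d x) d := by
    refine ⟨hss.mul hds, hds, fun x => ?_, fun x => ?_⟩
    · convert! (hs.hasDerivAt_comp_neg x).mul (hd x) using 1; ring
    · convert! hd x using 1; ring
  refine ⟨hright, hleft, (hW.one_sub_mul_pos (hr.abs_le 0) (hs.abs_le 0)).ne', fun x => ?_,
    δ / h, div_pos hW.pos hh, ?_⟩
  · -- The Wronskian is constant because the system is trace free.
    have hw : ∀ x, HasDerivAt (fun x => a x * d x - r x * a x * (s (-x) * d x)) 0 x := by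
      intro x
      convert! ((hright.deriv_fst x).mul (hleft.deriv_snd x)).sub
        ((hright.deriv_snd x).mul (hleft.deriv_fst x)) using 1
      ring
    have h1 := is_const_of_deriv_eq_zero (fun x => (hw x).differentiableAt)
      (fun x => (hw x).deriv) x 0
    rw [h1]
    have e1 : a 0 = 1 := by simp [ha_def, rightMode]
    have e2 : d 0 = 1 := by simp [hd_def, leftMode]
    simp [e1, e2]
  · have ba : a =O[atTop] fun x => Real.exp (-(δ / h) * x) := by
      refine IsBigO.of_bound 1 ?_
      filter_upwards [eventually_ge_atTop 0] with x hx
      rw [Real.norm_eq_abs, Real.norm_eq_abs, Real.abs_exp, one_mul, ha_def, rightMode, Real.abs_exp,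
        Real.exp_le_exp]
      have h1 := intervalIntegral.integral_mono_on (μ := volume) hx
        (hf.continuous.intervalIntegrable 0 x) ((continuous_const (y := -δ)).intervalIntegrable 0 x)
        (fun t _ => by linarith [hW.mul_le (hr.abs_le t) t])
      simp only [intervalIntegral.integral_const, sub_zero, smul_eq_mul] at h1
      rw [div_le_iff₀ hh]
      have : -(δ / h) * x * h = x * -δ := by field_simp
      linarith
    have bd : d =O[atBot] fun x => Real.exp (δ / h * x) := by
      refine IsBigO.of_bound 1 ?_
      filter_upwards [eventually_le_atBot 0] with x hx
      rw [Real.norm_eq_abs, Real.norm_eq_abs, Real.abs_exp, one_mul, hd_def, leftMode, Real.abs_exp,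
        Real.exp_le_exp]
      have h1 := intervalIntegral.integral_mono_on (μ := volume) hx
        ((continuous_const (y := δ)).intervalIntegrable x 0) (hg.continuous.intervalIntegrable x 0)
        (fun t _ => by linarith [hW.mul_le (hs.abs_le (-t)) t])
      simp only [intervalIntegral.integral_const, zero_sub, smul_eq_mul] at h1
      rw [div_le_iff₀ hh, intervalIntegral.integral_symm]
      have : δ / h * x * h = x * δ := by field_simp
      linarith
    have bmul : ∀ {l : Filter ℝ} {p f E : ℝ → ℝ}, (∀ x, |p x| ≤ 1 - δ) → f =O[l] E →
        (fun x => p x * f x) =O[l] E := by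
      intro l p f E hp hf
      have h1 : p =O[l] fun _ => (1 : ℝ) :=
        IsBigO.of_bound (1 - δ) (Eventually.of_forall fun x => by simpa using hp x)
      simpa using h1.mul hf
    exact ⟨ba, bmul hr.abs_le ba, bmul (fun x => hs.abs_le (-x)) bd, bd⟩

end IsGapFunction

/-! ### Half angles and the zero-energy trajectory -/

namespace IsGapFunction

variable {W : ℝ → ℝ} {δ : ℝ}

theorem mul_one_add_rootFun_sq (hW : IsGapFunction W δ) (x : ℝ) :
    W x * (1 + rootFun W x ^ 2) = 2 * rootFun W x := by
  linear_combination hW.rootFun_eq x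

theorem phaseSlope_mul (hW : IsGapFunction W δ) (x : ℝ) :
    phaseSlope W x * (1 + rootFun W x ^ 2) = 1 - rootFun W x ^ 2 := by
  rw [← hW.one_sub_mul_rootFun]
  linear_combination (-rootFun W x) * hW.mul_one_add_rootFun_sq x

/-- `arctan r₀` is half of `arcsin W`; its derivative is `W' / (2 √(1 - W²))`. -/
theorem hasDerivAt_arctan_rootFun (hW : IsGapFunction W δ) (x : ℝ) :
    HasDerivAt (fun x => Real.arctan (rootFun W x)) (deriv W x / (2 * phaseSlope W x)) x := by
  have h1 := (hW.bddSmooth_rootFun.hasDerivAt x).arctan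
  convert! h1 using 1
  have h2 : HasDerivAt (fun x => W x * (1 + rootFun W x ^ 2))
      (deriv W x * (1 + rootFun W x ^ 2) + W x * (2 * rootFun W x * deriv (rootFun W) x)) x := by
    have h3 := ((hW.bddSmooth_rootFun.hasDerivAt x).pow 2).const_add 1
    convert! (hW.bddSmooth.hasDerivAt x).mul h3 using 1
    simp
  have h3 : HasDerivAt (fun x => W x * (1 + rootFun W x ^ 2)) (2 * deriv (rootFun W) x) x := by
    rw [show (fun x => W x * (1 + rootFun W x ^ 2)) = fun x => 2 * rootFun W x from
      funext hW.mul_one_add_rootFun_sq]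
    exact (hW.bddSmooth_rootFun.hasDerivAt x).const_mul 2
  have h4 := h2.unique h3
  have h5 := hW.one_sub_mul_rootFun x
  have h6 := hW.phaseSlope_pos x
  have h7 : 0 < 1 + rootFun W x ^ 2 := by positivity
  field_simp
  linear_combination h4 + 2 * deriv (rootFun W) x * h5

theorem eq_sin_mul_cos (hW : IsGapFunction W δ) (x : ℝ) :
    W x = 2 * (Real.sin (Real.arctan (rootFun W x)) * Real.cos (Real.arctan (rootFun W x))) ∧
      phaseSlope W x = Real.cos (Real.arctan (rootFun W x)) ^ 2
        - Real.sin (Real.arctan (rootFun W x)) ^ 2 ∧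
      Real.sin (Real.arctan (rootFun W x)) = rootFun W x * Real.cos (Real.arctan (rootFun W x)) := by
  have h1 := hW.mul_one_add_rootFun_sq x
  have h2 := hW.phaseSlope_mul x
  have h3 : Real.cos (Real.arctan (rootFun W x)) ^ 2 * (1 + rootFun W x ^ 2) = 1 := by
    rw [Real.cos_sq_arctan]
    have : 0 < 1 + rootFun W x ^ 2 := by positivity
    field_simp
  have h4 : Real.sin (Real.arctan (rootFun W x))
      = rootFun W x * Real.cos (Real.arctan (rootFun W x)) := by
    rw [Real.sin_arctan, Real.cos_arctan]; ring
  refine ⟨?_, ?_, h4⟩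
  · rw [h4]
    linear_combination Real.cos (Real.arctan (rootFun W x)) ^ 2 * h1 - W x * h3
  · rw [h4]
    linear_combination Real.cos (Real.arctan (rootFun W x)) ^ 2 * h2 - phaseSlope W x * h3

end IsGapFunction

/-- Along a zero-energy trajectory the momentum is `±√(1 - V²)` with constant sign, which is the sign
of `x - y`, and the spin angle is `±` the variation of `½ arcsin (-V)`. -/
theorem IsZeroEnergyTrajectory.exists_sign {V : ℝ → ℝ} {τ : ℝ} {γ ϖ : ℝ → ℝ} {y x δ : ℝ}
    (ht : IsZeroEnergyTrajectory V τ γ ϖ y x) (hW : IsGapFunction (fun x => -V x) δ) :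
    (y < x ∧ ϖ 0 = phaseSlope (fun x => -V x) y ∧ spinAngle V γ τ =
      Real.arctan (rootFun (fun x => -V x) x) - Real.arctan (rootFun (fun x => -V x) y)) ∨
    (x < y ∧ ϖ 0 = -phaseSlope (fun x => -V x) y ∧ spinAngle V γ τ =
      Real.arctan (rootFun (fun x => -V x) y) - Real.arctan (rootFun (fun x => -V x) x)) := by
  set W : ℝ → ℝ := fun x => -V x with hWdef
  have hτ := ht.pos
  have h0 : (0 : ℝ) ∈ Icc 0 τ := ⟨le_rfl, hτ.le⟩
  have h1 : τ ∈ Icc 0 τ := ⟨hτ.le, le_rfl⟩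
  have hγc : ContinuousOn γ (Icc 0 τ) := ht.smooth_pos.continuousOn
  have hsqrt : ∀ t ∈ Icc 0 τ, √(1 - ϖ t ^ 2) = W (γ t) := by
    intro t ht'
    have := ht.energy t ht'
    rw [hamiltonian] at this
    simp only [hWdef]; linarith
  have hpos : ∀ t ∈ Icc 0 τ, 0 < 1 - ϖ t ^ 2 := by
    intro t ht'
    have h2 := abs_lt.1 (ht.mom_lt t ht')
    nlinarith [h2.1, h2.2]
  have hsq : EqOn (ϖ ^ 2) ((fun t => phaseSlope W (γ t)) ^ 2) (Icc 0 τ) := by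
    intro t ht'
    simp only [Pi.pow_apply, hW.phaseSlope_sq, ← hsqrt t ht', Real.sq_sqrt (hpos t ht').le]
    ring
  have hsign := isPreconnected_Icc.eq_or_eq_neg_of_sq_eq ht.smooth_mom.continuousOn
    (hW.bddSmooth_phaseSlope.smooth.continuous.comp_continuousOn hγc) hsq
    fun {t} _ => (hW.phaseSlope_pos (γ t)).ne'
  obtain ⟨ε, hε, hϖ⟩ : ∃ ε : ℝ, (ε = 1 ∨ ε = -1) ∧
      ∀ t ∈ Icc 0 τ, ϖ t = ε * phaseSlope W (γ t) := by
    rcases hsign with h | h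
    · exact ⟨1, .inl rfl, fun t ht' => by rw [h ht', one_mul]; rfl⟩
    · exact ⟨-1, .inr rfl, fun t ht' => by rw [h ht']; simp⟩
  have hεsq : ε * ε = 1 := by rcases hε with rfl | rfl <;> norm_num
  have hγ' : ∀ t ∈ Ioo 0 τ, HasDerivAt γ (ε * (phaseSlope W (γ t) / W (γ t))) t := by
    intro t ht'
    have htI := Ioo_subset_Icc_self ht'
    have h2 := (ht.deriv_pos t htI).hasDerivAt (Icc_mem_nhds ht'.1 ht'.2)
    have h3 : HasDerivAt (fun p => hamiltonian V (γ t) p)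
        (-(-(2 * ϖ t) / (2 * √(1 - ϖ t ^ 2)))) (ϖ t) := by
      have h4 := (((hasDerivAt_pow 2 (ϖ t)).const_sub 1).sqrt (hpos t htI).ne').neg.sub_const
        (V (γ t))
      simpa [hamiltonian] using h4
    rw [h3.deriv, hsqrt t htI, hϖ t htI] at h2
    convert! h2 using 1
    have := (hW.pos' (γ t)).ne'
    field_simp
  have hmono : StrictMonoOn (fun t => ε * γ t) (Icc 0 τ) := by
    refine strictMonoOn_of_deriv_pos (convex_Icc 0 τ) (continuousOn_const.mul hγc) fun t ht' => ?_
    rw [interior_Icc] at ht'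
    rw [((hγ' t ht').const_mul ε).deriv, ← mul_assoc, hεsq, one_mul]
    exact div_pos (hW.phaseSlope_pos _) (hW.pos' _)
  have hlt : ε * y < ε * x := by
    have := hmono h0 h1 hτ
    simpa [ht.start, ht.finish] using this
  have hVW : ∀ z, deriv V z = -deriv W z := fun z => by
    rw [hWdef, deriv.fun_neg, neg_neg]
  have hangle : spinAngle V γ τ = ε * Real.arctan (rootFun W x) - ε * Real.arctan (rootFun W y) := by
    have h2 : ∀ t ∈ Ioo 0 τ, HasDerivAt (fun t => ε * Real.arctan (rootFun W (γ t)))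
        (deriv V (γ t) / (2 * V (γ t))) t := by
      intro t ht'
      have h3 := ((hW.hasDerivAt_arctan_rootFun (γ t)).comp t (hγ' t ht')).const_mul ε
      convert! h3 using 1
      have h4 := (hW.pos' (γ t)).ne'
      have h5 := (hW.phaseSlope_pos (γ t)).ne'
      have h6 : V (γ t) = -W (γ t) := by simp [hWdef]
      rw [hVW, h6]
      field_simp
      linear_combination (-deriv W (γ t)) * hεsq
    have hcont : ContinuousOn (fun t => ε * Real.arctan (rootFun W (γ t))) (Icc 0 τ) :=
      continuousOn_const.mul (Real.continuous_arctan.comp_continuousOn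
        (hW.bddSmooth_rootFun.smooth.continuous.comp_continuousOn hγc))
    have hint : IntervalIntegrable (fun t => deriv V (γ t) / (2 * V (γ t))) volume 0 τ := by
      refine ContinuousOn.intervalIntegrable_of_Icc hτ.le ?_
      have e : (fun t => deriv V (γ t) / (2 * V (γ t)))
          = fun t => deriv W (γ t) / (2 * W (γ t)) := by
        ext t
        rw [hVW, show V (γ t) = -W (γ t) by simp [hWdef], mul_neg, neg_div_neg_eq]
      rw [e]
      exact (hW.bddSmooth.deriv.smooth.continuous.comp_continuousOn hγc).div
        (continuousOn_const.mul (hW.bddSmooth.smooth.continuous.comp_continuousOn hγc))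
        fun t _ => mul_ne_zero two_ne_zero (hW.pos' (γ t)).ne'
    rw [spinAngle, intervalIntegral.integral_eq_sub_of_hasDerivAt_of_le hτ.le hcont h2 hint,
      ht.start, ht.finish]
  have hϖ0 := hϖ 0 h0
  rw [ht.start] at hϖ0
  rcases hε with rfl | rfl
  · exact .inl ⟨by linarith, by linarith, by linarith⟩
  · exact .inr ⟨by linarith, by linarith, by linarith⟩

/-! ### Spin matrices in the Clifford realisation -/

section Leading

variable {n : ℕ} {α : Fin 2 → Matrix (Fin n) (Fin n) ℂ}

theorem IsDiracMatrices.diracJ_mul_cliffordMatrix (hα : IsDiracMatrices α) (a b c d : ℝ) :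
    diracJ α * cliffordMatrix α a b c d = cliffordMatrix α c d (-a) (-b) := by
  obtain ⟨-, -, a3, a4, -, -, a7, a8⟩ := hα.mul_units
  simp only [cliffordMatrix, mul_add, mul_smul_comm, a3, a4, a7, a8]
  push_cast
  module

theorem smul_projPlus (V : ℝ → ℝ) (y p : ℝ) (hp : √(1 - p ^ 2) = -V y) (hV : 0 < -V y) :
    ((-V y : ℝ) : ℂ) • projPlus α (Complex.I * (p : ℂ))
      = cliffordMatrix α (-V y / 2) ((1 + p) / 2) ((1 - p) / 2) (-V y / 2) := by
  have h1 : 0 < 1 - p ^ 2 := by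
    by_contra! hcon
    rw [Real.sqrt_eq_zero_of_nonpos hcon] at hp
    linarith
  have h2 : ((1 : ℂ) + (Complex.I * (p : ℂ)) ^ 2) ^ (1 / 2 : ℂ) = ((-V y : ℝ) : ℂ) := by
    have h3 : (1 : ℂ) + (Complex.I * (p : ℂ)) ^ 2 = ((1 - p ^ 2 : ℝ) : ℂ) := by
      rw [mul_pow, Complex.I_sq]; push_cast; ring
    rw [h3, ← hp, Real.sqrt_eq_rpow, Complex.ofReal_cpow h1.le]
    norm_num
  have h4 : (Complex.I * (p : ℂ)) • α 1 = (p : ℂ) • diracJ α := by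
    rw [diracJ, smul_smul, mul_comm]
  have h5 : (V y : ℂ) ≠ 0 := by exact_mod_cast (neg_pos.1 hV).ne
  rw [projPlus, symbolS, h2, h4, one_eq_units (α := α), 
    alpha0_eq_units (α := α), diracJ_eq_units (α := α), cliffordMatrix]
  push_cast
  match_scalars <;> field_simp <;> ring

theorem rotation_mul_cliffordMatrix (hα : IsDiracMatrices α) (θ a b c d : ℝ) :
    ((Real.cos θ : ℂ) • (1 : Matrix (Fin n) (Fin n) ℂ) - (Complex.I * (Real.sin θ : ℂ)) • α 1)
      * cliffordMatrix α a b c d = cliffordMatrix α (Real.cos θ * a - Real.sin θ * c)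
        (Real.cos θ * b - Real.sin θ * d) (Real.cos θ * c + Real.sin θ * a)
        (Real.cos θ * d + Real.sin θ * b) := by
  have h1 : (Complex.I * (Real.sin θ : ℂ)) • α 1 = (Real.sin θ : ℂ) • diracJ α := by
    rw [diracJ, smul_smul, mul_comm]
  rw [h1, sub_mul, smul_mul_assoc, smul_mul_assoc, one_mul, hα.diracJ_mul_cliffordMatrix]
  simp only [cliffordMatrix]
  push_cast
  module

end Leading

/-! ### Asymptotics of the Green kernel -/

section Asymptotics

variable {n : ℕ} {α : Fin 2 → Matrix (Fin n) (Fin n) ℂ}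

theorem hasCompleteExpansion_cliffordMatrix {f₁ f₂ f₃ f₄ : ℝ → ℝ} {a₁ a₂ a₃ a₄ : ℝ}
    (h₁ : HasPowerExpansion f₁ a₁) (h₂ : HasPowerExpansion f₂ a₂) (h₃ : HasPowerExpansion f₃ a₃)
    (h₄ : HasPowerExpansion f₄ a₄) :
    HasCompleteExpansion fun h => cliffordMatrix α (f₁ h) (f₂ h) (f₃ h) (f₄ h)
      - cliffordMatrix α a₁ a₂ a₃ a₄ := by
  have h := (((h₁.hasCompleteExpansion_smul (unit11 α)).add
    (h₂.hasCompleteExpansion_smul (unit12 α))).add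
    (h₃.hasCompleteExpansion_smul (unit21 α))).add (h₄.hasCompleteExpansion_smul (unit22 α))
  convert! h using 2
  simp only [cliffordMatrix]
  push_cast
  module

namespace IsGapFunction

variable {W : ℝ → ℝ} {δ : ℝ}

theorem rootFun_comp_neg (W : ℝ → ℝ) (x : ℝ) : rootFun (fun x => W (-x)) (-x) = rootFun W x := by
  simp [rootFun]

theorem subrootFun_comp_neg (W : ℝ → ℝ) (x : ℝ) :
    subrootFun (fun x => W (-x)) (-x) = -subrootFun W x := by
  have h1 : rootFun (fun x => W (-x)) = fun x => rootFun W (-x) := rfl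
  rw [subrootFun, h1, deriv_comp_neg, subrootFun]
  simp [phaseSlope]

/-- The amplitude of the kernel: with the normalising factor of `scalarFactor` the leading
coefficient becomes a product of cosines of half angles. -/
theorem amplitude_eq (hW : IsGapFunction W δ) (x y : ℝ) :
    (1 - W x ^ 2) ^ (1 / 4 : ℝ) * (1 - W y ^ 2) ^ (1 / 4 : ℝ) *
      Real.exp (∫ t in y..x, W t * subrootFun W t) * (1 - rootFun W y * rootFun W y)⁻¹
      = Real.cos (Real.arctan (rootFun W x)) * Real.cos (Real.arctan (rootFun W y)) := by
  have hq : ∀ z, ((1 - W z ^ 2) ^ (1 / 4 : ℝ)) ^ 2 = phaseSlope W z := by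
    intro z
    rw [← Real.rpow_natCast, ← Real.rpow_mul (hW.one_sub_sq_pos z).le, phaseSlope,
      Real.sqrt_eq_rpow]
    norm_num
  have hr : ∀ z, 0 < 1 - rootFun W z ^ 2 := fun z => by
    nlinarith [hW.rootFun_nonneg z, hW.rootFun_lt_one z]
  have hx := Real.rpow_pos_of_pos (hW.one_sub_sq_pos x) (1 / 4)
  have hy := Real.rpow_pos_of_pos (hW.one_sub_sq_pos y) (1 / 4)
  have hcx := Real.cos_arctan_pos (rootFun W x)
  have hcy := Real.cos_arctan_pos (rootFun W y)
  have hE := hW.exp_integral_subrootFun y x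
  rw [← pow_two (rootFun W y)]
  have hry := hr y
  refine (sq_eq_sq₀ (by positivity) (by positivity)).1 ?_
  simp only [mul_pow, hq, Real.cos_sq_arctan]
  have px := hW.phaseSlope_mul x
  have py := hW.phaseSlope_mul y
  have hx1 : (1 + rootFun W x ^ 2) ≠ 0 := by positivity
  have hy1 : (1 + rootFun W y ^ 2) ≠ 0 := by positivity
  rw [eq_div_of_mul_eq hx1 px, eq_div_of_mul_eq hy1 py, eq_div_of_mul_eq (hr x).ne' hE]
  have := (hr x).ne'
  field_simp

end IsGapFunction

end Asymptotics

/-! ### The Green kernel in factorised form -/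

section Factorisation

theorem scalarFactor_neg (V : ℝ → ℝ) (x y h : ℝ) :
    scalarFactor (fun x => -V x) x y h = scalarFactor V x y h := by
  simp [scalarFactor]

/-- What remains of a scalar multiple of the kernel after division by `scalarFactor`: the exponent
`e` collects the corrections to the phase, and `1 - p` is the Wronskian of the modes normalised
at `y`. -/
noncomputable def amplitude (W : ℝ → ℝ) (x y e p : ℝ) : ℝ :=
  (1 - W x ^ 2) ^ (1 / 4 : ℝ) * (1 - W y ^ 2) ^ (1 / 4 : ℝ) * Real.exp e * (1 - p)⁻¹

/-- The kernel built from the modes of the Riccati solutions `r` and `s`. -/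
noncomputable def riccatiKernel {n : ℕ} (α : Fin 2 → Matrix (Fin n) (Fin n) ℂ) (W : ℝ → ℝ)
    (h : ℝ) (r s : ℝ → ℝ) : ℝ → ℝ → Matrix (Fin n) (Fin n) ℂ :=
  greenKernel α h (1 - r 0 * s 0) (rightMode W h r) (fun x => r x * rightMode W h r x)
    (fun x => s (-x) * leftMode W h (fun x => s (-x)) x) (leftMode W h fun x => s (-x))

namespace IsGapFunction

variable {W r s : ℝ → ℝ} {δ h : ℝ}

theorem scalarFactor_mul_amplitude (hW : IsGapFunction W δ) (x y e p : ℝ) :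
    scalarFactor W x y h * amplitude W x y e p
      = h⁻¹ * Real.exp (-|∫ t in y..x, phaseSlope W t| / h) * Real.exp e * (1 - p)⁻¹ := by
  have hx := Real.rpow_pos_of_pos (hW.one_sub_sq_pos x) (1 / 4)
  have hy := Real.rpow_pos_of_pos (hW.one_sub_sq_pos y) (1 / 4)
  simp only [scalarFactor, amplitude, phaseSlope]
  field_simp

theorem integral_mul_sub_one (hW : IsGapFunction W δ) (hr : Continuous r) (x y : ℝ) :
    (∫ t in y..x, (W t * r t - 1)) / h = -(∫ t in y..x, phaseSlope W t) / h
      + ∫ t in y..x, W t * ((r t - rootFun W t) / h) := by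
  have hq := hW.bddSmooth_phaseSlope.smooth.continuous
  have hc : Continuous fun t => W t * ((r t - rootFun W t) / h) :=
    hW.bddSmooth.smooth.continuous.mul
      ((hr.sub hW.bddSmooth_rootFun.smooth.continuous).div_const h)
  have hq' : Continuous fun t => -phaseSlope W t / h := hq.neg.div_const h
  rw [← intervalIntegral.integral_div, ← intervalIntegral.integral_neg,
    ← intervalIntegral.integral_div, ← intervalIntegral.integral_add
      (hq'.intervalIntegrable _ _) (hc.intervalIntegrable _ _)]
  refine intervalIntegral.integral_congr fun t _ => ?_
  have := hW.one_sub_mul_rootFun t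
  linear_combination (-1 / h) * this

theorem rightMode_eq (hW : IsGapFunction W δ) (hr : Continuous r) {x y : ℝ} (hxy : y < x) :
    rightMode W h r x = Real.exp (-|∫ t in y..x, phaseSlope W t| / h) *
      Real.exp (∫ t in y..x, W t * ((r t - rootFun W t) / h)) * rightMode W h r y := by
  rw [abs_of_nonneg (intervalIntegral.integral_nonneg hxy.le fun t _ => (hW.phaseSlope_pos t).le),
    ← Real.exp_add, ← hW.integral_mul_sub_one hr]
  exact exp_primitive_div ((hW.bddSmooth.smooth.continuous.mul hr).sub continuous_const) h x y

theorem leftMode_eq (hW : IsGapFunction W δ) (hs : Continuous s) {x y : ℝ} (hxy : x < y) :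
    leftMode W h s x = Real.exp (-|∫ t in y..x, phaseSlope W t| / h) *
      Real.exp (-∫ t in y..x, W t * ((s t - rootFun W t) / h)) * leftMode W h s y := by
  have h1 := hW.integral_mul_sub_one (h := h) hs x y
  have h2 : 0 ≤ ∫ t in x..y, phaseSlope W t :=
    intervalIntegral.integral_nonneg hxy.le fun t _ => (hW.phaseSlope_pos t).le
  rw [intervalIntegral.integral_symm, neg_nonneg] at h2
  have h3 : (∫ t in y..x, (1 - W t * s t)) / h = -(∫ t in y..x, (W t * s t - 1)) / h := by
    rw [← intervalIntegral.integral_neg]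
    simp only [neg_sub]
  have h4 : (∫ t in y..x, (1 - W t * s t)) / h = -|∫ t in y..x, phaseSlope W t| / h
      + -∫ t in y..x, W t * ((s t - rootFun W t) / h) := by
    rw [h3, neg_div, h1, abs_of_nonpos h2]
    ring
  rw [← Real.exp_add, ← h4]
  exact exp_primitive_div (continuous_const.sub (hW.bddSmooth.smooth.continuous.mul hs)) h x y

variable {n : ℕ} {α : Fin 2 → Matrix (Fin n) (Fin n) ℂ}

/-- The Wronskian at `y` is the product of the values of the modes with `1 - r y * s (-y)`. -/
theorem inv_wronskian_mul (hW : IsGapFunction W δ) (hh : 0 < h)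
    (hr : IsRiccatiSolution W (1 - δ) h r) (hs : IsRiccatiSolution (fun x => W (-x)) (1 - δ) h s)
    (y : ℝ) : (1 - r 0 * s 0)⁻¹ * (rightMode W h r y * leftMode W h (fun x => s (-x)) y)
      = (1 - r y * s (-y))⁻¹ := by
  have h1 := (hW.isGreenPair hh hr hs).wronskian y
  have h2 := (hW.isGreenPair hh hr hs).wronskian_ne
  have h3 := (hW.one_sub_mul_pos (hr.abs_le y) (hs.abs_le (-y))).ne'
  field_simp
  linear_combination h1

theorem riccatiKernel_of_lt (hW : IsGapFunction W δ) (hh : 0 < h)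
    (hr : IsRiccatiSolution W (1 - δ) h r) (hs : IsRiccatiSolution (fun x => W (-x)) (1 - δ) h s)
    {x y Y : ℝ} (hxy : y < x) (hY : Y = amplitude W x y
      (∫ t in y..x, W t * ((r t - rootFun W t) / h)) (r y * s (-y))) :
    riccatiKernel α W h r s x y = (scalarFactor W x y h : ℂ) •
      cliffordMatrix α (Y * s (-y)) Y (r x * (Y * s (-y))) (r x * Y) := by
  have hrc : Continuous r := (hr.contDiff hW.bddSmooth.smooth).continuous
  have h1 := hW.inv_wronskian_mul hh hr hs y
  have h2 := hW.rightMode_eq (h := h) hrc hxy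
  have h3 := hW.scalarFactor_mul_amplitude (h := h) x y
    (∫ t in y..x, W t * ((r t - rootFun W t) / h)) (r y * s (-y))
  rw [← hY, ← h1] at h3
  have h4 : scalarFactor W x y h * Y = (h * (1 - r 0 * s 0))⁻¹ *
      (rightMode W h r x * leftMode W h (fun x => s (-x)) y) := by
    rw [h3, h2, mul_inv]; ring
  have h5 : (scalarFactor W x y h : ℂ) * Y = ((h : ℂ) * ((1 - r 0 * s 0 : ℝ) : ℂ))⁻¹ *
      (rightMode W h r x * leftMode W h (fun x => s (-x)) y) := by
    exact_mod_cast congrArg ((↑) : ℝ → ℂ) h4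
  rw [riccatiKernel, greenKernel, if_pos hxy.le]
  simp only [cliffordMatrix, smul_add, smul_smul, Complex.ofReal_mul]
  congr 1
  · congr 1
    · congr 1
      · congr 1
        linear_combination (-(s (-y)) : ℂ) * h5
      · congr 1
        linear_combination -h5
    · congr 1
      linear_combination (-(r x * s (-y)) : ℂ) * h5
  · congr 1
    linear_combination (-(r x) : ℂ) * h5

theorem riccatiKernel_of_gt (hW : IsGapFunction W δ) (hh : 0 < h)
    (hr : IsRiccatiSolution W (1 - δ) h r) (hs : IsRiccatiSolution (fun x => W (-x)) (1 - δ) h s)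
    {x y Y : ℝ} (hxy : x < y) (hY : Y = amplitude W x y
      (-∫ t in y..x, W t * ((s (-t) - rootFun W t) / h)) (r y * s (-y))) :
    riccatiKernel α W h r s x y = (scalarFactor W x y h : ℂ) •
      cliffordMatrix α (Y * s (-x)) (Y * s (-x) * r y) Y (Y * r y) := by
  have hsc : Continuous fun x => s (-x) :=
    (hs.contDiff hW.comp_neg.bddSmooth.smooth).continuous.comp continuous_neg
  have h1 := hW.inv_wronskian_mul hh hr hs y
  have h2 := hW.leftMode_eq (h := h) hsc hxy
  have h3 := hW.scalarFactor_mul_amplitude (h := h) x y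
    (-∫ t in y..x, W t * ((s (-t) - rootFun W t) / h)) (r y * s (-y))
  rw [← hY, ← h1] at h3
  have h4 : scalarFactor W x y h * Y = (h * (1 - r 0 * s 0))⁻¹ *
      (leftMode W h (fun x => s (-x)) x * rightMode W h r y) := by
    rw [h3, h2, mul_inv]; ring
  have h5 : (scalarFactor W x y h : ℂ) * Y = ((h : ℂ) * ((1 - r 0 * s 0 : ℝ) : ℂ))⁻¹ *
      (leftMode W h (fun x => s (-x)) x * rightMode W h r y) := by
    exact_mod_cast congrArg ((↑) : ℝ → ℂ) h4
  rw [riccatiKernel, greenKernel, if_neg hxy.not_ge]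
  simp only [cliffordMatrix, smul_add, smul_smul, Complex.ofReal_mul]
  congr 1
  · congr 1
    · congr 1
      · congr 1
        linear_combination (-(s (-x)) : ℂ) * h5
      · congr 1
        linear_combination (-(s (-x) * r y) : ℂ) * h5
    · congr 1
      linear_combination -h5
  · congr 1
    linear_combination (-(r y) : ℂ) * h5

end IsGapFunction

end Factorisation

/-! ### Expansion of the factors -/

section Expansion

namespace IsGapFunction

variable {W : ℝ → ℝ} {δ : ℝ} {r s : ℝ → ℝ → ℝ}

theorem hasPowerExpansion_riccati_neg (hW : IsGapFunction W δ)
    (hs : ∀ h ∈ Ioc (0 : ℝ) 1, IsRiccatiSolution (fun x => W (-x)) (1 - δ) h (s h)) (x : ℝ) :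
    HasPowerExpansion (fun h => s h (-x)) (rootFun W x) := by
  simpa only [rootFun_comp_neg] using hW.comp_neg.hasPowerExpansion_riccati hs (-x)

theorem hasPowerExpansion_exponent_neg (hW : IsGapFunction W δ)
    (hs : ∀ h ∈ Ioc (0 : ℝ) 1, IsRiccatiSolution (fun x => W (-x)) (1 - δ) h (s h)) (a b : ℝ) :
    HasPowerExpansion (fun h => -∫ t in a..b, W t * ((s h (-t) - rootFun W t) / h))
      (∫ t in a..b, W t * subrootFun W t) := by
  have h1 := hW.comp_neg.hasPowerExpansion_exponent hs (-a) (-b)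
  have e1 : ∀ h, (∫ t in -a..-b, W (-t) * ((s h t - rootFun (fun x => W (-x)) t) / h))
      = -∫ t in a..b, W t * ((s h (-t) - rootFun W t) / h) := by
    intro h
    rw [intervalIntegral.integral_symm, ← intervalIntegral.integral_comp_neg]
    simp only [neg_neg, rootFun_comp_neg]
  have e2 : (∫ t in -a..-b, W (-t) * subrootFun (fun x => W (-x)) t)
      = ∫ t in a..b, W t * subrootFun W t := by
    rw [intervalIntegral.integral_symm, ← intervalIntegral.integral_comp_neg,
      ← intervalIntegral.integral_neg]
    simp only [neg_neg, subrootFun_comp_neg, mul_neg]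
  simpa only [e1, e2] using h1

theorem hasPowerExpansion_amplitude (hW : IsGapFunction W δ)
    (hr : ∀ h ∈ Ioc (0 : ℝ) 1, IsRiccatiSolution W (1 - δ) h (r h))
    (hs : ∀ h ∈ Ioc (0 : ℝ) 1, IsRiccatiSolution (fun x => W (-x)) (1 - δ) h (s h)) (x y : ℝ)
    {e : ℝ → ℝ} (he : HasPowerExpansion e (∫ t in y..x, W t * subrootFun W t)) :
    HasPowerExpansion (fun h => amplitude W x y (e h) (r h y * s h (-y)))
      (Real.cos (Real.arctan (rootFun W x)) * Real.cos (Real.arctan (rootFun W y))) := by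
  have h1 : (1 - rootFun W y * rootFun W y) ≠ 0 := by
    nlinarith [hW.rootFun_nonneg y, hW.rootFun_lt_one y]
  rw [← hW.amplitude_eq x y]
  exact (he.exp.const_mul _).mul (((HasPowerExpansion.const 1).sub
    ((hW.hasPowerExpansion_riccati hr y).mul (hW.hasPowerExpansion_riccati_neg hs y))).inv h1)

end IsGapFunction

end Expansion

/-! ### Identification of the leading matrix -/

theorem IsAdmissiblePotential.exists_isGapFunction {V : ℝ → ℝ} (hV : IsAdmissiblePotential V) :
    ∃ δ, IsGapFunction (fun x => -V x) δ := by
  obtain ⟨δ, hδ, hgap⟩ := hV.gap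
  refine ⟨δ, ?_, hδ.1, fun x => by linarith [hgap x], fun x => by linarith [hgap x]⟩
  simpa using (BddSmooth.mk hV.smooth hV.bounded).const_mul (-1)

section Leading

variable {n : ℕ} {α : Fin 2 → Matrix (Fin n) (Fin n) ℂ} {V : ℝ → ℝ} {τ x y δ : ℝ} {γ ϖ : ℝ → ℝ}

/-- The leading matrix in half angles `a = arctan r₀(x)`, `b = arctan r₀(y)`: a product of a column
and a row which are those of the limits of the two decaying modes. -/
theorem leadingMatrix_eq (hα : IsDiracMatrices α) (hW : IsGapFunction (fun x => -V x) δ)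
    (ht : IsZeroEnergyTrajectory V τ γ ϖ y x) {a b : ℝ}
    (ha : a = Real.arctan (rootFun (fun x => -V x) x))
    (hb : b = Real.arctan (rootFun (fun x => -V x) y)) :
    (y < x ∧ leadingMatrix α V γ ϖ τ y = cliffordMatrix α (Real.cos a * Real.sin b)
      (Real.cos a * Real.cos b) (Real.sin a * Real.sin b) (Real.sin a * Real.cos b)) ∨
    (x < y ∧ leadingMatrix α V γ ϖ τ y = cliffordMatrix α (Real.sin a * Real.cos b)
      (Real.sin a * Real.sin b) (Real.cos a * Real.cos b) (Real.cos a * Real.sin b)) := by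
  have h0 : √(1 - ϖ 0 ^ 2) = -V y := by
    have := ht.energy 0 ⟨le_rfl, ht.pos.le⟩
    rw [hamiltonian, ht.start] at this
    linarith
  obtain ⟨e1, e2, -⟩ := hW.eq_sin_mul_cos y
  have e3 := Real.sin_sq_add_cos_sq b
  rw [← hb] at e1 e2
  rw [leadingMatrix, smul_projPlus V y _ h0 (hW.pos' y), rotation_mul_cliffordMatrix hα]
  rcases ht.exists_sign hW with ⟨hlt, hp, hang⟩ | ⟨hlt, hp, hang⟩
  · refine .inl ⟨hlt, ?_⟩
    rw [hang, hp, ← ha, ← hb, Real.cos_sub, Real.sin_sub, e1, e2]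
    congr 1 <;> grind
  · refine .inr ⟨hlt, ?_⟩
    rw [hang, hp, ← ha, ← hb, Real.cos_sub, Real.sin_sub, e1, e2]
    congr 1 <;> grind

end Leading

theorem theorem2 {n : ℕ} (α : Fin 2 → Matrix (Fin n) (Fin n) ℂ) (hα : IsDiracMatrices α)
    (V : ℝ → ℝ) (hV : IsAdmissiblePotential V) :
    (∀ h ∈ Ioc (0 : ℝ) 1, ∃ K : ℝ → ℝ → Matrix (Fin n) (Fin n) ℂ, IsGreenKernel α V h K) ∧
    ∀ G : ℝ → ℝ → ℝ → Matrix (Fin n) (Fin n) ℂ,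
      (∀ h ∈ Ioc (0 : ℝ) 1, IsGreenKernel α V h (G h)) →
      ∀ x y : ℝ, x ≠ y → ∀ (τ : ℝ) (γ ϖ : ℝ → ℝ), IsZeroEnergyTrajectory V τ γ ϖ y x →
        ∃ R : ℝ → Matrix (Fin n) (Fin n) ℂ, HasCompleteExpansion R ∧
          ∀ h ∈ Ioc (0 : ℝ) 1,
            G h x y = (scalarFactor V x y h : ℂ) • (leadingMatrix α V γ ϖ τ y + R h) := by
  obtain ⟨δ, hW⟩ := hV.exists_isGapFunction
  set W : ℝ → ℝ := fun x => -V x with hWdef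
  have hκ : 1 - δ < 1 := by linarith [hW.pos]
  choose! r hr using fun h (hh : h ∈ Ioc (0 : ℝ) 1) =>
    exists_isRiccatiSolution hW.bddSmooth.smooth.continuous hκ hW.abs_le hh.1
  choose! s hs using fun h (hh : h ∈ Ioc (0 : ℝ) 1) =>
    exists_isRiccatiSolution hW.comp_neg.bddSmooth.smooth.continuous hκ hW.comp_neg.abs_le hh.1
  have hK : ∀ h ∈ Ioc (0 : ℝ) 1, IsGreenKernel α V h (riccatiKernel α W h (r h) (s h)) :=
    fun h hh => (hW.isGreenPair hh.1 (hr h hh) (hs h hh)).isGreenKernel hα hV.smooth.continuous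
      hW.pos (fun x => by simpa [hWdef] using hW.abs_le x) hh.1.ne'
  refine ⟨fun h hh => ⟨_, hK h hh⟩, fun G hG x y hxy τ γ ϖ ht => ?_⟩
  have hGK : ∀ h ∈ Ioc (0 : ℝ) 1, G h x y = riccatiKernel α W h (r h) (s h) x y :=
    fun h hh => (hG h hh).eq_of_ne (hK h hh) hxy
  have hsin := fun z => (hW.eq_sin_mul_cos z).2.2
  rcases leadingMatrix_eq hα hW ht rfl rfl with ⟨hlt, hM⟩ | ⟨hlt, hM⟩
  · have hY := hW.hasPowerExpansion_amplitude hr hs x y (hW.hasPowerExpansion_exponent hr y x)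
    have hsy := hW.hasPowerExpansion_riccati_neg hs y
    have hrx := hW.hasPowerExpansion_riccati hr x
    refine ⟨_, hasCompleteExpansion_cliffordMatrix (α := α) (hY.mul hsy) hY
      (hrx.mul (hY.mul hsy)) (hrx.mul hY), fun h hh => ?_⟩
    rw [hGK h hh, hW.riccatiKernel_of_lt hh.1 (hr h hh) (hs h hh) hlt rfl, scalarFactor_neg, hM,
      ← hWdef, hsin x, hsin y]
    congr 1
    rw [← sub_eq_iff_eq_add']
    congr 2 <;> ring
  · have hY := hW.hasPowerExpansion_amplitude hr hs x y (hW.hasPowerExpansion_exponent_neg hs y x)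
    have hsx := hW.hasPowerExpansion_riccati_neg hs x
    have hry := hW.hasPowerExpansion_riccati hr y
    refine ⟨_, hasCompleteExpansion_cliffordMatrix (α := α) (hY.mul hsx) ((hY.mul hsx).mul hry) hY
      (hY.mul hry), fun h hh => ?_⟩
    rw [hGK h hh, hW.riccatiKernel_of_gt hh.1 (hr h hh) (hs h hh) hlt rfl, scalarFactor_neg, hM,
      ← hWdef, hsin x, hsin y]
    congr 1
    rw [← sub_eq_iff_eq_add']
    congr 2 <;> ring
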